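/- **Conventions.** Quantum circuits are finite sequences of Hadamard, Phase and Toffoli gates; ancilla qubits start in $|0\rangle$. A quantum polynomial-time algorithm is a family of circuits whose descriptions are written down by a classical polynomial-time machine. Circuits are described by bit strings of length polynomially related to the number of qubits plus the number of gates. An *injective one-way function hard to invert by quantum computers* is a family of injective functions $f_n:\{0,1\}^n\to\{0,1\}^{p(n)}$, $p$ a polynomial, computable in time $n^{O(1)}$, such that for every quantum polynomial-time algorithm $A$ and every $d$, $\Pr_{x\in\{0,1\}^n}[f_n(A(f_n(x)))=f_n(x)]<n^{-d}$ for all sufficiently large $n$. *The Harlow–Hayden decoding task.* The input is a description of a quantum circuit $C$ which maps $|0\cdots0\rangle$ to a state $|\psi\rangle_{RBH}$, where $R$ has at least one qubit and $B$ is a single qubit, with the promise that some unitary acting on $R$ alone puts $B$ and the rightmost qubit of $R$ into the joint state $|\Phi^+\rangle=\frac1{\sqrt2}(|00\rangle+|11\rangle)$. The task is done *in quantum polynomial time with fidelity $c$* if some classical polynomial-time machine turns every such description into a description of a quantum circuit, acting on $R$ and ancilla qubits, after which the reduced state $\rho$ of $B$ and the rightmost qubit of $R$ satisfies $\langle\Phi^+|\rho|\Phi^+\rangle\ge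 c$. Perfect decoding is the case $c=1$. **Theorem (Aaronson).** (i) If there exists an injective one-way function that is hard to invert by quantum computers, then the Harlow–Hayden decoding task is hard: it cannot be done perfectly in quantum polynomial time, and in fact it cannot be done in quantum polynomial time with fidelity $c$ for any constant $c>\frac12$. (ii) Let $f:\{0,1\}^n\to\{0,1\}^m$ be injective and let $$|\psi\rangle_{RBH}=\frac1{\sqrt{2^{n+1}}}\sum_{x\in\{0,1\}^n}\bigl(|x\,0^{m-n},0\rangle_R|0\rangle_B+|f(x),1\rangle_R|1\rangle_B\bigr)|x\rangle_H .$$ Let $U$ be a unitary on the $m+1$ qubits of $R$ that puts $B$ and the last qubit of $R$ into the joint state $|\Phi^+\rangle$. Let $V=(I\otimes\langle0|)\,U\,(I\otimes|0\rangle)$ and $W=(I\otimes\langle1|)\,U\,(I\otimes|1\rangle)$ be the operators on $m$ qubits induced by $U$ when the last qubit of $R$ is fixed to $0$ and to $1$ respectively. Then $V^\dagger W|f(x)\rangle=|x\,0^{m-n}\rangle$ for every $x\in\{0,1\}^n$. -/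

import Mathlib

open Filter

namespace HarlowHayden

/-! ### Classical computation with a step count

A multi-stack machine with structured control flow: finitely many registers, each of them a stack
of bits; every push, pop and test costs one step.  Such machines and multi-tape Turing machines
simulate each other with polynomial (in fact small) overhead. -/

/-- Programs of the stack machine. -/
inductive Prog : Type
  | skip : Prog
  /-- push the bit `b` on register `r` -/
  | push (r : ℕ) (b : Bool) : Prog
  /-- remove the top bit of register `r` (no effect on an empty register) -/
  | pop (r : ℕ) : Prog
  | seq (p q : Prog) : Prog
  /-- run `p`, `q` or `u` according to whether register `r` is empty, has top bit `0`,
  or has top bit `1` -/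
  | branch (r : ℕ) (p q u : Prog) : Prog
  /-- while register `r` is not empty, run `p` -/
  | loop (r : ℕ) (p : Prog) : Prog

/-- Contents of the registers; the head of a list is the top of the stack. -/
abbrev Store : Type := ℕ → List Bool

/-- `Runs p s t s'`: started in `s`, the program `p` halts after exactly `t` steps in `s'`. -/
inductive Runs : Prog → Store → ℕ → Store → Prop
  | skip (s : Store) : Runs .skip s 1 s
  | push (r : ℕ) (b : Bool) (s : Store) :
      Runs (.push r b) s 1 (Function.update s r (b :: s r))
  | pop (r : ℕ) (s : Store) :
      Runs (.pop r) s 1 (Function.update s r (s r).tail)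
  | seq {p q : Prog} {s s' s'' : Store} {t t' : ℕ} :
      Runs p s t s' → Runs q s' t' s'' → Runs (.seq p q) s (t + t') s''
  | branch_nil {r : ℕ} {p q u : Prog} {s s' : Store} {t : ℕ} :
      s r = [] → Runs p s t s' → Runs (.branch r p q u) s (t + 1) s'
  | branch_zero {r : ℕ} {p q u : Prog} {s s' : Store} {t : ℕ} :
      (s r).head? = some false → Runs q s t s' → Runs (.branch r p q u) s (t + 1) s'
  | branch_one {r : ℕ} {p q u : Prog} {s s' : Store} {t : ℕ} :
      (s r).head? = some true → Runs u s t s' → Runs (.branch r p q u) s (t + 1) s'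
  | loop_done {r : ℕ} {p : Prog} {s : Store} :
      s r = [] → Runs (.loop r p) s 1 s
  | loop_step {r : ℕ} {p : Prog} {s s' s'' : Store} {t t' : ℕ} :
      s r ≠ [] → Runs p s t s' → Runs (.loop r p) s' t' s'' →
        Runs (.loop r p) s (t + t' + 1) s''

/-- The initial store: the input is in register `0`, all other registers are empty. -/
def inputStore (x : List Bool) : Store := fun r => if r = 0 then x else []

/-- On input `x` the program `p` halts within `T` steps and leaves `y` in register `0`. -/
def OutputsWithin (p : Prog) (x : List Bool) (T : ℕ) (y : List Bool) : Prop :=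
  ∃ (t : ℕ) (s : Store), t ≤ T ∧ Runs p (inputStore x) t s ∧ s 0 = y

/-! ### Quantum circuits over {Hadamard, Phase, Toffoli} -/

/-- Gates on `w` qubits. -/
inductive Gate (w : ℕ) : Type
  | had (i : Fin w) : Gate w
  | phase (i : Fin w) : Gate w
  /-- controls `i`, `j`, target `k` -/
  | toffoli (i j k : Fin w) (hij : i ≠ j) (hik : i ≠ k) (hjk : j ≠ k) : Gate w

/-- State vectors: a complex amplitude for every basis state. -/
abbrev QState (w : ℕ) : Type := (Fin w → Bool) → ℂ

/-- The computational basis state `|z⟩`. -/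
def ket {w : ℕ} (z : Fin w → Bool) : QState w := Pi.single z 1

/-- The action of a gate: `H = (1/√2) [[1, 1], [1, -1]]`, `P = diag(1, i)`, and
`|x, y, z⟩ ↦ |x, y, z ⊕ xy⟩`. -/
noncomputable def Gate.apply {w : ℕ} : Gate w → QState w → QState w
  | .had i, ψ => fun z =>
      (ψ (Function.update z i false)
        + (if z i then -1 else 1) * ψ (Function.update z i true)) / (Real.sqrt 2 : ℂ)
  | .phase i, ψ => fun z => (if z i then Complex.I else 1) * ψ z
  | .toffoli i j k _ _ _, ψ => fun z => ψ (Function.update z k (xor (z k) (z i && z j)))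

/-- A circuit is a list of gates; the head of the list is applied first. -/
noncomputable def runCircuit {w : ℕ} (gs : List (Gate w)) (ψ : QState w) : QState w :=
  gs.foldl (fun φ g => g.apply φ) ψ

/-- Unary self-delimiting code `1ᵏ0`. -/
def encNat (k : ℕ) : List Bool := List.replicate k true ++ [false]

def Gate.encode {w : ℕ} : Gate w → List Bool
  | .had i => encNat 0 ++ encNat i
  | .phase i => encNat 1 ++ encNat i
  | .toffoli i j k _ _ _ => encNat 2 ++ encNat i ++ encNat j ++ encNat k

/-- Description of a circuit as a bit string, of length polynomially related to the number of
qubits plus the number of gates. -/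
def encCircuit {w : ℕ} (gs : List (Gate w)) : List Bool := gs.flatMap Gate.encode

/-! ### Injective one-way functions secure against quantum computers -/

/-- `f_n : {0,1}ⁿ → {0,1}^{p(n)}` is computable in time `n^{O(1)}`. -/
def PolyTimeComputable {p : ℕ → ℕ} (f : ∀ n, (Fin n → Bool) → (Fin (p n) → Bool)) : Prop :=
  ∃ (c : Prog) (T : Polynomial ℕ), ∀ (n : ℕ) (x : Fin n → Bool),
    OutputsWithin c (List.ofFn x) (T.eval n) (List.ofFn (f n x))

/-- A quantum algorithm with quantum input of `p n` qubits: for every `n` a number of ancilla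
qubits and a circuit on the input qubits (the first ones) and the ancilla qubits. -/
abbrev QFamily (p : ℕ → ℕ) : Type := ∀ n : ℕ, (a : ℕ) × List (Gate (p n + a))

/-- The family runs in polynomial time: a `P`-uniform family, whose `n`-th circuit is written down
by a classical machine in time `n^{O(1)}` on input `1ⁿ`. -/
def QFamily.PolyTime {p : ℕ → ℕ} (A : QFamily p) : Prop :=
  ∃ (c : Prog) (T : Polynomial ℕ), ∀ n : ℕ,
    OutputsWithin c (List.replicate n true) (T.eval n) (encNat (A n).1 ++ encCircuit (A n).2)

/-- The first `n` bits of a measurement outcome. -/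
def firstBits (n : ℕ) {w : ℕ} (z : Fin w → Bool) : Fin n → Bool :=
  fun i => if h : i.val < w then z ⟨i.val, h⟩ else false

/-- `Pr_x [f(A(f(x))) = f(x)]` for uniform `x ∈ {0,1}ⁿ`, where `A` runs its `n`-th circuit on
`|f(x)⟩|0…0⟩`, measures in the computational basis, and outputs the first `n` bits. -/
noncomputable def inversionProb {p : ℕ → ℕ} (f : ∀ n, (Fin n → Bool) → (Fin (p n) → Bool))
    (A : QFamily p) (n : ℕ) : ℝ :=
  (∑ x : Fin n → Bool, ∑ z : Fin (p n + (A n).1) → Bool,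
    if f n (firstBits n z) = f n x then
      ‖runCircuit (A n).2 (ket (Fin.append (f n x) (fun _ => false))) z‖ ^ 2 else 0) / 2 ^ n

/-- `f` is an injective one-way function that is hard to invert by quantum computers: it is
computable in polynomial time, and the success probability of every polynomial-time quantum
algorithm is smaller than every inverse polynomial. -/
def IsInjectiveQuantumOWF {p : ℕ → ℕ} (f : ∀ n, (Fin n → Bool) → (Fin (p n) → Bool)) : Prop :=
  PolyTimeComputable f ∧ (∀ n, Function.Injective (f n)) ∧
    ∀ A : QFamily p, A.PolyTime → ∀ d : ℕ,
      ∀ᶠ n : ℕ in atTop, inversionProb f A n < 1 / (n : ℝ) ^ d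

/-! ### The decoding task -/

/-- Amplitudes of a state on registers `R` (`w` qubits), `B` (one qubit), `H` (`h` qubits). -/
abbrev TriState (w h : ℕ) : Type := (Fin w → Bool) → Bool → (Fin h → Bool) → ℂ

/-- Apply an operation to the register `R` only. -/
def applyR {w w' h : ℕ} (T : QState w → QState w') (Φ : TriState w h) : TriState w' h :=
  fun z b y => T (fun x => Φ x b y) z

/-- The fidelity `⟨Φ⁺|ρ|Φ⁺⟩` of the reduced state `ρ` of `B` and qubit `d` of `R` with the Bell
pair `Φ⁺ = (|00⟩ + |11⟩)/√2`.  For a unit vector it equals `1` exactly when these two qubits are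
in the joint state `Φ⁺`. -/
noncomputable def bellFidelity {w h : ℕ} (d : Fin w) (Φ : TriState w h) : ℝ :=
  ∑ z : Fin w → Bool, ∑ y : Fin h → Bool,
    if z d = false then
      ‖(Φ z false y + Φ (Function.update z d true) true y) / (Real.sqrt 2 : ℂ)‖ ^ 2 else 0

/-- The unitary `U` on `R` puts `B` and the rightmost qubit of `R` into a Bell pair. -/
def DistillsBellPair {k h : ℕ}
    (U : Matrix.unitaryGroup (Fin (k + 1) → Bool) ℂ) (Φ : TriState (k + 1) h) : Prop :=
  bellFidelity (Fin.last k)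
    (applyR (fun v => (U : Matrix (Fin (k + 1) → Bool) (Fin (k + 1) → Bool) ℂ).mulVec v) Φ) = 1

/-- An input of the decoding task: a circuit whose first `k + 1` qubits form `R`, followed by the
single qubit `B` and by the `h` qubits of `H`. -/
structure Instance : Type where
  k : ℕ
  h : ℕ
  circuit : List (Gate (k + 1 + 1 + h))

/-- The description given to the decoder. -/
def Instance.encode (I : Instance) : List Bool :=
  encNat I.k ++ encNat I.h ++ encCircuit I.circuit

/-- The state `|ψ⟩_{RBH}` that the circuit makes from `|0…0⟩`. -/
noncomputable def Instance.state (I : Instance) : TriState (I.k + 1) I.h :=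
  fun z b y => runCircuit I.circuit (ket (fun _ => false))
    (Fin.append (Fin.snoc (α := fun _ => Bool) z b) y)

/-- Some unitary on `R` produces the Bell pair. -/
def Instance.Promise (I : Instance) : Prop :=
  ∃ U : Matrix.unitaryGroup (Fin (I.k + 1) → Bool) ℂ, DistillsBellPair U I.state

/-- Adjoin `a` qubits in the state `|0⟩`. -/
def addAncillas {w : ℕ} (a : ℕ) (v : QState w) : QState (w + a) :=
  fun z => if ∀ i : Fin a, z (Fin.natAdd w i) = false then v (fun i => z (Fin.castAdd a i)) else 0

/-- The bit string `out` describes a circuit on `R` and some ancilla qubits that puts `B` and the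
rightmost qubit of `R` into the Bell pair with fidelity at least `c`. -/
def Instance.DecodedBy (I : Instance) (c : ℝ) (out : List Bool) : Prop :=
  ∃ (a : ℕ) (gs : List (Gate (I.k + 1 + a))),
    out = encNat a ++ encCircuit gs ∧
    c ≤ bellFidelity (Fin.castAdd a (Fin.last I.k))
      (applyR (fun v => runCircuit gs (addAncillas a v)) I.state)

/-- The decoding task can be done in quantum polynomial time with fidelity `c`: a polynomial-time
machine turns every input that satisfies the promise into a quantum circuit that does the decoding
when it is applied to `R`.  Perfect decoding is the case `c = 1`. -/
def DecodingInPolyTime (c : ℝ) : Prop :=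
  ∃ (M : Prog) (T : Polynomial ℕ), ∀ I : Instance, I.Promise →
    ∃ out : List Bool, OutputsWithin M I.encode (T.eval I.encode.length) out ∧ I.DecodedBy c out

/-! ### The state built from a function -/

/-- The string `x 0…0` of length `m`. -/
def padZeros {n : ℕ} (m : ℕ) (x : Fin n → Bool) : Fin m → Bool := firstBits m x

/-- `2^{-(n+1)/2} ∑ₓ (|x 0…0, 0⟩_R |0⟩_B + |f(x), 1⟩_R |1⟩_B) |x⟩_H`. -/
noncomputable def owfState {n m : ℕ} (f : (Fin n → Bool) → (Fin m → Bool)) : TriState (m + 1) n :=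
  fun z b x =>
    if z = Fin.snoc (α := fun _ => Bool) (if b then f x else padZeros m x) b then
      1 / (Real.sqrt (2 ^ (n + 1)) : ℂ) else 0

/-- The operator induced on the other qubits of `R` by an operator `U` on `R` when the last qubit
is fixed to `b`. -/
def fixLast {m : ℕ} (b : Bool) (U : Matrix (Fin (m + 1) → Bool) (Fin (m + 1) → Bool) ℂ) :
    Matrix (Fin m → Bool) (Fin m → Bool) ℂ :=
  Matrix.of fun z' z => U (Fin.snoc (α := fun _ => Bool) z' b) (Fin.snoc (α := fun _ => Bool) z b)

end HarlowHayden

namespace HarlowHayden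

/-! ### Programs of the stack machine -/

/-! Hardness of decoding. Let `f` be injective and computed by a program in polynomial time. A
circuit prepares, up to normalisation, ∑ₓ (|x0…0,0⟩|0⟩ + |f(x),1⟩|1⟩)|γ(x)⟩, where `H` holds x
together with all the garbage of a reversible simulation of the program. The garbage need not be
erased: the simulation runs before `B` is put in superposition, so γ depends on x alone, and it is
injective because it contains x. The strings (x0…0,0) and (f(x),1) are pairwise distinct, so some
permutation of the basis states of `R` sends both branches of x to (x0…0,b), and the promise holds
(`IsBranchState.distills`).

Let D be a decoder, ancillas included. Different x are orthogonal on `H`, so the fidelity is an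
average over x (`IsBranchState.bellFidelity_eq`), and the term of x is at most (1 + Re ω(x))/2 with
ω(x) = ⟨x0…0,0| D† (|0⟩⟨1| on the decoded qubit) D |f(x),1⟩. Fidelity c therefore gives an average
of Re ω of at least 2c − 1 > 0 (`IsBranchState.sum_overlap_ge`). Now ω(x) is also an amplitude of an
efficient circuit: start from |f(x),1⟩, run D, move the decoded bit to a new wire, run D backwards;
the outcome that shows x0…0 and a 1 on the new wire has amplitude ω(x) (`inverterCircuit_apply`). So
x is found with probability at least |ω(x)|², whose average is at least (2c − 1)² by Cauchy–Schwarz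
(`inversionProb_ge`). This constant contradicts one-wayness.

Uniformity takes most of the work, since both circuits must be written down by stack machines. A
small language of circuit generators is compiled to stack machines with a polynomial time bound
(`Stmt.exec_compile`). One generator prints a circuit that simulates a given program
(`simulate_spec`): stacks become arrays of wires, pushes and pops become controlled shifts, tests
become control wires, and loops are unrolled as often as the time bound requires. The inverting
machine writes down the instance (`exists_encoder`), runs the decoding machine, and rewrites its
output into the inverter (`exists_inverterProg`).

Exact decoding. If the fidelity is 1, every term of the average is extremal, and the equality case
says that U|x0…0,0⟩ has last bit 0 and agrees with U|f(x),1⟩ after that bit is changed. The formula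
for V†W|f(x)⟩ is then the orthonormality of the columns of U (`fixLast_mulVec_ket`). -/

theorem Runs.one_le {p : Prog} {s s' : Store} {t : ℕ} (h : Runs p s t s') : 1 ≤ t := by
  induction h <;> omega

/-- A step lengthens a stack by at most one bit. Time bounds therefore also bound the lengths of
outputs, and initial length plus time is a sufficient capacity for the simulation by circuits. -/
theorem Runs.length_le {p : Prog} {s s' : Store} {t : ℕ} (h : Runs p s t s') (r : ℕ) :
    (s' r).length ≤ (s r).length + t := by
  induction h with
  | skip s => omega
  | push r' b s =>
    by_cases hr : r = r'
    · subst hr; simp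
    · simp [hr]
  | pop r' s =>
    by_cases hr : r = r'
    · subst hr; simp; omega
    · simp [hr]
  | seq _ _ h1 h2 => omega
  | branch_nil _ _ h => omega
  | branch_zero _ _ h => omega
  | branch_one _ _ h => omega
  | loop_done _ => omega
  | loop_step _ _ _ h1 h2 => omega

/-- A strict upper bound for the registers that a program mentions. -/
def Prog.regBound : Prog → ℕ
  | .skip => 0
  | .push r _ => r + 1
  | .pop r => r + 1
  | .seq p q => max p.regBound q.regBound
  | .branch r p q u => max (r + 1) (max p.regBound (max q.regBound u.regBound))
  | .loop r p => max (r + 1) p.regBound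

/-- The first `B` registers come from `s`, the others from `s₀`. -/
def splice (B : ℕ) (s s₀ : Store) : Store := fun r => if r < B then s r else s₀ r

theorem splice_update {B r : ℕ} (hr : r < B) (s s₀ : Store) (l : List Bool) :
    splice B (Function.update s r l) s₀ = Function.update (splice B s s₀) r l := by
  funext q
  by_cases hq : q = r
  · subst hq; simp [splice, hr]
  · simp [splice, hq]

/-- A program neither reads nor writes a register at or above `regBound`, so their contents are
arbitrary. This allows an unknown machine to be run as a subroutine while higher registers keep
other data. -/
theorem Runs.splice {p : Prog} {s s' : Store} {t : ℕ} (h : Runs p s t s') {B : ℕ}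
    (hB : p.regBound ≤ B) (s₀ : Store) :
    Runs p (splice B s s₀) t (splice B s' s₀) := by
  induction h with
  | skip s => exact .skip _
  | push r b s =>
    have hr : r < B := hB
    rw [splice_update hr]
    convert Runs.push r b _ using 3
    simp [HarlowHayden.splice, hr]
  | pop r s =>
    have hr : r < B := hB
    rw [splice_update hr]
    convert Runs.pop r _ using 3
    simp [HarlowHayden.splice, hr]
  | seq _ _ h1 h2 =>
    simp only [Prog.regBound, max_le_iff] at hB
    exact .seq (h1 hB.1) (h2 hB.2)
  | branch_nil hs _ h =>
    simp only [Prog.regBound, max_le_iff] at hB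
    exact .branch_nil (by simpa [HarlowHayden.splice, show _ < B from hB.1] using hs) (h hB.2.1)
  | branch_zero hs _ h =>
    simp only [Prog.regBound, max_le_iff] at hB
    exact .branch_zero (by simpa [HarlowHayden.splice, show _ < B from hB.1] using hs) (h hB.2.2.1)
  | branch_one hs _ h =>
    simp only [Prog.regBound, max_le_iff] at hB
    exact .branch_one (by simpa [HarlowHayden.splice, show _ < B from hB.1] using hs) (h hB.2.2.2)
  | loop_done hs =>
    simp only [Prog.regBound, max_le_iff] at hB
    exact .loop_done (by simpa [HarlowHayden.splice, show _ < B from hB.1] using hs)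
  | loop_step hs _ _ h1 h2 =>
    have hB' := hB
    simp only [Prog.regBound, max_le_iff] at hB'
    exact .loop_step (by simpa [HarlowHayden.splice, show _ < B from hB'.1] using hs)
      (h1 hB'.2) (h2 hB)

/-- `p` takes `s` to `s'` in at most `T` steps. -/
def Exec (p : Prog) (T : ℕ) (s s' : Store) : Prop := ∃ t ≤ T, Runs p s t s'

theorem Exec.mono {p : Prog} {T T' : ℕ} {s s' : Store} (h : Exec p T s s') (hT : T ≤ T') :
    Exec p T' s s' := by
  obtain ⟨t, ht, h⟩ := h
  exact ⟨t, ht.trans hT, h⟩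

theorem Exec.congr {p : Prog} {T T' : ℕ} {s s' s'' : Store} (h : Exec p T s s')
    (hs : s'' = s') (hT : T ≤ T') : Exec p T' s s'' := hs ▸ h.mono hT

theorem Exec.seq {p q : Prog} {T T' : ℕ} {s s' s'' : Store} (h : Exec p T s s')
    (h' : Exec q T' s' s'') : Exec (.seq p q) (T + T') s s'' := by
  obtain ⟨t, ht, h⟩ := h
  obtain ⟨t', ht', h'⟩ := h'
  exact ⟨t + t', by omega, .seq h h'⟩

theorem Exec.skip (s : Store) : Exec .skip 1 s s := ⟨1, le_rfl, .skip s⟩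

theorem Exec.push (r : ℕ) (b : Bool) (s : Store) :
    Exec (.push r b) 1 s (Function.update s r (b :: s r)) := ⟨1, le_rfl, .push r b s⟩

theorem Exec.pop (r : ℕ) (s : Store) :
    Exec (.pop r) 1 s (Function.update s r (s r).tail) := ⟨1, le_rfl, .pop r s⟩

theorem Exec.loop_done {r : ℕ} {p : Prog} {s : Store} (h : s r = []) :
    Exec (.loop r p) 1 s s := ⟨1, le_rfl, .loop_done h⟩

theorem Exec.loop_step {r : ℕ} {p : Prog} {T T' : ℕ} {s s' s'' : Store} (hs : s r ≠ [])
    (h : Exec p T s s') (h' : Exec (.loop r p) T' s' s'') :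
    Exec (.loop r p) (T + T' + 1) s s'' := by
  obtain ⟨t, ht, h⟩ := h
  obtain ⟨t', ht', h'⟩ := h'
  exact ⟨t + t' + 1, by omega, .loop_step hs h h'⟩

theorem Exec.branch_zero {r : ℕ} {p q u : Prog} {T : ℕ} {s s' : Store}
    (hs : (s r).head? = some false) (h : Exec q T s s') :
    Exec (.branch r p q u) (T + 1) s s' := by
  obtain ⟨t, ht, h⟩ := h
  exact ⟨t + 1, by omega, .branch_zero hs h⟩

theorem Exec.branch_one {r : ℕ} {p q u : Prog} {T : ℕ} {s s' : Store}
    (hs : (s r).head? = some true) (h : Exec u T s s') :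
    Exec (.branch r p q u) (T + 1) s s' := by
  obtain ⟨t, ht, h⟩ := h
  exact ⟨t + 1, by omega, .branch_one hs h⟩

/-- A loop that passes through the stores `st 0, …, st n`. -/
theorem Exec.loop {r : ℕ} {p : Prog} {T : ℕ} (n : ℕ) (st : ℕ → Store)
    (hne : ∀ i < n, st i r ≠ []) (hstep : ∀ i < n, Exec p T (st i) (st (i + 1)))
    (hend : st n r = []) : Exec (.loop r p) (n * (T + 1) + 1) (st 0) (st n) := by
  induction n generalizing st with
  | zero => simpa using Exec.loop_done hend
  | succ n ih =>
    have h := ih (fun i => st (i + 1)) (fun i hi => hne (i + 1) (by omega))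
      (fun i hi => hstep (i + 1) (by omega)) hend
    exact (Exec.loop_step (hne 0 (by omega)) (hstep 0 (by omega)) h).mono (by ring_nf; omega)

/-- Push the bits of `l` one after the other. -/
def pushBits (r : ℕ) : List Bool → Prog
  | [] => .skip
  | b :: l => .seq (.push r b) (pushBits r l)

theorem exec_pushBits (r : ℕ) (l : List Bool) (s : Store) :
    Exec (pushBits r l) (l.length + 1) s (Function.update s r (l.reverse ++ s r)) := by
  induction l generalizing s with
  | nil => simpa [pushBits] using Exec.skip s
  | cons b l ih =>
    have h := (Exec.push r b s).seq (ih (Function.update s r (b :: s r)))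
    simp only [Function.update_self, Function.update_idem] at h
    exact (by simpa [pushBits] using h : Exec (pushBits r (b :: l)) _ _ _).mono
      (by simp; omega)

/-- Move the contents of register `a` bit by bit to register `b`, which reverses them. -/
def moveReg (a b : ℕ) : Prog :=
  .loop a (.branch a .skip (.seq (.pop a) (.push b false)) (.seq (.pop a) (.push b true)))

theorem exec_moveReg {a b : ℕ} (hab : a ≠ b) (s : Store) :
    Exec (moveReg a b) (4 * (s a).length + 1) s
      (Function.update (Function.update s a []) b ((s a).reverse ++ s b)) := by
  generalize hl : s a = l
  induction l generalizing s with
  | nil =>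
    have : Function.update (Function.update s a []) b ([] ++ s b) = s := by
      funext q
      by_cases hb : q = b
      · subst hb; simp
      · by_cases ha : q = a
        · subst ha; simp [hb, hl]
        · simp [ha, hb]
    rw [List.reverse_nil, this]
    exact (Exec.loop_done hl).mono (by simp)
  | cons x l ih =>
    have h1 : Exec (.branch a .skip (.seq (.pop a) (.push b false))
        (.seq (.pop a) (.push b true))) 3 s
        (Function.update (Function.update s a l) b (x :: s b)) := by
      have key : ∀ x', Exec (.seq (.pop a) (.push b x')) 2 s
          (Function.update (Function.update s a l) b (x' :: s b)) := by
        intro x'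
        have := (Exec.pop a s).seq (Exec.push b x' _)
        simpa [hl, hab.symm] using this
      cases x
      · exact Exec.branch_zero (by simp [hl]) (key false)
      · exact Exec.branch_one (by simp [hl]) (key true)
    have h2 := ih (Function.update (Function.update s a l) b (x :: s b)) (by simp [hab])
    have h3 := Exec.loop_step (by simp [hl]) h1 h2
    refine Exec.congr (h3) ?_ ?_
    · funext q
      by_cases hb : q = b
      · subst hb; simp
      · by_cases ha : q = a
        · subst ha; simp [hb]
        · simp [ha, hb]
    · simp; omega

end HarlowHayden


namespace HarlowHayden

/-! ### Gates with numbered wires -/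

/-- Gates on wires numbered by natural numbers; `not` abbreviates `H P P H`. -/
inductive WGate : Type
  | had (i : ℕ)
  | phase (i : ℕ)
  | not (i : ℕ)
  | tof (i j k : ℕ)

namespace WGate

/-- Rename the wires. -/
def map (σ : ℕ → ℕ) : WGate → WGate
  | had i => had (σ i)
  | phase i => phase (σ i)
  | not i => not (σ i)
  | tof i j k => tof (σ i) (σ j) (σ k)

def encode : WGate → List Bool
  | had i => encNat 0 ++ encNat i
  | phase i => encNat 1 ++ encNat i
  | not i => (encNat 0 ++ encNat i) ++ ((encNat 1 ++ encNat i) ++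
      ((encNat 1 ++ encNat i) ++ (encNat 0 ++ encNat i)))
  | tof i j k => encNat 2 ++ encNat i ++ encNat j ++ encNat k

end WGate

/-- The description of a list of gates. -/
def encGates (gs : List WGate) : List Bool := gs.flatMap WGate.encode

@[simp] theorem encGates_nil : encGates [] = [] := rfl

@[simp] theorem encGates_append (gs gs' : List WGate) :
    encGates (gs ++ gs') = encGates gs ++ encGates gs' := by simp [encGates]

/-! ### A language of circuit generators

Variables hold natural numbers.  Its programs print gates and are translated to stack machines. -/

inductive Stmt : Type
  | skip
  | zero (v : ℕ)
  | inc (v : ℕ)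
  | dec (v : ℕ)
  | copy (v w : ℕ)
  /-- print a gate on the wires whose numbers are the values of the given variables -/
  | emit (g : WGate)
  | seq (s s' : Stmt)
  /-- repeat `s` as many times as the initial value of `q` says -/
  | rep (q : ℕ) (s : Stmt)

namespace Stmt

/-- The final values of the variables. -/
def vars : Stmt → (ℕ → ℕ) → (ℕ → ℕ)
  | skip, σ => σ
  | zero v, σ => Function.update σ v 0
  | inc v, σ => Function.update σ v (σ v + 1)
  | dec v, σ => Function.update σ v (σ v - 1)
  | copy v w, σ => Function.update σ v (σ w)
  | emit _, σ => σ
  | seq s s', σ => s'.vars (s.vars σ)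
  | rep q s, σ => s.vars^[σ q] σ

/-- The printed gates. -/
def gates : Stmt → (ℕ → ℕ) → List WGate
  | emit g, σ => [g.map σ]
  | seq s s', σ => s.gates σ ++ s'.gates (s.vars σ)
  | rep q s, σ => (List.range (σ q)).flatMap fun i => s.gates (s.vars^[i] σ)
  | _, _ => []

/-- Only variables in `P` control repetitions, and they are never assigned. -/
def Wf (P : Set ℕ) : Stmt → Prop
  | skip => True
  | zero v => v ∉ P
  | inc v => v ∉ P
  | dec v => v ∉ P
  | copy v _ => v ∉ P
  | emit _ => True
  | seq s s' => s.Wf P ∧ s'.Wf P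
  | rep q s => q ∈ P ∧ s.Wf P

/-- Repetition counts are constants of the whole execution. This excludes loops whose length grows
while they run, and is what keeps the running time polynomial. -/
theorem Wf.vars_eq {P : Set ℕ} {s : Stmt} (h : s.Wf P) {v : ℕ} (hv : v ∈ P) (σ : ℕ → ℕ) :
    s.vars σ v = σ v := by
  have aux : ∀ {w x : ℕ}, w ∉ P → Function.update σ w x v = σ v := fun hw =>
    Function.update_of_ne (fun e => hw (by rw [← e]; exact hv)) _ _
  induction s generalizing σ with
  | skip => rfl
  | zero w => exact aux h
  | inc w => exact aux h
  | dec w => exact aux h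
  | copy w _ => exact aux h
  | emit _ => rfl
  | seq s s' ih ih' =>
    exact (ih' h.2 _ fun hw => Function.update_of_ne (fun e => hw (by rw [← e]; exact hv)) _ _).trans
      (ih h.1 _ aux)
  | rep q s ih =>
    have : ∀ i, (s.vars^[i] σ) v = σ v := by
      intro i
      induction i with
      | zero => rfl
      | succ i hi =>
        rw [Function.iterate_succ_apply', ih h.2 _
          fun hw => Function.update_of_ne (fun e => hw (by rw [← e]; exact hv)) _ _, hi]
    exact this _

end Stmt

/-! ### Stores that hold the variables -/

/-- The register of a variable. -/
def varReg (B v : ℕ) : ℕ := B + 1 + 2 * v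

/-- The register of a loop counter; number `0` is a scratch register. -/
def ctrReg (B d : ℕ) : ℕ := B + 2 + 2 * d

/-- The registers below `B` hold `rest`, register `B` holds `out`, and variables and counters are
kept in unary. -/
def mkStore (B : ℕ) (rest : Store) (out : List Bool) (σ κ : ℕ → ℕ) : Store := fun r =>
  if r < B then rest r else if r = B then out
  else if (r - B) % 2 = 1 then List.replicate (σ ((r - B) / 2)) true
  else List.replicate (κ ((r - B) / 2 - 1)) true

section mkStore

variable {B : ℕ} {rest : Store} {out : List Bool} {σ κ : ℕ → ℕ}

@[simp] theorem varReg_inj {v w : ℕ} : varReg B v = varReg B w ↔ v = w := by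
  unfold varReg; omega

@[simp] theorem ctrReg_inj {v w : ℕ} : ctrReg B v = ctrReg B w ↔ v = w := by
  unfold ctrReg; omega

@[simp] theorem varReg_ne_ctrReg {v d : ℕ} : varReg B v ≠ ctrReg B d := by
  unfold varReg ctrReg; omega

@[simp] theorem ctrReg_ne_varReg {v d : ℕ} : ctrReg B d ≠ varReg B v := varReg_ne_ctrReg.symm

@[simp] theorem varReg_ne_out {v : ℕ} : varReg B v ≠ B := by unfold varReg; omega

@[simp] theorem ctrReg_ne_out {v : ℕ} : ctrReg B v ≠ B := by unfold ctrReg; omega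

@[simp] theorem out_ne_varReg {v : ℕ} : B ≠ varReg B v := by unfold varReg; omega

@[simp] theorem out_ne_ctrReg {v : ℕ} : B ≠ ctrReg B v := by unfold ctrReg; omega

theorem ne_varReg {r v : ℕ} (h : r < B) : r ≠ varReg B v := by unfold varReg; omega

theorem ne_ctrReg {r v : ℕ} (h : r < B) : r ≠ ctrReg B v := by unfold ctrReg; omega

theorem mkStore_lt {r : ℕ} (h : r < B) : mkStore B rest out σ κ r = rest r := by
  simp [mkStore, h]

@[simp] theorem mkStore_out : mkStore B rest out σ κ B = out := by simp [mkStore]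

@[simp] theorem mkStore_var (v : ℕ) :
    mkStore B rest out σ κ (varReg B v) = List.replicate (σ v) true := by
  have h1 : ¬ varReg B v < B := by unfold varReg; omega
  have h2 : (varReg B v - B) % 2 = 1 := by unfold varReg; omega
  have h3 : (varReg B v - B) / 2 = v := by unfold varReg; omega
  simp [mkStore, h1, h2, h3]

@[simp] theorem mkStore_ctr (d : ℕ) :
    mkStore B rest out σ κ (ctrReg B d) = List.replicate (κ d) true := by
  have h1 : ¬ ctrReg B d < B := by unfold ctrReg; omega
  have h2 : (ctrReg B d - B) % 2 = 0 := by unfold ctrReg; omega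
  have h3 : (ctrReg B d - B) / 2 - 1 = d := by unfold ctrReg; omega
  simp [mkStore, h1, h2, h3]

/-- Above `B`, odd offsets are variables and even offsets are counters, so four kinds of registers
exhaust the store. -/
theorem store_ext (B : ℕ) {s s' : Store} (h1 : ∀ r < B, s r = s' r) (h2 : s B = s' B)
    (h3 : ∀ v, s (varReg B v) = s' (varReg B v)) (h4 : ∀ d, s (ctrReg B d) = s' (ctrReg B d)) :
    s = s' := by
  funext r
  rcases lt_trichotomy r B with h | h | h
  · exact h1 r h
  · exact h ▸ h2
  · rcases Nat.even_or_odd' (r - B - 1) with ⟨k, hk | hk⟩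
    · rw [show r = varReg B k by unfold varReg; omega]; exact h3 k
    · rw [show r = ctrReg B k by unfold ctrReg; omega]; exact h4 k

theorem mkStore_update_lt {r : ℕ} (h : r < B) (l : List Bool) :
    Function.update (mkStore B rest out σ κ) r l = mkStore B (Function.update rest r l) out σ κ := by
  apply store_ext B
  · intro q hq
    by_cases hqr : q = r
    · subst hqr; simp [mkStore_lt hq]
    · simp [hqr, mkStore_lt hq]
  · simp [h.ne']
  · intro v; simp [(ne_varReg h).symm]
  · intro v; simp [(ne_ctrReg h).symm]

theorem mkStore_update_out (l : List Bool) :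
    Function.update (mkStore B rest out σ κ) B l = mkStore B rest l σ κ := by
  apply store_ext B
  · intro q hq; simp [hq.ne, mkStore_lt hq]
  all_goals simp

theorem mkStore_update_var (v k : ℕ) :
    Function.update (mkStore B rest out σ κ) (varReg B v) (List.replicate k true) =
      mkStore B rest out (Function.update σ v k) κ := by
  apply store_ext B
  · intro q hq; simp [mkStore_lt hq, ne_varReg hq]
  · simp
  · intro w
    by_cases hw : w = v
    · subst hw; simp
    · simp [hw]
  · simp

theorem mkStore_update_ctr (v k : ℕ) :
    Function.update (mkStore B rest out σ κ) (ctrReg B v) (List.replicate k true) =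
      mkStore B rest out σ (Function.update κ v k) := by
  apply store_ext B
  · intro q hq; simp [mkStore_lt hq, ne_ctrReg hq]
  · simp
  · simp
  · intro w
    by_cases hw : w = v
    · subst hw; simp
    · simp [hw]

end mkStore

/-! ### Moving unary numbers -/

/-- Push `1` on the registers in the list. -/
def pushAll : List ℕ → Prog
  | [] => .skip
  | r :: L => .seq (.push r true) (pushAll L)

theorem exec_pushAll (L : List ℕ) (hL : L.Nodup) (s : Store) :
    Exec (pushAll L) (L.length + 1) s (fun q => if q ∈ L then true :: s q else s q) := by
  induction L generalizing s with
  | nil => simpa [pushAll] using Exec.skip s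
  | cons r L ih =>
    rw [List.nodup_cons] at hL
    have h := (Exec.push r true s).seq (ih hL.2 _)
    refine Exec.congr h ?_ (by simp; omega)
    funext q
    by_cases hq : q = r
    · subst hq; simp [hL.1]
    · simp [hq]

/-- Empty register `r`, pushing `1` on the registers in the list for every removed bit. -/
def drain (r : ℕ) (L : List ℕ) : Prog := .loop r (.seq (.pop r) (pushAll L))

theorem exec_drain {r : ℕ} {L : List ℕ} (hL : (r :: L).Nodup) (s : Store) :
    Exec (drain r L) ((s r).length * (L.length + 3) + 1) s
      (fun q => if q = r then [] else
        if q ∈ L then List.replicate (s r).length true ++ s q else s q) := by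
  rw [List.nodup_cons] at hL
  generalize hl : s r = l
  induction l generalizing s with
  | nil =>
    refine Exec.congr (Exec.loop_done hl) ?_ (by simp)
    funext q
    by_cases hq : q = r
    · subst hq; simp [hl]
    · simp [hq]
  | cons b l ih =>
    have h1 := (Exec.pop r s).seq (exec_pushAll L hL.2 _)
    have h2 := ih (fun q => if q ∈ L then true :: (Function.update s r (s r).tail) q
      else (Function.update s r (s r).tail) q) (by simp [hL.1, hl])
    have h3 := Exec.loop_step (by simp [hl]) h1 h2
    refine Exec.congr (h3) ?_ ?_
    · funext q
      by_cases hq : q = r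
      · subst hq; simp
      · by_cases hqL : q ∈ L
        · simp [hq, hqL, List.replicate_succ']
        · simp [hq, hqL]
    · simp [Nat.add_mul]; omega

/-- Clear a variable. -/
def zeroVar (B v : ℕ) : Prog := drain (varReg B v) []

/-- Assign a variable to another one. -/
def copyVar (B v w : ℕ) : Prog :=
  if v = w then .skip else
    .seq (zeroVar B v) (.seq (drain (varReg B w) [ctrReg B 0])
      (drain (ctrReg B 0) [varReg B v, varReg B w]))

/-- Push the code of the value of a variable, in reverse order, on register `r`. -/
def emitVar (B r v : ℕ) : Prog :=
  .seq (drain (varReg B v) [ctrReg B 0])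
    (.seq (drain (ctrReg B 0) [varReg B v, r]) (.push r false))

/-- Push the code of the value of a variable on register `r`. -/
def pushVar (B r v : ℕ) : Prog :=
  .seq (.push r false) (.seq (drain (varReg B v) [ctrReg B 0])
    (drain (ctrReg B 0) [varReg B v, r]))

section macros

variable {B : ℕ} {rest : Store} {out : List Bool} {σ κ : ℕ → ℕ}

theorem exec_zeroVar (v : ℕ) :
    Exec (zeroVar B v) (3 * σ v + 1) (mkStore B rest out σ κ)
      (mkStore B rest out (Function.update σ v 0) κ) := by
  have h := exec_drain (r := varReg B v) (L := []) (by simp) (mkStore B rest out σ κ)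
  refine Exec.congr (h) ?_ ?_
  · rw [← mkStore_update_var]
    funext q
    by_cases hq : q = varReg B v
    · subst hq; simp
    · simp [hq]
  · simp; omega

/-- A stack can only be read by emptying it, so a value passes through the scratch counter `0` and
is then restored from there. Hence the standing hypothesis that this counter is `0`. -/
theorem exec_drainToTmp (hκ : κ 0 = 0) (v : ℕ) :
    Exec (drain (varReg B v) [ctrReg B 0]) (4 * σ v + 1) (mkStore B rest out σ κ)
      (mkStore B rest out (Function.update σ v 0) (Function.update κ 0 (σ v))) := by
  have h := exec_drain (r := varReg B v) (L := [ctrReg B 0]) (by simp) (mkStore B rest out σ κ)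
  refine Exec.congr (h) ?_ ?_
  · rw [← mkStore_update_var, ← mkStore_update_ctr]
    funext q
    by_cases hq : q = varReg B v
    · subst hq; simp
    · by_cases hq' : q = ctrReg B 0
      · subst hq'; simp [hκ]
      · simp [hq, hq']
  · simp; omega

theorem exec_copyVar (hκ : κ 0 = 0) (v w : ℕ) :
    Exec (copyVar B v w) (3 * σ v + 9 * σ w + 3) (mkStore B rest out σ κ)
      (mkStore B rest out (Function.update σ v (σ w)) κ) := by
  by_cases hvw : v = w
  · subst hvw
    simpa [copyVar] using (Exec.skip _).mono (by omega)
  have h1 := exec_zeroVar (B := B) (rest := rest) (out := out) (σ := σ) (κ := κ) v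
  have h2 := exec_drainToTmp (B := B) (rest := rest) (out := out) (σ := Function.update σ v 0)
    hκ w
  have h3 := exec_drain (r := ctrReg B 0) (L := [varReg B v, varReg B w]) (by simp [hvw])
    (mkStore B rest out (Function.update (Function.update σ v 0) w 0)
      (Function.update κ 0 (σ w)))
  rw [Function.update_of_ne (Ne.symm hvw)] at h2
  simp only [copyVar, hvw, if_false]
  refine Exec.congr (h1.seq (h2.seq h3)) ?_ ?_
  · apply store_ext B
    · intro r hr; simp [mkStore_lt hr, ne_ctrReg hr, ne_varReg hr]
    · simp
    · intro x
      by_cases hxv : x = v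
      · subst hxv; simp [hvw]
      · by_cases hxw : x = w
        · subst hxw; simp [hxv]
        · simp [hxv, hxw]
    · intro d
      by_cases hd : d = 0
      · subst hd; simp [hκ]
      · simp [hd]
  · simp; omega

theorem exec_unaryOut (hκ : κ 0 = 0) {r : ℕ} (hr : r ≤ B) (v : ℕ) (s : Store)
    (hs : s = mkStore B rest out σ κ) :
    Exec (.seq (drain (varReg B v) [ctrReg B 0]) (drain (ctrReg B 0) [varReg B v, r]))
      (9 * σ v + 2) s (Function.update s r (List.replicate (σ v) true ++ s r)) := by
  have hr1 : r ≠ varReg B v := by unfold varReg; omega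
  have hr2 : ∀ d, r ≠ ctrReg B d := by unfold ctrReg; omega
  have h2 := exec_drainToTmp (B := B) (rest := rest) (out := out) (σ := σ) hκ v
  have h3 := exec_drain (r := ctrReg B 0) (L := [varReg B v, r])
    (by simp [hr1.symm, (hr2 _).symm])
    (mkStore B rest out (Function.update σ v 0) (Function.update κ 0 (σ v)))
  rw [hs]
  refine Exec.congr (h2.seq h3) ?_ ?_
  · rw [← mkStore_update_var, ← mkStore_update_ctr]
    funext q
    by_cases hq : q = r
    · subst hq; simp [hr1, hr2]
    · by_cases hqv : q = varReg B v
      · subst hqv; simp [hq]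
      · by_cases hqc : q = ctrReg B 0
        · subst hqc; simp [hq, hκ]
        · simp [hq, hqv, hqc]
  · simp; omega

theorem encNat_reverse (k : ℕ) : (encNat k).reverse = false :: List.replicate k true := by
  simp [encNat]

/-- Printed text accumulates on a stack, so register `B` always holds it backwards. One final move
to another register puts it in reading order. -/
theorem exec_emitVar (hκ : κ 0 = 0) (v : ℕ) :
    Exec (emitVar B B v) (9 * σ v + 3) (mkStore B rest out σ κ)
      (mkStore B rest ((encNat (σ v)).reverse ++ out) σ κ) := by
  obtain ⟨t, ht, h⟩ := exec_unaryOut (rest := rest) (out := out) (σ := σ) hκ le_rfl v _ rfl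
  -- The final push is nested inside the second half of the program, so the run has to be split and
  -- reassociated.
  cases h with
  | seq h1 h2 =>
    rw [mkStore_update_out] at h2
    have h3 := Runs.push B false (mkStore B rest (List.replicate (σ v) true ++
      mkStore B rest out σ κ B) σ κ)
    rw [mkStore_update_out] at h3
    simp only [mkStore_out] at h2 h3
    rw [encNat_reverse]
    exact ⟨_, by omega, .seq h1 (.seq h2 h3)⟩

theorem exec_pushVar (hκ : κ 0 = 0) {r : ℕ} (hr : r < B) (v : ℕ) :
    Exec (pushVar B r v) (9 * σ v + 3) (mkStore B rest out σ κ)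
      (mkStore B (Function.update rest r (encNat (σ v) ++ rest r)) out σ κ) := by
  have h1 := Exec.push r false (mkStore B rest out σ κ)
  rw [mkStore_update_lt hr] at h1
  have h2 := exec_unaryOut (B := B)
    (rest := Function.update rest r (false :: mkStore B rest out σ κ r)) (out := out) (σ := σ)
    hκ hr.le v _ rfl
  rw [mkStore_update_lt hr] at h2
  refine Exec.congr (h1.seq h2) ?_ ?_
  · simp [mkStore_lt hr, encNat]
  · omega

theorem exec_pushOut (l : List Bool) :
    Exec (pushBits B l) (l.length + 1) (mkStore B rest out σ κ)
      (mkStore B rest (l.reverse ++ out) σ κ) := by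
  have := exec_pushBits B l (mkStore B rest out σ κ)
  rwa [mkStore_update_out, mkStore_out] at this

end macros

end HarlowHayden


namespace HarlowHayden

/-! ### Translation of generators to stack machines -/

/-- Print the code of a gate. -/
def emitGate (B : ℕ) : WGate → Prog
  | .had v => .seq (pushBits B (encNat 0)) (emitVar B B v)
  | .phase v => .seq (pushBits B (encNat 1)) (emitVar B B v)
  | .not v =>
    .seq (.seq (pushBits B (encNat 0)) (emitVar B B v))
      (.seq (.seq (pushBits B (encNat 1)) (emitVar B B v))
        (.seq (.seq (pushBits B (encNat 1)) (emitVar B B v))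
          (.seq (pushBits B (encNat 0)) (emitVar B B v))))
  | .tof u v w => .seq (pushBits B (encNat 2)) (.seq (emitVar B B u)
      (.seq (emitVar B B v) (emitVar B B w)))

@[simp] theorem length_encNat (k : ℕ) : (encNat k).length = k + 1 := by simp [encNat]

theorem exec_emitGate {B : ℕ} {rest : Store} {out : List Bool} {σ κ : ℕ → ℕ} {V : ℕ}
    (hκ : κ 0 = 0) (hV : ∀ v, σ v ≤ V) (g : WGate) :
    Exec (emitGate B g) (100 * (V + 1)) (mkStore B rest out σ κ)
      (mkStore B rest ((g.map σ).encode.reverse ++ out) σ κ) := by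
  have tok : ∀ (c v : ℕ) (out : List Bool), Exec (.seq (pushBits B (encNat c)) (emitVar B B v))
      (9 * σ v + c + 5) (mkStore B rest out σ κ)
      (mkStore B rest ((encNat c ++ encNat (σ v)).reverse ++ out) σ κ) := fun c v out =>
    ((exec_pushOut (encNat c)).seq (exec_emitVar hκ v)).congr (by simp) (by simp; omega)
  cases g with
  | had v => have := hV v; exact (tok 0 v out).mono (by omega)
  | phase v => have := hV v; exact (tok 1 v out).mono (by omega)
  | not v =>
    have := hV v
    exact ((tok 0 v out).seq ((tok 1 v _).seq ((tok 1 v _).seq (tok 0 v _)))).congr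
      (by simp [WGate.map, WGate.encode]) (by omega)
  | tof u v w =>
    have h1 := hV u
    have h2 := hV v
    have h3 := hV w
    exact ((exec_pushOut (encNat 2)).seq ((exec_emitVar hκ u).seq ((exec_emitVar hκ v).seq
      (exec_emitVar hκ w)))).congr (by simp [WGate.map, WGate.encode]) (by simp; omega)

namespace Stmt

/-- The stack machine program of a generator; `d` is the first free loop counter. -/
def compile (B : ℕ) : ℕ → Stmt → Prog
  | _, skip => .skip
  | _, zero v => zeroVar B v
  | _, inc v => .push (varReg B v) true
  | _, dec v => .pop (varReg B v)
  | _, copy v w => copyVar B v w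
  | _, emit g => emitGate B g
  | d, seq s s' => .seq (s.compile B d) (s'.compile B d)
  | d, rep q s => .seq (.seq (drain (varReg B q) [ctrReg B 0])
      (drain (ctrReg B 0) [varReg B q, ctrReg B d]))
      (.loop (ctrReg B d) (.seq (.pop (ctrReg B d)) (s.compile B (d + 1))))

end Stmt

theorem natPoly_eval_mono (p : Polynomial ℕ) {a b : ℕ} (h : a ≤ b) : p.eval a ≤ p.eval b := by
  induction p using Polynomial.induction_on' with
  | add p q hp hq => simpa using Nat.add_le_add hp hq
  | monomial n c => simpa using Nat.mul_le_mul_left c (Nat.pow_le_pow_left h n)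

section compile

variable {B : ℕ} {rest : Store} {out : List Bool} {σ κ : ℕ → ℕ}

theorem exec_loadCounter (hκ : κ 0 = 0) {d : ℕ} (hd : d ≠ 0) (hκd : κ d = 0) (q : ℕ) :
    Exec (.seq (drain (varReg B q) [ctrReg B 0]) (drain (ctrReg B 0) [varReg B q, ctrReg B d]))
      (9 * σ q + 2) (mkStore B rest out σ κ)
      (mkStore B rest out σ (Function.update κ d (σ q))) := by
  have h2 := exec_drainToTmp (B := B) (rest := rest) (out := out) (σ := σ) hκ q
  have h3 := exec_drain (r := ctrReg B 0) (L := [varReg B q, ctrReg B d]) (by simp [hd.symm])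
    (mkStore B rest out (Function.update σ q 0) (Function.update κ 0 (σ q)))
  refine (h2.seq h3).congr ?_ (by simp; omega)
  apply store_ext B
  · intro r hr; simp [mkStore_lt hr, ne_ctrReg hr, ne_varReg hr]
  · simp
  · intro x
    by_cases hx : x = q
    · subst hx; simp
    · simp [hx]
  · intro x
    by_cases hx : x = 0
    · subst hx; simp [hd.symm, hκ]
    · by_cases hxd : x = d
      · subst hxd; simp [hx, hκd]
      · simp [hx, hxd]

open Polynomial in
/-- The translated generator computes the semantics in polynomial time: `G` bounds the growth of
the variables and `T` the time. -/
theorem Stmt.exec_compile (B : ℕ) (P : Set ℕ) (s : Stmt) (hs : s.Wf P) :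
    ∃ G T : ℕ[X], ∀ (rest : Store) (out : List Bool) (σ κ : ℕ → ℕ) (d N V : ℕ),
      (∀ q ∈ P, σ q ≤ N) → (∀ v, σ v ≤ V) → 1 ≤ d → κ 0 = 0 → (∀ d' ≥ d, κ d' = 0) →
      (∀ v, s.vars σ v ≤ V + G.eval N) ∧
      Exec (s.compile B d) (T.eval (N + V)) (mkStore B rest out σ κ)
        (mkStore B rest ((encGates (s.gates σ)).reverse ++ out) (s.vars σ) κ) := by
  induction s with
  | skip =>
    refine ⟨0, 1, fun rest out σ κ d N V _ hV _ hκ _ => ⟨by simpa [vars] using hV, ?_⟩⟩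
    simpa [compile, gates, vars] using Exec.skip _
  | zero v =>
    refine ⟨0, 3 * X + 1, fun rest out σ κ d N V _ hV _ hκ _ => ⟨fun w => ?_, ?_⟩⟩
    · have := hV w
      by_cases hw : w = v
      · subst hw; simp [vars]
      · simp [vars, hw, this]
    · have := hV v
      exact (exec_zeroVar v).congr (by simp [gates, vars]) (by simp; omega)
  | inc v =>
    refine ⟨1, 1, fun rest out σ κ d N V _ hV _ hκ _ => ⟨fun w => ?_, ?_⟩⟩
    · have := hV w
      by_cases hw : w = v
      · subst hw; simpa [vars] using this
      · simp [vars, hw]; omega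
    · have h := Exec.push (varReg B v) true (mkStore B rest out σ κ)
      refine h.congr ?_ (by simp)
      simp only [gates, vars, encGates_nil, List.reverse_nil, List.nil_append,
        mkStore_var, ← List.replicate_succ, mkStore_update_var]
  | dec v =>
    refine ⟨0, 1, fun rest out σ κ d N V _ hV _ hκ _ => ⟨fun w => ?_, ?_⟩⟩
    · have := hV w
      by_cases hw : w = v
      · subst hw; simp [vars]; omega
      · simp [vars, hw, this]
    · have h := Exec.pop (varReg B v) (mkStore B rest out σ κ)
      refine h.congr ?_ (by simp)
      simp only [gates, vars, encGates_nil, List.reverse_nil, List.nil_append,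
        mkStore_var, List.tail_replicate, mkStore_update_var]
  | copy v w =>
    refine ⟨0, 12 * X + 3, fun rest out σ κ d N V _ hV _ hκ _ => ⟨fun u => ?_, ?_⟩⟩
    · have := hV u
      by_cases hu : u = v
      · subst hu; simpa [vars] using hV w
      · simp [vars, hu, this]
    · have h1 := hV v
      have h2 := hV w
      exact (exec_copyVar hκ v w).congr (by simp [gates, vars]) (by simp; omega)
  | emit g =>
    refine ⟨0, 100 * (X + 1), fun rest out σ κ d N V _ hV _ hκ _ =>
      ⟨by simpa [vars] using hV, ?_⟩⟩
    exact (exec_emitGate hκ hV g).congr (by simp [gates, vars, encGates]) (by simp)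
  | seq s s' ih ih' =>
    obtain ⟨G, T, h⟩ := ih hs.1
    obtain ⟨G', T', h'⟩ := ih' hs.2
    refine ⟨G + G', T + T'.comp (X + G), fun rest out σ κ d N V hP hV hd hκ hκd => ?_⟩
    obtain ⟨h1, h2⟩ := h rest out σ κ d N V hP hV hd hκ hκd
    obtain ⟨h1', h2'⟩ := h' rest ((encGates (s.gates σ)).reverse ++ out) (s.vars σ) κ d N
      (V + G.eval N) (fun q hq => by rw [hs.1.vars_eq hq]; exact hP q hq) h1 hd hκ hκd
    refine ⟨fun v => ?_, (h2.seq h2').congr (by simp [gates, vars]) ?_⟩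
    · have := h1' v
      simp only [vars, eval_add]; omega
    · simp only [eval_add, eval_comp, eval_X]
      have h3 := natPoly_eval_mono G (show N ≤ N + V by omega)
      exact Nat.add_le_add_left (natPoly_eval_mono T' (by omega)) _
  | rep q s ih =>
    obtain ⟨G, T, h⟩ := ih hs.2
    -- One pass adds at most `G.eval N` to a variable, and `N`, the bound for the controlling
    -- variables, does not change. So i passes add at most i times that amount. If the growth
    -- depended on `V`, iterating it could become exponential.
    refine ⟨X * G, 9 * X + 2 + (X * (T.comp (X + X * G) + 2) + 1),
      fun rest out σ κ d N V hP hV hd hκ hκd => ?_⟩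
    have hN : σ q ≤ N := hP q hs.1
    have key : ∀ i ≤ σ q, (∀ v, (s.vars^[i] σ) v ≤ V + i * G.eval N) ∧
        ∀ p ∈ P, (s.vars^[i] σ) p ≤ N := by
      intro i hi
      induction i with
      | zero => exact ⟨by simpa using hV, hP⟩
      | succ i ihi =>
        obtain ⟨h1, h2⟩ := ihi (by omega)
        have h3 := (h rest out (s.vars^[i] σ) κ d N _ h2 h1 hd hκ hκd).1
        rw [Function.iterate_succ_apply']
        refine ⟨fun v => (h3 v).trans (by ring_nf; omega), fun p hp => ?_⟩
        rw [hs.2.vars_eq hp]; exact h2 p hp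
    refine ⟨fun v => ((key _ le_rfl).1 v).trans ?_, ?_⟩
    · simpa using Nat.mul_le_mul_right _ hN
    · have h1 := exec_loadCounter (B := B) (rest := rest) (out := out) (σ := σ) hκ
        (show d ≠ 0 by omega) (hκd d le_rfl) q
      -- The i-th store holds the gates and variables of i passes; counter `d` has `σ q - i` left,
      -- and the body uses only counters above `d` and the scratch counter.
      have hloop := Exec.loop (r := ctrReg B d)
        (p := .seq (.pop (ctrReg B d)) (s.compile B (d + 1)))
        (T := T.eval (N + V + N * G.eval N) + 1) (σ q)
        (fun i => mkStore B rest ((encGates ((List.range i).flatMap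
          fun i => s.gates (s.vars^[i] σ))).reverse ++ out) (s.vars^[i] σ)
          (Function.update κ d (σ q - i)))
        (fun i hi => by simp; omega)
        (fun i hi => by
          obtain ⟨hk1, hk2⟩ := key i hi.le
          have hpop := Exec.pop (ctrReg B d) (mkStore B rest ((encGates ((List.range i).flatMap
            fun i => s.gates (s.vars^[i] σ))).reverse ++ out) (s.vars^[i] σ)
            (Function.update κ d (σ q - i)))
          rw [mkStore_ctr, List.tail_replicate, mkStore_update_ctr] at hpop
          have hbody := (h rest ((encGates ((List.range i).flatMap
            fun i => s.gates (s.vars^[i] σ))).reverse ++ out) (s.vars^[i] σ)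
            (Function.update (Function.update κ d (σ q - i)) d
              ((Function.update κ d (σ q - i)) d - 1)) (d + 1) N _ hk2 hk1 (by omega)
            (by rw [Function.update_idem, Function.update_of_ne (by omega)]; exact hκ)
            (fun d' hd' => by
              rw [Function.update_idem, Function.update_of_ne (by omega)]
              exact hκd d' (by omega))).2
          refine (hpop.seq hbody).congr ?_ ?_
          · simp [Function.iterate_succ_apply', List.range_succ, Nat.sub_sub]
          · have : i * G.eval N ≤ N * G.eval N := Nat.mul_le_mul_right _ (by omega)
            have := natPoly_eval_mono T (show N + (V + i * G.eval N) ≤ N + V + N * G.eval N by omega)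
            omega)
        (by simp)
      simp only [Function.iterate_zero, id, Nat.sub_zero, Nat.sub_self, List.range_zero,
        List.flatMap_nil, encGates_nil, List.reverse_nil, List.nil_append] at hloop
      refine (h1.seq hloop).congr ?_ ?_
      · rw [← hκd d le_rfl, Function.update_eq_self]
        simp [vars, gates]
      · simp only [eval_add, eval_mul, eval_comp, eval_X, eval_one, eval_ofNat]
        have h3 : G.eval N ≤ G.eval (N + V) := natPoly_eval_mono G (by omega)
        have h4 : N * G.eval N ≤ (N + V) * G.eval (N + V) := Nat.mul_le_mul (by omega) h3
        have h5 := natPoly_eval_mono T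
          (show N + V + N * G.eval N ≤ N + V + (N + V) * G.eval (N + V) by omega)
        have h6 : σ q * (T.eval (N + V + N * G.eval N) + 1 + 1) ≤
          (N + V) * (T.eval (N + V + (N + V) * G.eval (N + V)) + 2) :=
            Nat.mul_le_mul (by omega) (by omega)
        omega

end compile

end HarlowHayden


namespace HarlowHayden

/-! ### Classical evaluation of circuits -/

/-- The action of a classical gate on an assignment of bits to the wires. -/
def WGate.eval : WGate → (ℕ → Bool) → (ℕ → Bool)
  | .had _, m => m
  | .phase _, m => m
  | .not i, m => Function.update m i (!m i)
  | .tof i j k, m => Function.update m k (xor (m k) (m i && m j))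

/-- The action of a list of classical gates. -/
def evalGates (gs : List WGate) (m : ℕ → Bool) : ℕ → Bool := gs.foldl (fun m g => g.eval m) m

@[simp] theorem evalGates_nil (m : ℕ → Bool) : evalGates [] m = m := rfl

@[simp] theorem evalGates_cons (g : WGate) (gs : List WGate) (m : ℕ → Bool) :
    evalGates (g :: gs) m = evalGates gs (g.eval m) := rfl

@[simp] theorem evalGates_append (gs gs' : List WGate) (m : ℕ → Bool) :
    evalGates (gs ++ gs') m = evalGates gs' (evalGates gs m) := by
  simp [evalGates]

/-- A classical gate whose wires are distinct and smaller than `W`. -/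
def WGate.Good (W : ℕ) : WGate → Prop
  | .had _ => False
  | .phase _ => False
  | .not i => i < W
  | .tof i j k => i < W ∧ j < W ∧ k < W ∧ i ≠ j ∧ i ≠ k ∧ j ≠ k

theorem WGate.Good.mono {W W' : ℕ} {g : WGate} (h : g.Good W) (hW : W ≤ W') : g.Good W' := by
  cases g <;> simp only [WGate.Good] at h ⊢ <;> omega

/-- Controlled swap of the wires `c` and `a`. -/
def cswapGates (e c a : ℕ) : List WGate := [.tof e a c, .tof e c a, .tof e a c]

/-- Three alternating XORs between two wires swap them; the control wire switches all three on or
off. -/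
theorem eval_cswapGates {e c a : ℕ} (hec : e ≠ c) (hea : e ≠ a) (hca : c ≠ a) (m : ℕ → Bool) :
    evalGates (cswapGates e c a) m =
      if m e then Function.update (Function.update m c (m a)) a (m c) else m := by
  funext q
  by_cases he : m e
  · by_cases hq : q = a
    · subst hq
      cases h1 : m c <;> cases h2 : m q <;>
        simp [cswapGates, WGate.eval, he, hec, hea, hca, hca.symm, h1, h2]
    · by_cases hqc : q = c
      · subst hqc
        cases h1 : m a <;> cases h2 : m q <;>
        simp [cswapGates, WGate.eval, he, hec, hea, hca, hca.symm, h1, h2]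
      · simp [cswapGates, WGate.eval, he, hq, hqc]
  · simp only [Bool.not_eq_true] at he
    simp [cswapGates, WGate.eval, he]

/-- The carry wire is swapped with the cells in increasing order: each swap deposits the previous
cell and picks up the current one. The carry enters at the front and the last cell ends up on the
carry wire. -/
theorem eval_shiftIn {e c A : ℕ} (n : ℕ) (hec : e ≠ c) (he : ∀ i < n, e ≠ A + i)
    (hc : ∀ i < n, c ≠ A + i) (m : ℕ → Bool) :
    evalGates ((List.range n).flatMap fun i => cswapGates e c (A + i)) m =
      if m e then fun a => if a = c then (if n = 0 then m c else m (A + n - 1))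
        else if A ≤ a ∧ a < A + n then (if a = A then m c else m (a - 1)) else m a
      else m := by
  induction n with
  | zero =>
    have : (fun a => if a = c then m c else m a) = m := by
      funext a; split_ifs with h
      · rw [h]
      · rfl
    have h2 : ∀ a, ¬ (A ≤ a ∧ a < A) := by omega
    simp [h2, this]
  | succ n ih =>
    rw [List.range_succ, List.flatMap_append, evalGates_append,
      ih (fun i hi => he i (by omega)) (fun i hi => hc i (by omega))]
    have h1 := he n (by omega)
    have h2 := hc n (by omega)
    simp only [List.flatMap_cons, List.flatMap_nil, List.append_nil]
    rw [eval_cswapGates hec h1 h2]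
    by_cases hm : m e
    · have h3 : ¬ (A ≤ e ∧ e < A + n) := by
        intro h; exact he (e - A) (by omega) (by omega)
      simp only [hm, if_true, hec, if_false, h3]
      funext a
      by_cases ha : a = A + n
      · subst ha
        simp only [Function.update_self, if_neg h2.symm]
        by_cases hn : n = 0
        · subst hn; simp
        · simp [hn]
      · rw [Function.update_of_ne ha]
        by_cases hac : a = c
        · subst hac
          simp [h2.symm]
        · simp only [Function.update_of_ne hac, hac, if_false]
          have : (A ≤ a ∧ a < A + (n + 1)) ↔ (A ≤ a ∧ a < A + n) := by omega
          simp only [this]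
    · simp [hm]

/-- The same sweep in decreasing order. The statement treats the first `k` swaps so that the
induction leaves the array size `n` fixed. -/
theorem eval_shiftOut {e c A : ℕ} (n : ℕ) (hec : e ≠ c) (he : ∀ i < n, e ≠ A + i)
    (hc : ∀ i < n, c ≠ A + i) (m : ℕ → Bool) (k : ℕ) (hk : k ≤ n) :
    evalGates ((List.range k).flatMap fun i => cswapGates e c (A + n - i - 1)) m =
      if m e then fun a => if a = c then (if k = 0 then m c else m (A + n - k))
        else if A + n - k ≤ a ∧ a < A + n then (if a = A + n - 1 then m c else m (a + 1)) else m a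
      else m := by
  induction k with
  | zero =>
    have : (fun a => if a = c then m c else m a) = m := by
      funext a; split_ifs with h
      · rw [h]
      · rfl
    have h2 : ∀ a, ¬ (A + n ≤ a ∧ a < A + n) := by omega
    simp [h2, this]
  | succ k ih =>
    rw [List.range_succ, List.flatMap_append, evalGates_append, ih (by omega)]
    have h1 : e ≠ A + n - k - 1 := by have := he (n - k - 1) (by omega); omega
    have h2 : c ≠ A + n - k - 1 := by have := hc (n - k - 1) (by omega); omega
    simp only [List.flatMap_cons, List.flatMap_nil, List.append_nil]
    rw [eval_cswapGates hec h1 h2]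
    by_cases hm : m e
    · have h3 : ¬ (A + n - k ≤ e ∧ e < A + n) := by
        intro h; exact he (e - A) (by omega) (by omega)
      simp only [hm, if_true, hec, if_false, h3]
      funext a
      by_cases ha : a = A + n - k - 1
      · subst ha
        have h4 : A + n - (k + 1) ≤ A + n - k - 1 ∧ A + n - k - 1 < A + n := by omega
        simp only [Function.update_self, if_neg h2.symm, if_true, h4, and_self]
        by_cases hn : k = 0
        · subst hn; simp
        · rw [if_neg hn, if_neg (by omega), show A + n - k - 1 + 1 = A + n - k by omega]
      · rw [Function.update_of_ne ha]
        by_cases hac : a = c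
        · subst hac
          have h4 : ¬ (A + n - k ≤ A + n - k - 1 ∧ A + n - k - 1 < A + n) := by omega
          simp only [Function.update_self, if_neg h2.symm, if_true, h4, if_false]
          rw [if_neg (by omega), show A + n - k - 1 = A + n - (k + 1) by omega]
        · simp only [Function.update_of_ne hac, hac, if_false]
          have : (A + n - (k + 1) ≤ a ∧ a < A + n) ↔ (A + n - k ≤ a ∧ a < A + n) := by omega
          simp only [this]
    · simp [hm]

/-! ### Simulation of stack machines by circuits -/

-- Roles of the variables: `vSize` is the capacity of each array, `vFresh` the first unused wire,
-- `vBase` the first wire of the arrays, `vOne` a wire that is constantly 1 (it turns Toffoli gates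
-- into controlled NOTs). `vJ`, `vC`, `vK` are scratch, the second for the carry wire of a shift and
-- the others for pointers to cells. Variables `0` and `1` are left for the lengths of argument and
-- value.
notation "vSize" => (2 : ℕ)
notation "vFresh" => (3 : ℕ)
notation "vBase" => (4 : ℕ)
notation "vOne" => (5 : ℕ)
notation "vJ" => (6 : ℕ)
notation "vC" => (7 : ℕ)
notation "vK" => (8 : ℕ)

namespace Stmt

/-- Advance a variable by `t` times the stack capacity. -/
def advance (v : ℕ) : ℕ → Stmt
  | 0 => skip
  | t + 1 => seq (advance v t) (rep vSize (inc v))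

/-- Controlled swap of the wires `vC` and `vJ`. -/
def cswap (ve : ℕ) : Stmt :=
  seq (emit (.tof ve vJ vC)) (seq (emit (.tof ve vC vJ)) (emit (.tof ve vJ vC)))

/-- Allocate a wire. -/
def newBit (v : ℕ) : Stmt := seq (copy v vFresh) (inc vFresh)

/-- Controlled shift of array `t`, where the bit `b` enters at the front. -/
def shiftIn (ve t : ℕ) (b : Bool) : Stmt :=
  seq (newBit vC) (seq (if b then emit (.tof ve vOne vC) else skip)
    (seq (copy vJ vBase) (seq (advance vJ t) (rep vSize (seq (cswap ve) (inc vJ))))))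

/-- Controlled shift of array `t`, where a `0` enters at the end. -/
def shiftOut (ve t : ℕ) : Stmt :=
  seq (newBit vC) (seq (copy vJ vBase) (seq (advance vJ (t + 1))
    (rep vSize (seq (dec vJ) (cswap ve)))))

/-- Let `vJ` and `vK` be the first cells of the two arrays of register `r`. -/
def locate (r : ℕ) : Stmt :=
  seq (copy vJ vBase) (seq (advance vJ (2 * r)) (seq (copy vK vJ) (advance vK 1)))

/-- Three wires that say which branch is enabled. -/
def branchBits (r ve vn : ℕ) : Stmt :=
  seq (locate r)
    (seq (newBit vn) (seq (emit (.tof ve vOne vn)) (seq (emit (.tof ve vJ vn))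
      (seq (emit (.tof ve vK vn))
        (seq (newBit (vn + 1)) (seq (emit (.tof ve vJ (vn + 1)))
          (seq (newBit (vn + 2)) (emit (.tof ve vK (vn + 2))))))))))

/-- A wire that says whether the body of a loop is enabled. -/
def loopBit (r ve vn : ℕ) : Stmt :=
  seq (locate r) (seq (newBit vn) (seq (emit (.tof ve vJ vn)) (emit (.tof ve vK vn))))

end Stmt

/-- Simulation of a program under the control of the wire in variable `ve`.  Register `r` is kept
in the arrays `2 * r` and `2 * r + 1`, which mark the bits `0` and `1` on the stack.
Variables from `vn` on are free. -/
def Prog.simulate : Prog → ℕ → ℕ → Stmt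
  | .skip, _, _ => .skip
  | .push r b, ve, _ => .seq (.shiftIn ve (2 * r) (!b)) (.shiftIn ve (2 * r + 1) b)
  | .pop r, ve, _ => .seq (.shiftOut ve (2 * r)) (.shiftOut ve (2 * r + 1))
  | .seq p q, ve, vn => .seq (p.simulate ve vn) (q.simulate ve vn)
  | .branch r p q u, ve, vn =>
    .seq (.branchBits r ve vn) (.seq (p.simulate vn (vn + 3))
      (.seq (q.simulate (vn + 1) (vn + 3)) (u.simulate (vn + 2) (vn + 3))))
  | .loop r p, ve, vn => .rep vSize (.seq (.loopBit r ve vn) (p.simulate vn (vn + 1)))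

/-- The arrays of register capacity `σ vSize` hold the bits `X t j`, and all wires from `σ vFresh`
on are `0`. -/
structure Cfg (R : ℕ) (σ : ℕ → ℕ) (m : ℕ → Bool) (X : ℕ → ℕ → Bool) : Prop where
  fresh : σ vBase + 2 * R * σ vSize ≤ σ vFresh
  one_lt : σ vOne < σ vBase
  one : m (σ vOne) = true
  zero : ∀ a, σ vFresh ≤ a → m a = false
  cells : ∀ t < 2 * R, ∀ j < σ vSize, m (σ vBase + t * σ vSize + j) = X t j

/-- Variable `ve` holds a control wire with value `en`. -/
structure Enable (R : ℕ) (σ : ℕ → ℕ) (m : ℕ → Bool) (ve : ℕ) (en : Bool) : Prop where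
  le : 10 ≤ ve
  lt : σ ve < σ vFresh
  out : σ ve < σ vBase ∨ σ vBase + 2 * R * σ vSize ≤ σ ve
  ne : σ ve ≠ σ vOne
  val : m (σ ve) = en

/-- The generator `s` prints good gates, keeps the variables below `vn` except for the scratch
variables, and keeps the old wires outside of the arrays. -/
structure Tame (R vn : ℕ) (s : Stmt) (σ : ℕ → ℕ) (m : ℕ → Bool) : Prop where
  vars : ∀ v < vn, v ≠ vFresh → v ≠ vJ → v ≠ vC → v ≠ vK → s.vars σ v = σ v
  fresh : σ vFresh ≤ s.vars σ vFresh
  mem : ∀ a < σ vFresh, (a < σ vBase ∨ σ vBase + 2 * R * σ vSize ≤ a) →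
    evalGates (s.gates σ) m a = m a
  good : ∀ g ∈ s.gates σ, g.Good (s.vars σ vFresh)

theorem Tame.seq {R vn : ℕ} {s s' : Stmt} {σ : ℕ → ℕ} {m : ℕ → Bool} (hvn : 10 ≤ vn)
    (h : Tame R vn s σ m) (h' : Tame R vn s' (s.vars σ) (evalGates (s.gates σ) m)) :
    Tame R vn (.seq s s') σ m where
  vars v hv h1 h2 h3 h4 := (h'.vars v hv h1 h2 h3 h4).trans (h.vars v hv h1 h2 h3 h4)
  fresh := h.fresh.trans h'.fresh
  mem a ha hout := by
    have e1 := h.vars vBase (by omega) (by omega) (by omega) (by omega) (by omega)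
    have e2 := h.vars vSize (by omega) (by omega) (by omega) (by omega) (by omega)
    simp only [Stmt.gates, evalGates_append]
    rw [h'.mem a (ha.trans_le h.fresh) (by rw [e1, e2]; exact hout), h.mem a ha hout]
  good g hg := by
    simp only [Stmt.gates, List.mem_append] at hg
    rcases hg with hg | hg
    · exact (h.good g hg).mono h'.fresh
    · exact h'.good g hg

theorem Tame.weaken {R vn vn' : ℕ} {s : Stmt} {σ : ℕ → ℕ} {m : ℕ → Bool}
    (h : Tame R vn' s σ m) (hvn : vn ≤ vn') : Tame R vn s σ m :=
  ⟨fun v hv => h.vars v (by omega), h.fresh, h.mem, h.good⟩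

/-- A control wire is an old wire outside the arrays, which is exactly the kind of wire that `Tame`
protects. -/
theorem Enable.of_tame {R vn ve : ℕ} {s : Stmt} {σ : ℕ → ℕ} {m : ℕ → Bool} {en : Bool}
    (h : Enable R σ m ve en) (hs : Tame R vn s σ m) (hve : ve < vn) :
    Enable R (s.vars σ) (evalGates (s.gates σ) m) ve en := by
  have h10 := h.le
  have e1 := hs.vars vBase (by omega) (by omega) (by omega) (by omega) (by omega)
  have e2 := hs.vars vSize (by omega) (by omega) (by omega) (by omega) (by omega)
  have e3 := hs.vars vOne (by omega) (by omega) (by omega) (by omega) (by omega)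
  have e4 := hs.vars ve hve (by omega) (by omega) (by omega) (by omega)
  refine ⟨h.le, ?_, ?_, ?_, ?_⟩
  · rw [e4]; exact h.lt.trans_le hs.fresh
  · rw [e1, e2, e4]; exact h.out
  · rw [e3, e4]; exact h.ne
  · rw [e4, hs.mem _ h.lt h.out]; exact h.val

/-- The bits that represent a store. -/
def content (s : Store) (t j : ℕ) : Bool := decide ((s (t / 2))[j]? = some (t % 2 == 1))

theorem Cfg.congr {R : ℕ} {σ : ℕ → ℕ} {m : ℕ → Bool} {X Y : ℕ → ℕ → Bool} (h : Cfg R σ m X)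
    (hXY : ∀ t < 2 * R, ∀ j < σ vSize, X t j = Y t j) : Cfg R σ m Y :=
  ⟨h.fresh, h.one_lt, h.one, h.zero, fun t ht j hj => (h.cells t ht j hj).trans (hXY t ht j hj)⟩

theorem cell_lt {S t t' j : ℕ} (h : t < t') (hj : j < S) : t * S + j < t' * S :=
  calc t * S + j < t * S + S := by omega
    _ = (t + 1) * S := by ring
    _ ≤ t' * S := Nat.mul_le_mul_right _ h

namespace Stmt

theorem iterate_inc (v i : ℕ) (σ : ℕ → ℕ) :
    (fun σ => Function.update σ v (σ v + 1))^[i] σ = Function.update σ v (σ v + i) := by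
  induction i with
  | zero => simp
  | succ i ih => rw [Function.iterate_succ_apply', ih]; simp [add_assoc]

theorem iterate_dec (v i : ℕ) (σ : ℕ → ℕ) :
    (fun σ => Function.update σ v (σ v - 1))^[i] σ = Function.update σ v (σ v - i) := by
  induction i with
  | zero => simp
  | succ i ih => rw [Function.iterate_succ_apply', ih]; simp [Nat.sub_sub]

theorem advance_vars (v t : ℕ) (hv : v ≠ vSize) (σ : ℕ → ℕ) :
    (advance v t).vars σ = Function.update σ v (σ v + t * σ vSize) := by
  induction t with
  | zero => simp [advance, vars]
  | succ t ih =>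
    simp only [advance, vars, ih, iterate_inc]
    simp [hv.symm, Nat.add_mul, add_assoc]

theorem advance_gates (v t : ℕ) (σ : ℕ → ℕ) : (advance v t).gates σ = [] := by
  induction t with
  | zero => simp [advance, gates]
  | succ t ih => simp [advance, gates, ih]

theorem shiftIn_vars (ve t : ℕ) (b : Bool) (σ : ℕ → ℕ) :
    (shiftIn ve t b).vars σ = Function.update (Function.update (Function.update σ vC (σ vFresh))
      vFresh (σ vFresh + 1)) vJ (σ vBase + t * σ vSize + σ vSize) := by
  cases b <;> simp [shiftIn, newBit, vars, advance_vars, cswap, iterate_inc]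

theorem shiftIn_gates {ve : ℕ} (hve : 10 ≤ ve) (t : ℕ) (b : Bool) (σ : ℕ → ℕ) :
    (shiftIn ve t b).gates σ = (if b then [.tof (σ ve) (σ vOne) (σ vFresh)] else []) ++
      (List.range (σ vSize)).flatMap fun i =>
        cswapGates (σ ve) (σ vFresh) (σ vBase + t * σ vSize + i) := by
  have h1 : ve ≠ vFresh := by omega
  have h2 : ve ≠ vJ := by omega
  have h3 : ve ≠ vC := by omega
  cases b <;> simp [shiftIn, newBit, vars, gates, advance_vars, advance_gates, iterate_inc,
    cswap, cswapGates, WGate.map, h1, h2, h3]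

theorem shiftOut_vars (ve t : ℕ) (σ : ℕ → ℕ) :
    (shiftOut ve t).vars σ = Function.update (Function.update (Function.update σ vC (σ vFresh))
      vFresh (σ vFresh + 1)) vJ (σ vBase + (t + 1) * σ vSize - σ vSize) := by
  simp [shiftOut, newBit, vars, advance_vars, cswap, iterate_dec]

theorem shiftOut_gates {ve : ℕ} (hve : 10 ≤ ve) (t : ℕ) (σ : ℕ → ℕ) :
    (shiftOut ve t).gates σ = (List.range (σ vSize)).flatMap fun i =>
        cswapGates (σ ve) (σ vFresh) (σ vBase + (t + 1) * σ vSize - i - 1) := by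
  have h1 : ve ≠ vFresh := by omega
  have h2 : ve ≠ vJ := by omega
  have h3 : ve ≠ vC := by omega
  simp [shiftOut, newBit, vars, gates, advance_vars, advance_gates, iterate_dec,
    cswap, cswapGates, WGate.map, h1, h2, h3]

end Stmt

/-! ### Controlled shifts of one array -/

section shifts

variable {R vn ve t : ℕ} {σ : ℕ → ℕ} {m : ℕ → Bool} {X : ℕ → ℕ → Bool} {en : Bool}

theorem good_cswapGates {e c a W : ℕ} (he : e < W) (hc : c < W) (ha : a < W) (hec : e ≠ c)
    (hea : e ≠ a) (hca : c ≠ a) : ∀ g ∈ cswapGates e c a, g.Good W := by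
  simp [cswapGates, WGate.Good, *, Ne.symm hca]

/-- The carry is a newly allocated wire, loaded with `en && b`. After the sweep it keeps the bit
that fell off the array; this garbage is harmless, because `vFresh` has moved past it. Losing that
bit is why correctness later needs a bound on the stack lengths. -/
theorem shiftIn_spec (h : Cfg R σ m X) (he : Enable R σ m ve en) (ht : t < 2 * R) (b : Bool) :
    Tame R vn (.shiftIn ve t b) σ m ∧
    Cfg R ((Stmt.shiftIn ve t b).vars σ) (evalGates ((Stmt.shiftIn ve t b).gates σ) m)
      (if en then Function.update X t fun j => if j = 0 then b else X t (j - 1) else X) := by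
  have ht' : t * σ vSize + σ vSize ≤ 2 * R * σ vSize := by
    calc t * σ vSize + σ vSize = (t + 1) * σ vSize := by ring
      _ ≤ _ := Nat.mul_le_mul_right _ ht
  have hf := h.fresh
  have h1 := h.one_lt
  have hlt := he.lt
  have hout := he.out
  have hval := he.val
  have hone := h.one
  set A := σ vBase + t * σ vSize with hA
  -- the memory after the carry wire has been prepared
  set m₁ : ℕ → Bool := fun a => if a = σ vFresh then (en && b) else m a with hm₁
  have hprep : evalGates (if b then [WGate.tof (σ ve) (σ vOne) (σ vFresh)] else []) m = m₁ := by
    have hz := h.zero _ le_rfl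
    funext a
    cases b
    · by_cases ha : a = σ vFresh <;> simp [hm₁, ha, hz]
    · by_cases ha : a = σ vFresh
      · subst ha; simp [hm₁, WGate.eval, hz, hval, hone]
      · simp [hm₁, WGate.eval, ha]
  have hmem : evalGates ((Stmt.shiftIn ve t b).gates σ) m =
      if en then fun a => if a = σ vFresh then (if σ vSize = 0 then m₁ (σ vFresh) else m₁ (A + σ vSize - 1))
        else if A ≤ a ∧ a < A + σ vSize then (if a = A then m₁ (σ vFresh) else m₁ (a - 1)) else m₁ a
      else m₁ := by
    rw [Stmt.shiftIn_gates he.le, ← hA, evalGates_append, hprep,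
      eval_shiftIn _ (by omega) (by intros; omega) (by intros; omega)]
    simp only [hm₁, if_neg hlt.ne, hval]
  have hmem' : ∀ a, a ≠ σ vFresh → (a < A ∨ A + σ vSize ≤ a) →
      evalGates ((Stmt.shiftIn ve t b).gates σ) m a = m a := by
    intro a ha ha'
    rw [hmem]
    cases en <;> simp [ha, hm₁, show ¬ (A ≤ a ∧ a < A + σ vSize) by omega]
  refine ⟨⟨?_, ?_, ?_, ?_⟩, ⟨?_, ?_, ?_, ?_, ?_⟩⟩
  · intro v _ h3 h6 h7 h8
    simp [Stmt.shiftIn_vars, h3, h6, h7]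
  · simp [Stmt.shiftIn_vars]
  · intro a ha ha'
    exact hmem' a ha.ne (by omega)
  · intro g hg
    rw [Stmt.shiftIn_gates he.le] at hg
    have hW : (Stmt.shiftIn ve t b).vars σ vFresh = σ vFresh + 1 := by simp [Stmt.shiftIn_vars]
    rw [hW]
    simp only [List.mem_append, List.mem_flatMap, List.mem_range] at hg
    rcases hg with hg | ⟨i, hi, hg⟩
    · have hne := he.ne
      cases b <;> simp at hg
      subst hg
      simp only [WGate.Good]; omega
    · exact good_cswapGates (by omega) (by omega) (by omega) (by omega) (by omega) (by omega) g hg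
  · simp [Stmt.shiftIn_vars]; omega
  · simpa [Stmt.shiftIn_vars] using h1
  · have e : (Stmt.shiftIn ve t b).vars σ vOne = σ vOne := by simp [Stmt.shiftIn_vars]
    rw [e, hmem' _ (by omega) (by omega), hone]
  · have e : (Stmt.shiftIn ve t b).vars σ vFresh = σ vFresh + 1 := by simp [Stmt.shiftIn_vars]
    rw [e]
    intro a ha
    rw [hmem' a (by omega) (by omega), h.zero a (by omega)]
  · have e1 : (Stmt.shiftIn ve t b).vars σ vBase = σ vBase := by simp [Stmt.shiftIn_vars]
    have e2 : (Stmt.shiftIn ve t b).vars σ vSize = σ vSize := by simp [Stmt.shiftIn_vars]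
    rw [e1, e2]
    intro t' ht2 j hj
    have hc := h.cells t' ht2
    have hlt2 := cell_lt ht2 hj
    by_cases htt : t' = t
    · subst htt
      rw [hmem]
      have hcj := hc j hj
      cases hen : en
      · simp [hm₁, hcj, show σ vBase + t' * σ vSize + j ≠ σ vFresh by omega]
      · have c1 : σ vBase + t' * σ vSize + j ≠ σ vFresh := by omega
        have c2 : A ≤ σ vBase + t' * σ vSize + j ∧ σ vBase + t' * σ vSize + j < A + σ vSize := by omega
        simp only [if_true, if_neg c1, if_pos c2, Function.update_self]
        by_cases hj0 : j = 0
        · subst hj0; simp [hm₁, hA, hen]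
        · have c3 := hc (j - 1) (by omega)
          rw [if_neg (by omega), if_neg hj0, ← c3]
          simp only [hm₁]
          rw [if_neg (by omega), show σ vBase + t' * σ vSize + j - 1 =
            σ vBase + t' * σ vSize + (j - 1) by omega]
    · have : σ vBase + t' * σ vSize + j < A ∨ A + σ vSize ≤ σ vBase + t' * σ vSize + j := by
        rcases lt_or_gt_of_ne htt with hlt3 | hgt
        · have := cell_lt hlt3 hj; omega
        · have : (t + 1) * σ vSize ≤ t' * σ vSize := Nat.mul_le_mul_right _ hgt
          rw [Nat.add_mul] at this; omega
      rw [hmem' _ (by omega) this, hc j hj]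
      cases en <;> simp [htt]

/-- The new carry wire is `0`, so a `0` enters at the far end while the front cell is moved to the
carry wire and abandoned there. -/
theorem shiftOut_spec (h : Cfg R σ m X) (he : Enable R σ m ve en) (ht : t < 2 * R) :
    Tame R vn (.shiftOut ve t) σ m ∧
    Cfg R ((Stmt.shiftOut ve t).vars σ) (evalGates ((Stmt.shiftOut ve t).gates σ) m)
      (if en then Function.update X t fun j => if j + 1 < σ vSize then X t (j + 1) else false
        else X) := by
  have ht' : t * σ vSize + σ vSize ≤ 2 * R * σ vSize := by
    calc t * σ vSize + σ vSize = (t + 1) * σ vSize := by ring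
      _ ≤ _ := Nat.mul_le_mul_right _ ht
  have hf := h.fresh
  have h1 := h.one_lt
  have hlt := he.lt
  have hout := he.out
  have hval := he.val
  have hone := h.one
  have hz := h.zero _ le_rfl
  set A := σ vBase + t * σ vSize with hA
  have hAS : σ vBase + (t + 1) * σ vSize = A + σ vSize := by rw [Nat.add_mul]; omega
  have hmem : evalGates ((Stmt.shiftOut ve t).gates σ) m =
      if en then fun a => if a = σ vFresh then (if σ vSize = 0 then m (σ vFresh) else m (A + σ vSize - σ vSize))
        else if A + σ vSize - σ vSize ≤ a ∧ a < A + σ vSize then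
          (if a = A + σ vSize - 1 then m (σ vFresh) else m (a + 1)) else m a
      else m := by
    rw [Stmt.shiftOut_gates he.le, hAS,
      eval_shiftOut (σ vSize) (by omega) (by intros; omega) (by intros; omega) m (σ vSize) le_rfl, hval]
  rw [Nat.add_sub_cancel] at hmem
  have hmem' : ∀ a, a ≠ σ vFresh → (a < A ∨ A + σ vSize ≤ a) →
      evalGates ((Stmt.shiftOut ve t).gates σ) m a = m a := by
    intro a ha ha'
    rw [hmem]
    cases en <;> simp [ha, show ¬ (A ≤ a ∧ a < A + σ vSize) by omega]
  refine ⟨⟨?_, ?_, ?_, ?_⟩, ⟨?_, ?_, ?_, ?_, ?_⟩⟩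
  · intro v _ h3 h6 h7 h8
    simp [Stmt.shiftOut_vars, h3, h6, h7]
  · simp [Stmt.shiftOut_vars]
  · intro a ha ha'
    exact hmem' a ha.ne (by omega)
  · intro g hg
    rw [Stmt.shiftOut_gates he.le, hAS] at hg
    have hW : (Stmt.shiftOut ve t).vars σ vFresh = σ vFresh + 1 := by simp [Stmt.shiftOut_vars]
    rw [hW]
    simp only [List.mem_flatMap, List.mem_range] at hg
    rcases hg with ⟨i, hi, hg⟩
    exact good_cswapGates (by omega) (by omega) (by omega) (by omega) (by omega) (by omega) g hg
  · simp [Stmt.shiftOut_vars]; omega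
  · simpa [Stmt.shiftOut_vars] using h1
  · have e : (Stmt.shiftOut ve t).vars σ vOne = σ vOne := by simp [Stmt.shiftOut_vars]
    rw [e, hmem' _ (by omega) (by omega), hone]
  · have e : (Stmt.shiftOut ve t).vars σ vFresh = σ vFresh + 1 := by simp [Stmt.shiftOut_vars]
    rw [e]
    intro a ha
    rw [hmem' a (by omega) (by omega), h.zero a (by omega)]
  · have e1 : (Stmt.shiftOut ve t).vars σ vBase = σ vBase := by simp [Stmt.shiftOut_vars]
    have e2 : (Stmt.shiftOut ve t).vars σ vSize = σ vSize := by simp [Stmt.shiftOut_vars]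
    rw [e1, e2]
    intro t' ht2 j hj
    have hc := h.cells t' ht2
    have hlt2 := cell_lt ht2 hj
    by_cases htt : t' = t
    · subst htt
      rw [hmem]
      have hcj := hc j hj
      cases hen : en
      · simp [hcj]
      · have c1 : σ vBase + t' * σ vSize + j ≠ σ vFresh := by omega
        have c2 : A ≤ σ vBase + t' * σ vSize + j ∧ σ vBase + t' * σ vSize + j < A + σ vSize := by omega
        simp only [if_true, if_neg c1, if_pos c2, Function.update_self]
        by_cases hj0 : j + 1 < σ vSize
        · have c3 := hc (j + 1) hj0
          rw [if_neg (by omega), if_pos hj0, ← c3]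
          rfl
        · rw [if_pos (by omega), if_neg hj0, hz]
    · have : σ vBase + t' * σ vSize + j < A ∨ A + σ vSize ≤ σ vBase + t' * σ vSize + j := by
        rcases lt_or_gt_of_ne htt with hlt3 | hgt
        · have := cell_lt hlt3 hj; omega
        · have : (t + 1) * σ vSize ≤ t' * σ vSize := Nat.mul_le_mul_right _ hgt
          rw [Nat.add_mul] at this; omega
      rw [hmem' _ (by omega) this, hc j hj]
      cases en <;> simp [htt]

end shifts

end HarlowHayden


namespace HarlowHayden

/-! ### Control wires for branches and loops -/

section bits

variable {R vn ve r : ℕ} {σ : ℕ → ℕ} {m : ℕ → Bool} {X : ℕ → ℕ → Bool} {en : Bool}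

theorem Cfg.of_update {σ' : ℕ → ℕ} {m' : ℕ → Bool} (h : Cfg R σ m X)
    (h2 : σ' vSize = σ vSize) (h3 : σ vFresh ≤ σ' vFresh) (h4 : σ' vBase = σ vBase)
    (h5 : σ' vOne = σ vOne) (hm : ∀ a < σ vFresh, m' a = m a)
    (hz : ∀ a, σ' vFresh ≤ a → m' a = false) : Cfg R σ' m' X := by
  have hf := h.fresh
  have h1 := h.one_lt
  refine ⟨?_, ?_, ?_, hz, ?_⟩
  · rw [h2, h4]; exact hf.trans h3
  · rw [h4, h5]; exact h1
  · rw [h5, hm _ (by omega)]; exact h.one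
  · intro t ht j hj
    rw [h2] at hj
    have := cell_lt ht hj
    rw [h2, h4, hm _ (by omega)]
    exact h.cells t ht j hj

/-- The front cells of the two arrays of a register mark a top bit `0` and a top bit `1`; at most
one is set for a genuine stack, so they agree exactly when it is empty. The first new wire is the
XOR of the control with its products with both marks, which computes this agreement; the other two
are the products themselves. All three are fixed before any branch runs. -/
theorem branchBits_spec (h : Cfg R σ m X) (he : Enable R σ m ve en) (hr : r < R)
    (hS : 1 ≤ σ vSize) (hvn : 11 ≤ vn) (hve : ve < vn) :
    Tame R vn (.branchBits r ve vn) σ m ∧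
    Cfg R ((Stmt.branchBits r ve vn).vars σ) (evalGates ((Stmt.branchBits r ve vn).gates σ) m) X ∧
    Enable R ((Stmt.branchBits r ve vn).vars σ)
      (evalGates ((Stmt.branchBits r ve vn).gates σ) m) vn
      (en && (X (2 * r) 0 == X (2 * r + 1) 0)) ∧
    Enable R ((Stmt.branchBits r ve vn).vars σ)
      (evalGates ((Stmt.branchBits r ve vn).gates σ) m) (vn + 1) (en && X (2 * r) 0) ∧
    Enable R ((Stmt.branchBits r ve vn).vars σ)
      (evalGates ((Stmt.branchBits r ve vn).gates σ) m) (vn + 2) (en && X (2 * r + 1) 0) := by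
  have h10 := he.le
  have hf := h.fresh
  have h1 := h.one_lt
  have hlt := he.lt
  have hout := he.out
  have hne := he.ne
  have n2 : vn ≠ vSize := by omega
  have n3 : vn ≠ vFresh := by omega
  have n4 : vn ≠ vBase := by omega
  have n5 : vn ≠ vOne := by omega
  have n6 : vn ≠ vJ := by omega
  have n8 : vn ≠ vK := by omega
  have n9 : ve ≠ vn := by omega
  have n10 : ve ≠ vn + 1 := by omega
  have n11 : ve ≠ vn + 2 := by omega
  have n12 : ve ≠ vJ := by omega
  have n13 : ve ≠ vK := by omega
  have n14 : ve ≠ vFresh := by omega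
  have m3 : vn + 1 ≠ vFresh := by omega
  have m6 : vn + 1 ≠ vJ := by omega
  have m8 : vn + 1 ≠ vK := by omega
  have l8 : vn + 2 ≠ vK := by omega
  have l3 : vn + 2 ≠ vFresh := by omega
  have n0 : vn ≠ 0 := by omega
  have n1 : vn ≠ 1 := by omega
  have c0 := h.cells (2 * r) (by omega) 0 (by omega)
  have c1 := h.cells (2 * r + 1) (by omega) 0 (by omega)
  have b0 := cell_lt (show 2 * r < 2 * R by omega) (show 0 < σ vSize by omega)
  have b1 := cell_lt (show 2 * r + 1 < 2 * R by omega) (show 0 < σ vSize by omega)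
  have hK : σ vBase + 2 * r * σ vSize + σ vSize = σ vBase + (2 * r + 1) * σ vSize + 0 := by ring
  have hvars : (Stmt.branchBits r ve vn).vars σ = Function.update (Function.update
      (Function.update (Function.update (Function.update (Function.update σ vJ
        (σ vBase + 2 * r * σ vSize)) vK (σ vBase + 2 * r * σ vSize + σ vSize)) vn (σ vFresh))
        (vn + 1) (σ vFresh + 1)) (vn + 2) (σ vFresh + 2)) vFresh (σ vFresh + 3) := by
    funext v
    by_cases hv3 : v = vFresh
    · subst hv3
      simp [Stmt.branchBits, Stmt.locate, Stmt.newBit, Stmt.vars, Stmt.advance_vars,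
        n3.symm, m3.symm, l3.symm]
    · simp only [Stmt.branchBits, Stmt.locate, Stmt.newBit, Stmt.vars]
      simp [Stmt.advance_vars, hv3, n3.symm, m3.symm, Function.update_apply]
  have hgates : (Stmt.branchBits r ve vn).gates σ =
      [.tof (σ ve) (σ vOne) (σ vFresh), .tof (σ ve) (σ vBase + 2 * r * σ vSize) (σ vFresh),
        .tof (σ ve) (σ vBase + 2 * r * σ vSize + σ vSize) (σ vFresh),
        .tof (σ ve) (σ vBase + 2 * r * σ vSize) (σ vFresh + 1),
        .tof (σ ve) (σ vBase + 2 * r * σ vSize + σ vSize) (σ vFresh + 2)] := by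
    simp [Stmt.branchBits, Stmt.locate, Stmt.newBit, Stmt.vars, Stmt.gates, Stmt.advance_vars,
      Stmt.advance_gates, WGate.map, n3, n5.symm, n6.symm, n8.symm, n9, n10, n11, n12, n13, n14,
      m3, m6.symm, m8.symm, l8.symm, n3.symm, m3.symm, l3, l3.symm]
  rw [hvars, hgates]
  have z0 := h.zero (σ vFresh) le_rfl
  have z1 := h.zero (σ vFresh + 1) (by omega)
  have z2 := h.zero (σ vFresh + 2) (by omega)
  have e1 : m (σ vBase + 2 * r * σ vSize) = X (2 * r) 0 := c0
  have e2 : m (σ vBase + 2 * r * σ vSize + σ vSize) = X (2 * r + 1) 0 := by rw [hK]; exact c1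
  have e3 := h.one
  have e4 := he.val
  have i1 : σ ve ≠ σ vFresh := by omega
  have i2 : σ ve ≠ σ vFresh + 1 := by omega
  have i3 : σ ve ≠ σ vFresh + 2 := by omega
  have i4 : σ vBase + 2 * r * σ vSize ≠ σ vFresh := by omega
  have i5 : σ vBase + 2 * r * σ vSize + σ vSize ≠ σ vFresh := by omega
  have i6 : σ vBase + 2 * r * σ vSize ≠ σ vFresh + 1 := by omega
  have i7 : σ vBase + 2 * r * σ vSize + σ vSize ≠ σ vFresh + 1 := by omega
  have i8 : σ vBase + 2 * r * σ vSize + σ vSize ≠ σ vFresh + 2 := by omega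
  have hmem : evalGates [.tof (σ ve) (σ vOne) (σ vFresh),
        .tof (σ ve) (σ vBase + 2 * r * σ vSize) (σ vFresh),
        .tof (σ ve) (σ vBase + 2 * r * σ vSize + σ vSize) (σ vFresh),
        .tof (σ ve) (σ vBase + 2 * r * σ vSize) (σ vFresh + 1),
        .tof (σ ve) (σ vBase + 2 * r * σ vSize + σ vSize) (σ vFresh + 2)] m =
      Function.update (Function.update (Function.update m (σ vFresh)
        (en && (X (2 * r) 0 == X (2 * r + 1) 0))) (σ vFresh + 1) (en && X (2 * r) 0))
        (σ vFresh + 2) (en && X (2 * r + 1) 0) := by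
    simp only [evalGates_cons, evalGates_nil, WGate.eval]
    simp only [Function.update_self, Function.update_of_ne i1, Function.update_of_ne i2,
      Function.update_of_ne i4, Function.update_of_ne i5,
      Function.update_of_ne i7, Function.update_idem,
      Function.update_of_ne (show σ vFresh + 2 ≠ σ vFresh + 1 by omega),
      Function.update_of_ne (show σ vFresh + 2 ≠ σ vFresh by omega),
      Function.update_of_ne (show σ vFresh + 1 ≠ σ vFresh by omega), z0, z1, z2, e1, e2, e3, e4]
    cases en <;> cases X (2 * r) 0 <;> cases X (2 * r + 1) 0 <;> rfl
  rw [hmem]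
  have hold : ∀ a < σ vFresh, Function.update (Function.update (Function.update m (σ vFresh)
        (en && (X (2 * r) 0 == X (2 * r + 1) 0))) (σ vFresh + 1) (en && X (2 * r) 0))
        (σ vFresh + 2) (en && X (2 * r + 1) 0) a = m a := by
    intro a ha
    rw [Function.update_of_ne (by omega), Function.update_of_ne (by omega),
      Function.update_of_ne (by omega)]
  refine ⟨⟨?_, ?_, ?_, ?_⟩, h.of_update ?_ ?_ ?_ ?_ hold ?_, ⟨?_, ?_, ?_, ?_, ?_⟩,
    ⟨?_, ?_, ?_, ?_, ?_⟩, ⟨?_, ?_, ?_, ?_, ?_⟩⟩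
  · intro v hv h3 h6 h7 h8
    rw [hvars]
    simp [h3, h6, h8, hv.ne, (show v ≠ vn + 1 by omega), (show v ≠ vn + 2 by omega)]
  · rw [hvars]; simp
  · intro a ha _
    rw [hgates, hmem, hold a ha]
  · rw [hgates, hvars]
    simp only [List.mem_cons, List.not_mem_nil, or_false]
    rintro g (rfl | rfl | rfl | rfl | rfl) <;> simp only [WGate.Good, Function.update_self] <;>
      omega
  · simp [n0, n1, n2.symm]
  · simp
  · simp [n4.symm, (show vBase ≠ vn + 1 by omega), (show vBase ≠ vn + 2 by omega)]
  · simp [n5.symm, (show vOne ≠ vn + 1 by omega), (show vOne ≠ vn + 2 by omega)]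
  · simp only [Function.update_self]
    intro a ha
    rw [Function.update_of_ne (by omega), Function.update_of_ne (by omega),
      Function.update_of_ne (by omega), h.zero a (by omega)]
  all_goals first
    | omega
    | (simp [n0, n1, n2.symm, l3, n3, m3, n4.symm, n5.symm,
        (show vBase ≠ vn + 1 by omega), (show vBase ≠ vn + 2 by omega),
        (show vOne ≠ vn + 1 by omega), (show vOne ≠ vn + 2 by omega)]; done)
    | (simp [n0, n1, n2.symm, l3, n3, m3, n4.symm, n5.symm,
        (show vBase ≠ vn + 1 by omega), (show vBase ≠ vn + 2 by omega),
        (show vOne ≠ vn + 1 by omega), (show vOne ≠ vn + 2 by omega)]; omega)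

/-- The stack is not empty exactly when its two front marks differ; the XOR of their products with
the control wire records this. -/
theorem loopBit_spec (h : Cfg R σ m X) (he : Enable R σ m ve en) (hr : r < R)
    (hS : 1 ≤ σ vSize) (hvn : 11 ≤ vn) (hve : ve < vn) :
    Tame R vn (.loopBit r ve vn) σ m ∧
    Cfg R ((Stmt.loopBit r ve vn).vars σ) (evalGates ((Stmt.loopBit r ve vn).gates σ) m) X ∧
    Enable R ((Stmt.loopBit r ve vn).vars σ)
      (evalGates ((Stmt.loopBit r ve vn).gates σ) m) vn
      (en && (X (2 * r) 0 != X (2 * r + 1) 0)) := by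
  have h10 := he.le
  have hf := h.fresh
  have h1 := h.one_lt
  have hlt := he.lt
  have hout := he.out
  have n2 : vn ≠ vSize := by omega
  have n3 : vn ≠ vFresh := by omega
  have n4 : vn ≠ vBase := by omega
  have n5 : vn ≠ vOne := by omega
  have n6 : vn ≠ vJ := by omega
  have n8 : vn ≠ vK := by omega
  have n9 : ve ≠ vn := by omega
  have n12 : ve ≠ vJ := by omega
  have n13 : ve ≠ vK := by omega
  have n14 : ve ≠ vFresh := by omega
  have c0 := h.cells (2 * r) (by omega) 0 (by omega)
  have c1 := h.cells (2 * r + 1) (by omega) 0 (by omega)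
  have b0 := cell_lt (show 2 * r < 2 * R by omega) (show 0 < σ vSize by omega)
  have b1 := cell_lt (show 2 * r + 1 < 2 * R by omega) (show 0 < σ vSize by omega)
  have hK : σ vBase + 2 * r * σ vSize + σ vSize = σ vBase + (2 * r + 1) * σ vSize + 0 := by ring
  have hvars : (Stmt.loopBit r ve vn).vars σ = Function.update (Function.update (Function.update
      (Function.update σ vJ (σ vBase + 2 * r * σ vSize)) vK (σ vBase + 2 * r * σ vSize + σ vSize))
        vn (σ vFresh)) vFresh (σ vFresh + 1) := by
    simp [Stmt.loopBit, Stmt.locate, Stmt.newBit, Stmt.vars, Stmt.advance_vars, n3.symm]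
  have hgates : (Stmt.loopBit r ve vn).gates σ =
      [.tof (σ ve) (σ vBase + 2 * r * σ vSize) (σ vFresh),
        .tof (σ ve) (σ vBase + 2 * r * σ vSize + σ vSize) (σ vFresh)] := by
    simp [Stmt.loopBit, Stmt.locate, Stmt.newBit, Stmt.vars, Stmt.gates, Stmt.advance_vars,
      Stmt.advance_gates, WGate.map, n3, n6.symm, n8.symm, n9, n12, n13, n14, n3.symm]
  have z0 := h.zero (σ vFresh) le_rfl
  have e1 : m (σ vBase + 2 * r * σ vSize) = X (2 * r) 0 := c0
  have e2 : m (σ vBase + 2 * r * σ vSize + σ vSize) = X (2 * r + 1) 0 := by rw [hK]; exact c1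
  have e4 := he.val
  have i1 : σ ve ≠ σ vFresh := by omega
  have i4 : σ vBase + 2 * r * σ vSize ≠ σ vFresh := by omega
  have i5 : σ vBase + 2 * r * σ vSize + σ vSize ≠ σ vFresh := by omega
  have hmem : evalGates [.tof (σ ve) (σ vBase + 2 * r * σ vSize) (σ vFresh),
        .tof (σ ve) (σ vBase + 2 * r * σ vSize + σ vSize) (σ vFresh)] m =
      Function.update m (σ vFresh) (en && (X (2 * r) 0 != X (2 * r + 1) 0)) := by
    simp only [evalGates_cons, evalGates_nil, WGate.eval]
    simp only [Function.update_self, Function.update_of_ne i1,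
      Function.update_of_ne i5, Function.update_idem, z0, e1, e2, e4]
    cases en <;> cases X (2 * r) 0 <;> cases X (2 * r + 1) 0 <;> rfl
  refine ⟨⟨?_, ?_, ?_, ?_⟩, ?_⟩
  · intro v hv h3 h6 h7 h8
    rw [hvars]
    simp [h3, h6, h8, hv.ne]
  · rw [hvars]; simp
  · intro a ha _
    rw [hgates, hmem, Function.update_of_ne (by omega)]
  · rw [hgates, hvars]
    simp only [List.mem_cons, List.not_mem_nil, or_false]
    rintro g (rfl | rfl) <;> simp only [WGate.Good, Function.update_self] <;> omega
  · rw [hvars, hgates, hmem]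
    refine ⟨h.of_update ?_ ?_ ?_ ?_ ?_ ?_, ⟨?_, ?_, ?_, ?_, ?_⟩⟩
    · simp [n2.symm]
    · simp
    · simp [n4.symm]
    · simp [n5.symm]
    · intro a ha; rw [Function.update_of_ne (by omega)]
    · simp only [Function.update_self]
      intro a ha
      rw [Function.update_of_ne (by omega), h.zero a (by omega)]
    · omega
    · simp [n3]
    · simp [n2.symm, n3, n4.symm]; omega
    · simp [n3, n5.symm]; omega
    · simp [n3]

end bits

end HarlowHayden


/-! ### Correctness of the simulation -/

namespace HarlowHayden

/-- What a program does to a store within the capacity `S`, under the control of `en`. -/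
def Eff (R S : ℕ) (c : Prog) (en : Bool) (s s' : Store) : Prop :=
  (en = false ∧ s' = s ∧ ∀ r < R, (s r).length ≤ S) ∨
  (en = true ∧ ∃ t, Runs c s t s' ∧ ∀ r < R, (s r).length + t ≤ S)

theorem Eff.length_le {R S : ℕ} {c : Prog} {en : Bool} {s s' : Store} (h : Eff R S c en s s')
    {r : ℕ} (hr : r < R) : (s r).length ≤ S := by
  rcases h with ⟨_, _, h⟩ | ⟨_, t, _, h⟩
  · exact h r hr
  · have := h r hr; omega

/-- The slack for the time of the whole run is divided: stacks grow by at most the time of the first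
half, so the second half still fits into the capacity. -/
theorem Eff.seq {R S : ℕ} {p q : Prog} {en : Bool} {s s'' : Store}
    (h : Eff R S (.seq p q) en s s'') : ∃ s', Eff R S p en s s' ∧ Eff R S q en s' s'' := by
  rcases h with ⟨he, rfl, h⟩ | ⟨he, t, hr, h⟩
  · exact ⟨s'', .inl ⟨he, rfl, h⟩, .inl ⟨he, rfl, h⟩⟩
  · cases hr with
    | @seq _ _ _ s' _ t t' h1 h2 =>
      refine ⟨s', .inr ⟨he, t, h1, fun r hr => ?_⟩, .inr ⟨he, t', h2, fun r hr => ?_⟩⟩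
      · have := h r hr; omega
      · have := h r hr; have := h1.length_le r; omega

theorem content_zero (s : Store) (r j : ℕ) :
    content s (2 * r) j = decide ((s r)[j]? = some false) := by
  simp [content]

theorem content_one (s : Store) (r j : ℕ) :
    content s (2 * r + 1) j = decide ((s r)[j]? = some true) := by
  simp [content, show (2 * r + 1) / 2 = r by omega, show (2 * r + 1) % 2 = 1 by omega]

theorem content_update_of_ne {s : Store} {r t j : ℕ} {l : List Bool} (h : t / 2 ≠ r) :
    content (Function.update s r l) t j = content s t j := by
  simp [content, h]

theorem getElem?_cons_eq_some (l : List Bool) (b b' : Bool) (j : ℕ) :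
    decide ((b :: l)[j]? = some b') = if j = 0 then b == b' else decide (l[j - 1]? = some b') := by
  cases j with
  | zero => cases b <;> cases b' <;> simp
  | succ j => simp

theorem Tame.skip (R vn : ℕ) (σ : ℕ → ℕ) (m : ℕ → Bool) : Tame R vn .skip σ m :=
  ⟨fun _ _ _ _ _ _ => rfl, le_rfl, fun _ _ _ => rfl, fun g hg => by simp [Stmt.gates] at hg⟩

/-- `n` copies of `s`. -/
def Stmt.iter (s : Stmt) : ℕ → Stmt
  | 0 => .skip
  | n + 1 => .seq s (s.iter n)

theorem Stmt.iter_vars (s : Stmt) (n : ℕ) (σ : ℕ → ℕ) : (s.iter n).vars σ = s.vars^[n] σ := by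
  induction n generalizing σ with
  | zero => rfl
  | succ n ih => simp [Stmt.iter, Stmt.vars, ih]

theorem Stmt.iter_gates (s : Stmt) (n : ℕ) (σ : ℕ → ℕ) :
    (s.iter n).gates σ = (List.range n).flatMap fun i => s.gates (s.vars^[i] σ) := by
  induction n generalizing σ with
  | zero => simp [Stmt.iter, Stmt.gates]
  | succ n ih => simp [Stmt.iter, Stmt.gates, ih, List.range_succ_eq_map, List.flatMap_map]

/-- The simulation does what the program does. -/
def Simulates (R : ℕ) (s : Stmt) (vn : ℕ) (σ : ℕ → ℕ) (m : ℕ → Bool) (s' : Store) : Prop :=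
  Tame R vn s σ m ∧ Cfg R (s.vars σ) (evalGates (s.gates σ) m) (content s')

theorem Tame.size {R vn : ℕ} {s : Stmt} {σ : ℕ → ℕ} {m : ℕ → Bool} (h : Tame R vn s σ m)
    (hvn : 10 ≤ vn) : s.vars σ vSize = σ vSize :=
  h.vars vSize (by omega) (by omega) (by omega) (by omega) (by omega)

/-- The two arrays of a register are the indicators of its zeros and of its ones, so pushing `b`
shifts `!b` into the first and `b` into the second. -/
theorem simulate_push {R : ℕ} {r : ℕ} {b : Bool} (hr : r < R) {ve vn : ℕ} (hvn : 11 ≤ vn)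
    (hve : ve < vn) {σ : ℕ → ℕ} {m : ℕ → Bool} {s s' : Store} {en : Bool}
    (h : Cfg R σ m (content s)) (he : Enable R σ m ve en)
    (hs : Eff R (σ vSize) (.push r b) en s s') :
    Simulates R ((Prog.push r b).simulate ve vn) vn σ m s' := by
  obtain ⟨t1, c1⟩ := shiftIn_spec (vn := vn) h he (show 2 * r < 2 * R by omega) (!b)
  obtain ⟨t2, c2⟩ := shiftIn_spec (vn := vn) c1 (he.of_tame t1 hve)
    (show 2 * r + 1 < 2 * R by omega) b
  refine ⟨t1.seq (by omega) t2, ?_⟩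
  simp only [Prog.simulate, Stmt.vars, Stmt.gates, evalGates_append]
  refine c2.congr fun t ht j hj => ?_
  rcases hs with ⟨rfl, rfl, _⟩ | ⟨rfl, t', hrun, _⟩
  · simp
  · cases hrun
    simp only [if_true]
    by_cases h1 : t = 2 * r + 1
    · subst h1
      rw [Function.update_self, content_one, Function.update_self, getElem?_cons_eq_some]
      rw [Function.update_of_ne (by omega), content_one]
      cases b <;> rfl
    · rw [Function.update_of_ne h1]
      by_cases h0 : t = 2 * r
      · subst h0
        simp only [Function.update_self, content_zero, getElem?_cons_eq_some]
        cases b <;> rfl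
      · rw [Function.update_of_ne h0, content_update_of_ne (by omega)]

theorem simulate_pop {R : ℕ} {r : ℕ} (hr : r < R) {ve vn : ℕ} (hvn : 11 ≤ vn)
    (hve : ve < vn) {σ : ℕ → ℕ} {m : ℕ → Bool} {s s' : Store} {en : Bool}
    (h : Cfg R σ m (content s)) (he : Enable R σ m ve en)
    (hs : Eff R (σ vSize) (.pop r) en s s') :
    Simulates R ((Prog.pop r).simulate ve vn) vn σ m s' := by
  obtain ⟨t1, c1⟩ := shiftOut_spec (vn := vn) h he (show 2 * r < 2 * R by omega)
  obtain ⟨t2, c2⟩ := shiftOut_spec (vn := vn) c1 (he.of_tame t1 hve)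
    (show 2 * r + 1 < 2 * R by omega)
  refine ⟨t1.seq (by omega) t2, ?_⟩
  simp only [Prog.simulate, Stmt.vars, Stmt.gates, evalGates_append]
  have hlen := hs.length_le hr
  refine c2.congr fun t ht j hj => ?_
  rw [t1.size (by omega)]
  rcases hs with ⟨rfl, rfl, _⟩ | ⟨rfl, t', hrun, _⟩
  · simp
  · cases hrun
    simp only [if_true]
    -- At the last cell the circuit supplies a `0`. This is right because the stack has length at
    -- most `vSize`, so there is no further bit.
    have key : ∀ b', (if j + 1 < σ vSize then decide ((s r)[j + 1]? = some b') else false) =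
        decide ((s r).tail[j]? = some b') := by
      intro b'
      rw [List.getElem?_tail]
      split_ifs with hj'
      · rfl
      · rw [List.getElem?_eq_none (by omega)]; simp
    by_cases h1 : t = 2 * r + 1
    · subst h1
      rw [Function.update_self, content_one, Function.update_self, ← key]
      rw [Function.update_of_ne (by omega), content_one]
    · rw [Function.update_of_ne h1]
      by_cases h0 : t = 2 * r
      · subst h0
        simp only [Function.update_self, content_zero, ← key]
      · rw [Function.update_of_ne h0, content_update_of_ne (by omega)]

theorem head_cases (l : List Bool) :
    (l = [] ∧ decide (l[0]? = some false) = false ∧ decide (l[0]? = some true) = false) ∨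
    (l.head? = some false ∧ decide (l[0]? = some false) = true ∧
      decide (l[0]? = some true) = false) ∨
    (l.head? = some true ∧ decide (l[0]? = some false) = false ∧
      decide (l[0]? = some true) = true) := by
  rcases l with _ | ⟨_ | _, l⟩ <;> simp

/-- Of the three control bits only the one for the branch taken equals `en`; the other two are
false. So the three bodies can be run one after another, with two of them doing nothing. -/
theorem Eff.branch {R S r : ℕ} {p q u : Prog} {en : Bool} {s s' : Store}
    (h : Eff R S (.branch r p q u) en s s') : ∃ s₁ s₂,
      Eff R S p (en && (content s (2 * r) 0 == content s (2 * r + 1) 0)) s s₁ ∧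
      Eff R S q (en && content s (2 * r) 0) s₁ s₂ ∧
      Eff R S u (en && content s (2 * r + 1) 0) s₂ s' := by
  rw [content_zero, content_one]
  rcases h with ⟨rfl, rfl, h⟩ | ⟨rfl, t, hrun, h⟩
  · exact ⟨s', s', .inl ⟨by simp, rfl, h⟩, .inl ⟨by simp, rfl, h⟩, .inl ⟨by simp, rfl, h⟩⟩
  · have hlen : ∀ r < R, (s r).length ≤ S := fun r hr => by have := h r hr; omega
    have hlen' : ∀ r < R, (s' r).length ≤ S := fun r hr => by
      have := h r hr; have := hrun.length_le r; omega
    rcases head_cases (s r) with ⟨h0, h1, h2⟩ | ⟨h0, h1, h2⟩ | ⟨h0, h1, h2⟩ <;> rw [h1, h2] <;>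
      cases hrun <;> simp_all only [List.head?_nil, reduceCtorEq, Option.some.injEq,
        Bool.false_eq_true, Bool.true_eq_false]
    case inl.branch_nil t _ hp =>
      exact ⟨s', s', .inr ⟨rfl, t, hp, fun r hr => by have := h r hr; omega⟩,
        .inl ⟨rfl, rfl, hlen'⟩, .inl ⟨rfl, rfl, hlen'⟩⟩
    case inr.inl.branch_zero t _ hp =>
      exact ⟨s, s', .inl ⟨rfl, rfl, hlen⟩, .inr ⟨rfl, t, hp, fun r hr => by
        have := h r hr; omega⟩, .inl ⟨rfl, rfl, hlen'⟩⟩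
    case inr.inr.branch_one t _ hp =>
      exact ⟨s, s, .inl ⟨rfl, rfl, hlen⟩, .inl ⟨rfl, rfl, hlen⟩,
        .inr ⟨rfl, t, hp, fun r hr => by have := h r hr; omega⟩⟩

/-- Iterating the guarded body sufficiently often simulates a loop. -/
theorem simulate_loop {R r : ℕ} {p : Prog} (hr : r < R)
    (ih : ∀ (ve vn : ℕ), 11 ≤ vn → ve < vn → ∀ (σ : ℕ → ℕ) (m : ℕ → Bool) (s s' : Store)
      (en : Bool), Cfg R σ m (content s) → Enable R σ m ve en → 1 ≤ σ vSize →
      Eff R (σ vSize) p en s s' → Simulates R (p.simulate ve vn) vn σ m s')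
    {ve vn : ℕ} (hvn : 11 ≤ vn) (hve : ve < vn) (n : ℕ) (σ : ℕ → ℕ) (m : ℕ → Bool)
    (s s' : Store) (en : Bool) (h : Cfg R σ m (content s)) (he : Enable R σ m ve en)
    (hS : 1 ≤ σ vSize) (hlen : ∀ r < R, (s r).length ≤ σ vSize)
    (hs : (en = false ∧ s' = s) ∨ (en = true ∧ ∃ t ≤ n + 1, Runs (.loop r p) s t s' ∧
      ∀ r < R, (s r).length + t ≤ σ vSize)) :
    Simulates R ((Stmt.seq (.loopBit r ve vn) (p.simulate vn (vn + 1))).iter n) vn σ m s' := by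
  induction n generalizing σ m s with
  | zero =>
    -- An executed iteration costs at least three steps (body, test, remaining loop), so in one step
    -- there is only the final test.
    have : s' = s := by
      rcases hs with ⟨_, h⟩ | ⟨_, t, ht, hrun, _⟩
      · exact h
      · cases hrun with
        | loop_done => rfl
        | loop_step _ h1 h2 => have := h1.one_le; have := h2.one_le; omega
    subst this
    exact ⟨Tame.skip _ _ _ _, h⟩
  | succ n ihn =>
    obtain ⟨t1, c1, e1⟩ := loopBit_spec (vn := vn) h he hr hS hvn hve
    rw [content_zero, content_one] at e1
    have hstep : ∃ s₁, Eff R (σ vSize) p (en && (decide ((s r)[0]? = some false) !=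
        decide ((s r)[0]? = some true))) s s₁ ∧ (∀ r < R, (s₁ r).length ≤ σ vSize) ∧
        ((en = false ∧ s' = s₁) ∨ (en = true ∧ ∃ t ≤ n + 1, Runs (.loop r p) s₁ t s' ∧
          ∀ r < R, (s₁ r).length + t ≤ σ vSize)) := by
      rcases hs with ⟨rfl, rfl⟩ | ⟨rfl, t, ht, hrun, ht'⟩
      · exact ⟨s', .inl ⟨by simp, rfl, hlen⟩, hlen, .inl ⟨rfl, rfl⟩⟩
      · cases hrun with
        | loop_done hnil =>
          exact ⟨s', .inl ⟨by simp [hnil], rfl, hlen⟩, hlen,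
            .inr ⟨rfl, 1, by omega, .loop_done hnil, ht'⟩⟩
        | @loop_step _ _ _ s₁ _ t t' hne h1 h2 =>
          have := h1.one_le
          have hb : (decide ((s r)[0]? = some false) != decide ((s r)[0]? = some true)) = true := by
            rcases head_cases (s r) with ⟨h0, h1, h2⟩ | ⟨h0, h1, h2⟩ | ⟨h0, h1, h2⟩
            · exact absurd h0 hne
            · rw [h1, h2]; rfl
            · rw [h1, h2]; rfl
          refine ⟨s₁, .inr ⟨by rw [hb]; rfl, t, h1, fun r hr => ?_⟩, fun r hr => ?_,
            .inr ⟨rfl, t', by omega, h2, fun r hr => ?_⟩⟩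
          · have := ht' r hr; omega
          · have := ht' r hr; have := h1.length_le r; omega
          · have := ht' r hr; have := h1.length_le r; omega
    obtain ⟨s₁, heff, hlen₁, hs₁⟩ := hstep
    have hsz := t1.size (by omega)
    obtain ⟨t2, c2⟩ := ih vn (vn + 1) (by omega) (by omega) _ _ s s₁ _ c1 e1
      (by rw [hsz]; exact hS) (by rw [hsz]; exact heff)
    have t12 := t1.seq (by omega) (t2.weaken (by omega))
    have c2' : Cfg R ((Stmt.seq (.loopBit r ve vn) (p.simulate vn (vn + 1))).vars σ)
      (evalGates ((Stmt.seq (.loopBit r ve vn) (p.simulate vn (vn + 1))).gates σ) m)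
      (content s₁) := by
      simpa only [Stmt.vars, Stmt.gates, evalGates_append] using c2
    have hsz2 := t12.size (by omega)
    obtain ⟨t3, c3⟩ := ihn _ _ s₁ c2' (he.of_tame t12 hve) (by rw [hsz2]; exact hS)
      (by rw [hsz2]; exact hlen₁) (by rw [hsz2]; exact hs₁)
    refine ⟨t12.seq (by omega) t3, ?_⟩
    simpa only [Stmt.iter, Stmt.vars, Stmt.gates, evalGates_append] using c3

/-- Induction on the program. A circuit has no data-dependent control flow, so everything is
executed under a control wire. A loop is unrolled `vSize` times, which suffices because the slack in
`Eff` bounds its running time by `vSize`. Nested control wires are held in variables from `vn` on,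
which inner parts leave alone. -/
theorem simulate_spec {R : ℕ} (c : Prog) (hc : c.regBound ≤ R) :
    ∀ (ve vn : ℕ), 11 ≤ vn → ve < vn → ∀ (σ : ℕ → ℕ) (m : ℕ → Bool) (s s' : Store)
      (en : Bool), Cfg R σ m (content s) → Enable R σ m ve en → 1 ≤ σ vSize →
      Eff R (σ vSize) c en s s' → Simulates R (c.simulate ve vn) vn σ m s' := by
  induction c with
  | skip =>
    intro ve vn hvn hve σ m s s' en h he hS hs
    have : s' = s := by
      rcases hs with ⟨_, h, _⟩ | ⟨_, t, hrun, _⟩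
      · exact h
      · cases hrun; rfl
    subst this
    exact ⟨Tame.skip _ _ _ _, h⟩
  | push r b =>
    intro ve vn hvn hve σ m s s' en h he hS hs
    exact simulate_push hc hvn hve h he hs
  | pop r =>
    intro ve vn hvn hve σ m s s' en h he hS hs
    exact simulate_pop hc hvn hve h he hs
  | seq p q ihp ihq =>
    intro ve vn hvn hve σ m s s' en h he hS hs
    simp only [Prog.regBound, max_le_iff] at hc
    obtain ⟨s₁, h1, h2⟩ := hs.seq
    obtain ⟨t1, c1⟩ := ihp hc.1 ve vn hvn hve σ m s s₁ en h he hS h1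
    have hsz := t1.size (by omega)
    obtain ⟨t2, c2⟩ := ihq hc.2 ve vn hvn hve _ _ s₁ s' en c1 (he.of_tame t1 hve)
      (by rw [hsz]; exact hS) (by rw [hsz]; exact h2)
    refine ⟨t1.seq (by omega) t2, ?_⟩
    simpa only [Prog.simulate, Stmt.vars, Stmt.gates, evalGates_append] using c2
  | branch r p q u ihp ihq ihu =>
    intro ve vn hvn hve σ m s s' en h he hS hs
    simp only [Prog.regBound, max_le_iff] at hc
    obtain ⟨s₁, s₂, h1, h2, h3⟩ := hs.branch
    obtain ⟨t0, c0, e0, e1, e2⟩ := branchBits_spec (vn := vn) h he hc.1 hS hvn hve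
    have hsz0 := t0.size (by omega)
    obtain ⟨t1, c1⟩ := ihp hc.2.1 vn (vn + 3) (by omega) (by omega) _ _ s s₁ _ c0 e0
      (by rw [hsz0]; exact hS) (by rw [hsz0]; exact h1)
    have hsz1 := (t1.size (by omega)).trans hsz0
    have e1' := e1.of_tame t1 (by omega)
    have e2' := e2.of_tame t1 (by omega)
    obtain ⟨t2, c2⟩ := ihq hc.2.2.1 (vn + 1) (vn + 3) (by omega) (by omega) _ _ s₁ s₂ _ c1 e1'
      (by rw [hsz1]; exact hS) (by rw [hsz1]; exact h2)
    have hsz2 := (t2.size (by omega)).trans hsz1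
    have e2'' := e2'.of_tame t2 (by omega)
    obtain ⟨t3, c3⟩ := ihu hc.2.2.2 (vn + 2) (vn + 3) (by omega) (by omega) _ _ s₂ s' _ c2 e2''
      (by rw [hsz2]; exact hS) (by rw [hsz2]; exact h3)
    refine ⟨t0.seq (by omega) ((t1.weaken (by omega)).seq (by omega)
      ((t2.weaken (by omega)).seq (by omega) (t3.weaken (by omega)))), ?_⟩
    simpa only [Prog.simulate, Stmt.vars, Stmt.gates, evalGates_append] using c3
  | loop r p ih =>
    intro ve vn hvn hve σ m s s' en h he hS hs
    simp only [Prog.regBound, max_le_iff] at hc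
    have hs' : (en = false ∧ s' = s) ∨ (en = true ∧ ∃ t ≤ σ vSize + 1, Runs (.loop r p) s t s' ∧
        ∀ r < R, (s r).length + t ≤ σ vSize) := by
      rcases hs with ⟨h1, h2, _⟩ | ⟨h1, t, h2, h3⟩
      · exact .inl ⟨h1, h2⟩
      · exact .inr ⟨h1, t, by have := h3 r hc.1; omega, h2, h3⟩
    have hlen : ∀ r < R, (s r).length ≤ σ vSize := fun r hr => hs.length_le hr
    obtain ⟨t1, c1⟩ := simulate_loop hc.1 (ih hc.2) hvn hve (σ vSize) σ m s s' en h he hS hlen hs'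
    -- A repetition and its unrolled form `Stmt.iter` have the same variables and gates, so the
    -- result for the latter transfers.
    obtain ⟨a1, a2, a3, a4⟩ := t1
    simp only [Stmt.iter_vars, Stmt.iter_gates] at a1 a2 a3 a4 c1
    exact ⟨⟨a1, a2, a3, a4⟩, c1⟩

/-- The variables `0`, `1` and `2` control repetitions. -/
def params : Set ℕ := {v | v < 3}

theorem Stmt.wf_advance (v t : ℕ) (hv : 3 ≤ v) : (Stmt.advance v t).Wf params := by
  induction t with
  | zero => trivial
  | succ t ih => exact ⟨ih, show 2 < 3 by omega, by simp [Stmt.Wf, params]; omega⟩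

/-- Every repetition in the simulation is controlled by `vSize`, and assignments go to variables
from `3` on, so `Stmt.exec_compile` applies. -/
theorem Prog.wf_simulate (c : Prog) (ve vn : ℕ) (hvn : 11 ≤ vn) :
    (c.simulate ve vn).Wf params := by
  have hadv := Stmt.wf_advance
  induction c generalizing ve vn with
  | skip => trivial
  | push r b =>
    cases b <;> simp [Prog.simulate, Stmt.shiftIn, Stmt.newBit, Stmt.cswap, Stmt.Wf, hadv] <;>
      simp [params]
  | pop r =>
    simp [Prog.simulate, Stmt.shiftOut, Stmt.newBit, Stmt.cswap, Stmt.Wf, hadv]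
    simp [params]
  | seq p q ihp ihq => exact ⟨ihp _ _ hvn, ihq _ _ hvn⟩
  | branch r p q u ihp ihq ihu =>
    refine ⟨?_, ihp _ _ (by omega), ihq _ _ (by omega), ihu _ _ (by omega)⟩
    simp [Stmt.branchBits, Stmt.locate, Stmt.newBit, Stmt.Wf, hadv]
    simp [params]; omega
  | loop r p ih =>
    refine ⟨show 2 < 3 by omega, ?_, ih _ _ (by omega)⟩
    simp [Stmt.loopBit, Stmt.locate, Stmt.newBit, Stmt.Wf, hadv]
    simp [params]; omega

end HarlowHayden


namespace HarlowHayden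

/-! ### Linearity and unitarity of circuits -/

section linear

variable {w : ℕ}

/-- A gate as a linear map. -/
noncomputable def Gate.toLin (g : Gate w) : QState w →ₗ[ℂ] QState w where
  toFun := g.apply
  map_add' u v := by
    funext z
    cases g <;> simp only [Gate.apply, Pi.add_apply] <;> ring
  map_smul' c u := by
    funext z
    cases g <;> simp only [Gate.apply, Pi.smul_apply, smul_eq_mul, RingHom.id_apply] <;> ring

@[simp] theorem runCircuit_nil (ψ : QState w) : runCircuit [] ψ = ψ := rfl

@[simp] theorem runCircuit_cons (g : Gate w) (gs : List (Gate w)) (ψ : QState w) :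
    runCircuit (g :: gs) ψ = runCircuit gs (g.apply ψ) := rfl

@[simp] theorem runCircuit_append (gs gs' : List (Gate w)) (ψ : QState w) :
    runCircuit (gs ++ gs') ψ = runCircuit gs' (runCircuit gs ψ) := by
  simp [runCircuit]

/-- A circuit as a linear map. -/
noncomputable def circuitLin : List (Gate w) → QState w →ₗ[ℂ] QState w
  | [] => LinearMap.id
  | g :: gs => circuitLin gs ∘ₗ g.toLin

theorem circuitLin_apply (gs : List (Gate w)) (ψ : QState w) :
    circuitLin gs ψ = runCircuit gs ψ := by
  induction gs generalizing ψ with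
  | nil => rfl
  | cons g gs ih => exact ih _

/-- The inner product of two states. -/
noncomputable def braket (u v : QState w) : ℂ := ∑ z, star (u z) * v z

/-- Negate bit `i`. -/
def flipBit (i : Fin w) (z : Fin w → Bool) : Fin w → Bool := Function.update z i (!z i)

theorem flipBit_flipBit (i : Fin w) (z : Fin w → Bool) : flipBit i (flipBit i z) = z := by
  simp [flipBit]

theorem sum_comp_involutive {f : (Fin w → Bool) → (Fin w → Bool)} (hf : Function.Involutive f)
    (F : (Fin w → Bool) → ℂ) : ∑ z, F (f z) = ∑ z, F z :=
  Equiv.sum_comp (hf.toPerm f) F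

theorem had_apply (i : Fin w) (ψ : QState w) (z : Fin w → Bool) :
    (Gate.had i).apply ψ z =
      ((if z i then -1 else 1) * ψ z + ψ (flipBit i z)) / (Real.sqrt 2 : ℂ) := by
  cases hz : z i
  · have : Function.update z i false = z := by rw [← hz, Function.update_eq_self]
    simp [Gate.apply, flipBit, hz, this]
  · have : Function.update z i true = z := by rw [← hz, Function.update_eq_self]
    simp [Gate.apply, flipBit, hz, this, add_comm]

theorem phase_apply (i : Fin w) (ψ : QState w) (z : Fin w → Bool) :
    (Gate.phase i).apply ψ z = (if z i then Complex.I else 1) * ψ z := rfl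

/-- The inverse of a gate. -/
def Gate.inverse : Gate w → List (Gate w)
  | .had i => [.had i]
  | .phase i => [.phase i, .phase i, .phase i]
  | .toffoli i j k h h' h'' => [.toffoli i j k h h' h'']

/-- The inverse of a circuit. -/
def inverseCircuit : List (Gate w) → List (Gate w)
  | [] => []
  | g :: gs => inverseCircuit gs ++ g.inverse

theorem sqrt_two_mul_self : (Real.sqrt 2 : ℂ) * (Real.sqrt 2 : ℂ) = 2 := by
  rw [← Complex.ofReal_mul, Real.mul_self_sqrt (by norm_num)]; norm_num

theorem sqrt_two_ne_zero : (Real.sqrt 2 : ℂ) ≠ 0 := by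
  intro h
  have := sqrt_two_mul_self
  rw [h] at this
  norm_num at this

theorem toffoli_involutive {i j k : Fin w} (hik : i ≠ k) (hjk : j ≠ k) :
    Function.Involutive
      (fun z : Fin w → Bool => Function.update z k (xor (z k) (z i && z j))) := by
  intro z
  simp [hik, hjk]

theorem Gate.inverse_apply (g : Gate w) (ψ : QState w) :
    runCircuit g.inverse (g.apply ψ) = ψ := by
  funext z
  cases g with
  | had i =>
    simp only [Gate.inverse, runCircuit_cons, runCircuit_nil, had_apply, flipBit_flipBit]
    have h2 := sqrt_two_mul_self
    have h0 := sqrt_two_ne_zero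
    have hz : flipBit i z i = !z i := by simp [flipBit]
    rw [hz]
    cases z i <;> simp <;> field_simp <;> rw [pow_two, h2] <;> ring
  | phase i =>
    simp only [Gate.inverse, runCircuit_cons, runCircuit_nil, Gate.apply]
    cases z i
    · simp
    · simp only [if_true]
      linear_combination (Complex.I ^ 2 - 1) * ψ z * Complex.I_mul_I
  | toffoli i j k h h' h'' =>
    simp only [Gate.inverse, runCircuit_cons, runCircuit_nil, Gate.apply]
    exact congrArg ψ (toffoli_involutive h' h'' z)

/-- Unitarity in the form "adjoint equals inverse". For Hadamard and Toffoli gates it comes from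
reindexing the sum by an involution of the basis; for the phase gate it uses i³ = −i. -/
theorem Gate.braket_apply (g : Gate w) (u v : QState w) :
    braket (g.apply u) v = braket u (runCircuit g.inverse v) := by
  cases g with
  | had i =>
    simp only [Gate.inverse, runCircuit_cons, runCircuit_nil, braket, had_apply]
    have e1 : ∀ z, star (((if z i then -1 else 1) * u z + u (flipBit i z)) / (Real.sqrt 2 : ℂ)) *
        v z = star (u z) * ((if z i then -1 else 1) * v z) / (Real.sqrt 2 : ℂ) +
          star (u (flipBit i z)) * v z / (Real.sqrt 2 : ℂ) := by
      intro z
      cases z i <;> simp <;> ring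
    have e2 : ∀ z, star (u z) * (((if z i then -1 else 1) * v z + v (flipBit i z)) /
        (Real.sqrt 2 : ℂ)) = star (u z) * ((if z i then -1 else 1) * v z) / (Real.sqrt 2 : ℂ) +
          star (u z) * v (flipBit i z) / (Real.sqrt 2 : ℂ) := by
      intro z; ring
    rw [Finset.sum_congr rfl fun z _ => e1 z, Finset.sum_congr rfl fun z _ => e2 z,
      Finset.sum_add_distrib, Finset.sum_add_distrib]
    congr 1
    rw [← sum_comp_involutive (flipBit_flipBit i)]
    simp only [flipBit_flipBit]
  | phase i =>
    simp only [Gate.inverse, runCircuit_cons, runCircuit_nil, braket, Gate.apply]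
    refine Finset.sum_congr rfl fun z _ => ?_
    cases z i
    · simp
    · simp only [if_true, star_mul', Complex.star_def, Complex.conj_I]
      linear_combination -Complex.I * (starRingEnd ℂ) (u z) * v z * Complex.I_mul_I
  | toffoli i j k h h' h'' =>
    simp only [Gate.inverse, runCircuit_cons, runCircuit_nil, braket, Gate.apply]
    have hinv := toffoli_involutive (w := w) h' h''
    rw [← sum_comp_involutive hinv]
    exact Finset.sum_congr rfl fun z _ => by
      rw [show Function.update _ k _ = z from hinv z]

theorem braket_inverseCircuit (gs : List (Gate w)) (u v : QState w) :
    braket (runCircuit gs u) v = braket u (runCircuit (inverseCircuit gs) v) := by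
  induction gs generalizing u with
  | nil => rfl
  | cons g gs ih =>
    rw [runCircuit_cons, ih, Gate.braket_apply, inverseCircuit, runCircuit_append]

theorem inverseCircuit_apply (gs : List (Gate w)) (ψ : QState w) :
    runCircuit (inverseCircuit gs) (runCircuit gs ψ) = ψ := by
  induction gs generalizing ψ with
  | nil => rfl
  | cons g gs ih =>
    rw [runCircuit_cons, inverseCircuit, runCircuit_append, ih, Gate.inverse_apply]

theorem braket_runCircuit (gs : List (Gate w)) (u v : QState w) :
    braket (runCircuit gs u) (runCircuit gs v) = braket u v := by
  rw [braket_inverseCircuit, inverseCircuit_apply]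

theorem ket_apply (z z' : Fin w → Bool) : ket z z' = if z' = z then 1 else 0 := by
  simp [ket, Pi.single_apply]

theorem braket_ket (z : Fin w → Bool) (v : QState w) : braket (ket z) v = v z := by
  simp [braket, ket_apply]

theorem braket_self (u : QState w) : braket u u = ((∑ z, ‖u z‖ ^ 2 : ℝ) : ℂ) := by
  simp only [braket, Complex.ofReal_sum]
  refine Finset.sum_congr rfl fun z _ => ?_
  rw [Complex.star_def, mul_comm, Complex.mul_conj, Complex.normSq_eq_norm_sq]

theorem sum_norm_sq_runCircuit (gs : List (Gate w)) (u : QState w) :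
    ∑ z, ‖runCircuit gs u z‖ ^ 2 = ∑ z, ‖u z‖ ^ 2 := by
  have := braket_runCircuit gs u u
  rw [braket_self, braket_self] at this
  exact_mod_cast this

theorem sum_norm_sq_ket (z : Fin w → Bool) : ∑ z', ‖ket z z'‖ ^ 2 = 1 := by
  have : ∀ z', ‖ket z z'‖ ^ 2 = if z' = z then (1 : ℝ) else 0 := by
    intro z'; rw [ket_apply]; split_ifs <;> simp
  simp [this]

end linear

/-! ### Circuits on a part of the wires -/

section lift

variable {w W : ℕ}

/-- A gate on the first `w` of `W` wires. -/
def Gate.lift (h : w ≤ W) : Gate w → Gate W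
  | .had i => .had (i.castLE h)
  | .phase i => .phase (i.castLE h)
  | .toffoli i j k h1 h2 h3 => .toffoli (i.castLE h) (j.castLE h) (k.castLE h)
      (fun e => h1 (Fin.castLE_injective h e)) (fun e => h2 (Fin.castLE_injective h e))
      (fun e => h3 (Fin.castLE_injective h e))

/-- The description contains wire numbers but not the number of qubits. So a decoder can be copied
verbatim into a wider circuit. -/
theorem encCircuit_lift (h : w ≤ W) (gs : List (Gate w)) :
    encCircuit (gs.map (Gate.lift h)) = encCircuit gs := by
  simp only [encCircuit, List.flatMap_map]
  congr 1
  funext g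
  cases g <;> rfl

/-- Complete the bits `z` of the first wires by the bits `τ`. -/
def glue (W : ℕ) (z : Fin w → Bool) (τ : ℕ → Bool) : Fin W → Bool :=
  fun i => if h : i.val < w then z ⟨i, h⟩ else τ i

theorem glue_castLE (h : w ≤ W) (z : Fin w → Bool) (τ : ℕ → Bool) (i : Fin w) :
    glue W z τ (i.castLE h) = z i := by
  simp [glue]

theorem update_glue (h : w ≤ W) (z : Fin w → Bool) (τ : ℕ → Bool) (i : Fin w) (b : Bool) :
    Function.update (glue W z τ) (i.castLE h) b = glue W (Function.update z i b) τ := by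
  funext j
  by_cases hj : j = i.castLE h
  · subst hj; simp [glue]
  · rw [Function.update_of_ne hj]
    unfold glue
    split_ifs with hw
    · rw [Function.update_of_ne]
      intro e
      exact hj (Fin.ext (by simpa using congrArg Fin.val e))
    · rfl

/-- The restriction of a state to fixed values of the last wires. -/
def slice (w : ℕ) (τ : ℕ → Bool) (ψ : QState W) : QState w := fun z => ψ (glue W z τ)

/-- A gate on the first wires acts separately on each part of the state with fixed values of the
other wires. -/
theorem slice_apply_lift (h : w ≤ W) (τ : ℕ → Bool) (g : Gate w) (ψ : QState W) :
    slice w τ ((g.lift h).apply ψ) = g.apply (slice w τ ψ) := by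
  funext z
  cases g <;> simp [slice, Gate.lift, Gate.apply, glue_castLE, update_glue h]

theorem slice_runCircuit_lift (h : w ≤ W) (τ : ℕ → Bool) (gs : List (Gate w)) (ψ : QState W) :
    slice w τ (runCircuit (gs.map (Gate.lift h)) ψ) = runCircuit gs (slice w τ ψ) := by
  induction gs generalizing ψ with
  | nil => rfl
  | cons g gs ih => rw [List.map_cons, runCircuit_cons, ih, slice_apply_lift, runCircuit_cons]

end lift

/-! ### Circuits with numbered wires -/

/-- The wires of the gate are distinct and smaller than `W`. -/
def WGate.Valid (W : ℕ) : WGate → Prop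
  | .had i => i < W
  | .phase i => i < W
  | .not i => i < W
  | .tof i j k => i < W ∧ j < W ∧ k < W ∧ i ≠ j ∧ i ≠ k ∧ j ≠ k

theorem WGate.Good.valid {W : ℕ} {g : WGate} (h : g.Good W) : g.Valid W := by
  cases g <;> simp only [WGate.Good, WGate.Valid] at h ⊢ <;> tauto

/-- The gates on `W` qubits that a gate with numbered wires stands for. -/
def WGate.toGates (W : ℕ) : WGate → List (Gate W)
  | .had i => if h : i < W then [.had ⟨i, h⟩] else []
  | .phase i => if h : i < W then [.phase ⟨i, h⟩] else []
  | .not i => if h : i < W then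
      [.had ⟨i, h⟩, .phase ⟨i, h⟩, .phase ⟨i, h⟩, .had ⟨i, h⟩] else []
  | .tof i j k => if h : i < W ∧ j < W ∧ k < W ∧ i ≠ j ∧ i ≠ k ∧ j ≠ k then
      [.toffoli ⟨i, h.1⟩ ⟨j, h.2.1⟩ ⟨k, h.2.2.1⟩ (by simpa using h.2.2.2.1)
        (by simpa using h.2.2.2.2.1) (by simpa using h.2.2.2.2.2)] else []

/-- The circuit on `W` qubits that a list of gates with numbered wires stands for. -/
def toCircuit (W : ℕ) (gs : List WGate) : List (Gate W) := gs.flatMap (WGate.toGates W)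

@[simp] theorem toCircuit_append (W : ℕ) (gs gs' : List WGate) :
    toCircuit W (gs ++ gs') = toCircuit W gs ++ toCircuit W gs' := by simp [toCircuit]

@[simp] theorem encCircuit_append {w : ℕ} (gs gs' : List (Gate w)) :
    encCircuit (gs ++ gs') = encCircuit gs ++ encCircuit gs' := by simp [encCircuit]

theorem encCircuit_toCircuit {W : ℕ} {gs : List WGate} (h : ∀ g ∈ gs, g.Valid W) :
    encCircuit (toCircuit W gs) = encGates gs := by
  induction gs with
  | nil => rfl
  | cons g gs ih =>
    have h1 : encCircuit (g.toGates W) = g.encode := by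
      have hg := h g (by simp)
      cases g <;> simp only [WGate.Valid] at hg <;>
        simp [WGate.toGates, hg, encCircuit, WGate.encode, Gate.encode]
    have h2 := ih fun g hg => h g (by simp [hg])
    change encCircuit (g.toGates W ++ toCircuit W gs) = g.encode ++ encGates gs
    rw [encCircuit_append, h1, h2]

/-- The basis state of an assignment of bits to all wires. -/
def ketOf (W : ℕ) (m : ℕ → Bool) : QState W := ket fun i => m i

/-- P² is the Pauli matrix Z, and HZH = X. -/
theorem runCircuit_not {w : ℕ} (i : Fin w) (ψ : QState w) :
    runCircuit [.had i, .phase i, .phase i, .had i] ψ = fun z => ψ (flipBit i z) := by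
  funext z
  have h2 := sqrt_two_mul_self
  have h0 := sqrt_two_ne_zero
  have hz : flipBit i z i = !z i := by simp [flipBit]
  simp only [runCircuit_cons, runCircuit_nil, had_apply, phase_apply, flipBit_flipBit, hz]
  cases z i <;> simp [← mul_assoc] <;> field_simp <;> rw [pow_two, h2] <;> ring

theorem eq_comp_iff_of_involutive {α : Type*} {f : α → α} (hf : Function.Involutive f) (x y : α) :
    f x = y ↔ x = f y :=
  ⟨fun h => by rw [← h, hf], fun h => by rw [h, hf]⟩

theorem ket_comp {w : ℕ} {f : (Fin w → Bool) → (Fin w → Bool)} (hf : Function.Involutive f)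
    (z : Fin w → Bool) : (fun z' => ket z (f z')) = ket (f z) := by
  funext z'
  simp [ket_apply, eq_comp_iff_of_involutive hf]

theorem update_restrict {W : ℕ} (m : ℕ → Bool) (i : ℕ) (hi : i < W) (b : Bool) :
    (fun j : Fin W => Function.update m i b j) =
      Function.update (fun j : Fin W => m j) ⟨i, hi⟩ b := by
  funext j
  by_cases hj : j = ⟨i, hi⟩
  · subst hj; simp
  · rw [Function.update_of_ne hj, Function.update_of_ne]
    intro e; exact hj (Fin.ext e)

theorem runCircuit_toGates {W : ℕ} {g : WGate} (hg : g.Good W) (m : ℕ → Bool) :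
    runCircuit (g.toGates W) (ketOf W m) = ketOf W (g.eval m) := by
  cases g with
  | had i => exact hg.elim
  | phase i => exact hg.elim
  | not i =>
    have hi : i < W := hg
    simp only [WGate.toGates, hi, dif_pos, WGate.eval, ketOf, update_restrict m i hi]
    rw [runCircuit_not, ket_comp (flipBit_flipBit _)]
    rfl
  | tof i j k =>
    have h : i < W ∧ j < W ∧ k < W ∧ i ≠ j ∧ i ≠ k ∧ j ≠ k := hg
    simp only [WGate.toGates, h, and_self, dif_pos, ne_eq, not_false_eq_true, WGate.eval, ketOf,
      update_restrict m k h.2.2.1, runCircuit_cons, runCircuit_nil, Gate.apply]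
    rw [ket_comp (toffoli_involutive (by simpa using h.2.2.2.2.1) (by simpa using h.2.2.2.2.2))]

theorem runCircuit_toCircuit {W : ℕ} {gs : List WGate} (h : ∀ g ∈ gs, g.Good W)
    (m : ℕ → Bool) : runCircuit (toCircuit W gs) (ketOf W m) = ketOf W (evalGates gs m) := by
  induction gs generalizing m with
  | nil => rfl
  | cons g gs ih =>
    change runCircuit (g.toGates W ++ toCircuit W gs) _ = _
    rw [runCircuit_append, runCircuit_toGates (h g (by simp)), ih fun g hg => h g (by simp [hg])]
    rfl

theorem runCircuit_had {W i : ℕ} (hi : i < W) {m : ℕ → Bool} (hm : m i = false) :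
    runCircuit (toCircuit W [.had i]) (ketOf W m) =
      (1 / (Real.sqrt 2 : ℂ)) • ∑ b : Bool, ketOf W (Function.update m i b) := by
  funext z
  simp only [toCircuit, WGate.toGates, hi, dif_pos, List.flatMap_cons, List.flatMap_nil,
    List.append_nil, runCircuit_cons, runCircuit_nil, Pi.smul_apply, Fintype.sum_bool, smul_eq_mul,
    ketOf, update_restrict m i hi, had_apply]
  rw [show Function.update (fun j : Fin W => m j) ⟨i, hi⟩ true =
    flipBit ⟨i, hi⟩ (fun j : Fin W => m j) by simp [flipBit, hm],
    show Function.update (fun j : Fin W => m j) ⟨i, hi⟩ false = (fun j : Fin W => m j) by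
      rw [← hm]; exact Function.update_eq_self _ _,
    show ket (fun j : Fin W => m j) (flipBit ⟨i, hi⟩ z) =
      ket (flipBit ⟨i, hi⟩ (fun j : Fin W => m j)) z from congrFun (ket_comp (flipBit_flipBit _) _) z]
  by_cases hz : z = fun j : Fin W => m j
  · subst hz
    simp [hm]; ring
  · simp only [Pi.add_apply, ket_apply, hz, if_false]
    split_ifs <;> simp

/-- Store the bits `X` on the wires from `x₀` on. -/
def setBlock {n : ℕ} (m : ℕ → Bool) (x₀ : ℕ) (X : Fin n → Bool) : ℕ → Bool :=
  fun a => if h : x₀ ≤ a ∧ a < x₀ + n then X ⟨a - x₀, by omega⟩ else m a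

/-- Each further Hadamard gate splits every basis state by one new bit, so the strings of length n +
1 arise from those of length n by `Fin.snoc`. -/
theorem runCircuit_hadBlock {W x₀ : ℕ} (n : ℕ) (hn : x₀ + n ≤ W) {m : ℕ → Bool}
    (hm : ∀ i < n, m (x₀ + i) = false) :
    runCircuit (toCircuit W ((List.range n).map fun i => .had (x₀ + i))) (ketOf W m) =
      (1 / (Real.sqrt 2 : ℂ)) ^ n • ∑ X : Fin n → Bool, ketOf W (setBlock m x₀ X) := by
  induction n with
  | zero =>
    have : ∀ X : Fin 0 → Bool, setBlock m x₀ X = m := by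
      intro X; funext a; simp [setBlock]
    simp [this, toCircuit]
  | succ n ih =>
    rw [List.range_succ, List.map_append, toCircuit_append, runCircuit_append,
      ih (by omega) (fun i hi => hm i (by omega)), ← circuitLin_apply, map_smul, map_sum]
    simp only [circuitLin_apply, List.map_cons, List.map_nil]
    have h1 : ∀ X : Fin n → Bool,
        runCircuit (toCircuit W [.had (x₀ + n)]) (ketOf W (setBlock m x₀ X)) =
        (1 / (Real.sqrt 2 : ℂ)) • ∑ b : Bool, ketOf W
          (setBlock m x₀ (Fin.snoc (α := fun _ => Bool) X b)) := by
      intro X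
      rw [runCircuit_had (by omega) (by simp [setBlock, hm n (by omega)])]
      congr 1
      refine Finset.sum_congr rfl fun b _ => ?_
      congr 1
      funext a
      by_cases ha : a = x₀ + n
      · subst ha
        simp [setBlock, Fin.snoc]
      · rw [Function.update_of_ne ha]
        unfold setBlock
        by_cases hb : x₀ ≤ a ∧ a < x₀ + n
        · rw [dif_pos hb, dif_pos (by omega)]
          simp [Fin.snoc, show a - x₀ < n by omega]
        · rw [dif_neg hb, dif_neg (by omega)]
    rw [Finset.sum_congr rfl fun X _ => h1 X, ← Finset.smul_sum, smul_smul, ← pow_succ]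
    congr 1
    rw [← Equiv.sum_comp (Fin.snocEquiv fun _ => Bool), Fintype.sum_prod_type, Finset.sum_comm]
    rfl

end HarlowHayden


namespace HarlowHayden

/-! ### Superpositions of two branches -/

/-- The state `2^{-(n+1)/2} ∑ |ρ b x⟩_R |b⟩_B |γ x⟩_H`, where `γ` is injective. -/
structure IsBranchState {w h n : ℕ} (Φ : TriState w h) (ρ : Bool → (Fin n → Bool) → Fin w → Bool)
    (γ : (Fin n → Bool) → Fin h → Bool) : Prop where
  inj : Function.Injective γ
  amp : ∀ z b y, Φ z b y =
    (1 / (Real.sqrt (2 ^ (n + 1)) : ℂ)) * ∑ x, if y = γ x then ket (ρ b x) z else 0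

/-- `∑ |a z + b z'|²` over the strings `z` with bit `d` equal to `0`, where `z'` is `z` with bit
`d` set to `1`. -/
noncomputable def mergeNorm {w : ℕ} (d : Fin w) (a b : QState w) : ℝ :=
  ∑ z, if z d = false then ‖a z + b (Function.update z d true)‖ ^ 2 else 0

/-- The inner product of the part of `a` with bit `d` equal to `0` and the part of `b` with bit
`d` equal to `1`. -/
noncomputable def overlap {w : ℕ} (d : Fin w) (a b : QState w) : ℂ :=
  ∑ z, if z d = false then star (a z) * b (Function.update z d true) else 0

/-! ### Merging the outputs of two branches -/

section merge

variable {w : ℕ}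

theorem sum_false_le (d : Fin w) (a : QState w) :
    (∑ z, if z d = false then ‖a z‖ ^ 2 else 0) ≤ ∑ z, ‖a z‖ ^ 2 :=
  Finset.sum_le_sum fun z _ => by split_ifs; exacts [le_rfl, by positivity]

theorem sum_update_true_le (d : Fin w) (b : QState w) :
    (∑ z, if z d = false then ‖b (Function.update z d true)‖ ^ 2 else 0) ≤ ∑ z, ‖b z‖ ^ 2 := by
  have hinv : Function.Involutive (flipBit d) := flipBit_flipBit d
  rw [← Equiv.sum_comp (hinv.toPerm _) fun z => ‖b z‖ ^ 2]
  refine Finset.sum_le_sum fun z _ => ?_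
  split_ifs with hz
  · simp [flipBit, hz]
  · positivity

theorem mergeNorm_eq (d : Fin w) (a b : QState w) :
    mergeNorm d a b = (∑ z, if z d = false then ‖a z‖ ^ 2 else 0) +
      (∑ z, if z d = false then ‖b (Function.update z d true)‖ ^ 2 else 0) +
      2 * (overlap d a b).re := by
  have hterm : ∀ u v : ℂ, ‖u + v‖ ^ 2 = ‖u‖ ^ 2 + ‖v‖ ^ 2 + 2 * (star u * v).re := by
    intro u v
    simp only [← Complex.normSq_eq_norm_sq, Complex.normSq_apply, Complex.star_def,
      Complex.add_re, Complex.add_im, Complex.mul_re, Complex.conj_re, Complex.conj_im]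
    ring
  rw [mergeNorm, overlap, Complex.re_sum, Finset.mul_sum, ← Finset.sum_add_distrib,
    ← Finset.sum_add_distrib]
  refine Finset.sum_congr rfl fun z _ => ?_
  split_ifs
  · exact hterm _ _
  · simp

/-- Of the three terms of the expanded square, the first two are parts of squared norms, hence at
most 1 each. High fidelity can therefore only come from the overlap. -/
theorem mergeNorm_le (d : Fin w) {a b : QState w} (ha : ∑ z, ‖a z‖ ^ 2 ≤ 1)
    (hb : ∑ z, ‖b z‖ ^ 2 ≤ 1) : mergeNorm d a b ≤ 2 + 2 * (overlap d a b).re := by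
  rw [mergeNorm_eq]
  have := sum_false_le d a
  have := sum_update_true_le d b
  linarith

/-- This polarisation identity, an equality despite the name, shows the defect from the maximum as a
sum of squares; the bound by 4 and its equality case are read off from it. -/
theorem two_re_overlap_le (d : Fin w) (a b : QState w) :
    2 * (overlap d a b).re = (∑ z, if z d = false then ‖a z‖ ^ 2 else 0) +
      (∑ z, if z d = false then ‖b (Function.update z d true)‖ ^ 2 else 0) -
      ∑ z, if z d = false then ‖a z - b (Function.update z d true)‖ ^ 2 else 0 := by
  have hterm : ∀ u v : ℂ, 2 * (star u * v).re = ‖u‖ ^ 2 + ‖v‖ ^ 2 - ‖u - v‖ ^ 2 := by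
    intro u v
    simp only [← Complex.normSq_eq_norm_sq, Complex.normSq_apply, Complex.star_def,
      Complex.sub_re, Complex.sub_im, Complex.mul_re, Complex.conj_re, Complex.conj_im]
    ring
  rw [overlap, Complex.re_sum, Finset.mul_sum, ← Finset.sum_add_distrib,
    ← Finset.sum_sub_distrib]
  refine Finset.sum_congr rfl fun z _ => ?_
  split_ifs
  · exact hterm _ _
  · simp

theorem mergeNorm_le_four (d : Fin w) {a b : QState w} (ha : ∑ z, ‖a z‖ ^ 2 ≤ 1)
    (hb : ∑ z, ‖b z‖ ^ 2 ≤ 1) : mergeNorm d a b ≤ 4 := by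
  rw [mergeNorm_eq, two_re_overlap_le]
  have := sum_false_le d a
  have := sum_update_true_le d b
  have : 0 ≤ ∑ z, if z d = false then ‖a z - b (Function.update z d true)‖ ^ 2 else 0 :=
    Finset.sum_nonneg fun z _ => by split_ifs <;> positivity
  linarith

/-- Equality in `mergeNorm_le_four`. -/
theorem eq_of_mergeNorm_eq_four (d : Fin w) {a b : QState w} (ha : ∑ z, ‖a z‖ ^ 2 ≤ 1)
    (hb : ∑ z, ‖b z‖ ^ 2 ≤ 1) (h : mergeNorm d a b = 4) :
    (∀ z, z d = false → a z = b (Function.update z d true)) ∧ ∀ z, z d = true → a z = 0 := by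
  rw [mergeNorm_eq, two_re_overlap_le] at h
  have h1 := sum_false_le d a
  have h2 := sum_update_true_le d b
  have hnn : ∀ z ∈ Finset.univ, (0 : ℝ) ≤
      if z d = false then ‖a z - b (Function.update z d true)‖ ^ 2 else 0 :=
    fun z _ => by split_ifs <;> positivity
  have h3 := Finset.sum_nonneg hnn
  have h4 : (∑ z, if z d = false then ‖a z - b (Function.update z d true)‖ ^ 2 else 0) = 0 := by
    linarith
  -- The part of `a` with bit `d` equal to 0 must already have squared norm 1, so nothing is left
  -- for the strings with bit `d` equal to 1.
  have h5 : (∑ z, if z d = false then ‖a z‖ ^ 2 else 0) = ∑ z, ‖a z‖ ^ 2 := by linarith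
  rw [Finset.sum_eq_zero_iff_of_nonneg hnn] at h4
  refine ⟨fun z hz => ?_, fun z hz => ?_⟩
  · have := h4 z (Finset.mem_univ z)
    rw [if_pos hz] at this
    exact sub_eq_zero.mp (norm_eq_zero.mp (pow_eq_zero_iff (two_ne_zero)|>.mp this))
  · have h6 := (Finset.sum_eq_sum_iff_of_le (s := Finset.univ)
      (f := fun z => if z d = false then ‖a z‖ ^ 2 else 0) (g := fun z => ‖a z‖ ^ 2)
      (fun z _ => by split_ifs; exacts [le_rfl, by positivity])).mp h5 z (Finset.mem_univ z)
    simp only [hz] at h6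
    exact norm_eq_zero.mp (pow_eq_zero_iff two_ne_zero |>.mp h6.symm)

end merge

/-! ### Fidelity of a state with two branches -/

section branch

variable {w w' h n : ℕ} {Φ : TriState w h} {ρ : Bool → (Fin n → Bool) → Fin w → Bool}
  {γ : (Fin n → Bool) → Fin h → Bool}

theorem sqrt_two_pow_sq (n : ℕ) :
    ‖(1 / (Real.sqrt (2 ^ (n + 1)) : ℂ)) / (Real.sqrt 2 : ℂ)‖ ^ 2 = 1 / 2 ^ (n + 2) := by
  rw [norm_div, norm_div, norm_one, Complex.norm_real, Complex.norm_real, Real.norm_eq_abs,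
    Real.norm_eq_abs, abs_of_nonneg (Real.sqrt_nonneg _), abs_of_nonneg (Real.sqrt_nonneg _),
    div_pow, div_pow, Real.sq_sqrt (by positivity), Real.sq_sqrt (by positivity)]
  field_simp; ring

/-- Since γ is injective, different x leave orthogonal states on `H`, and the fidelity has no cross
terms. The denominator combines the normalisation 2⁻⁽ⁿ⁺¹⁾ with the factor 1/2 of the Bell pair. -/
theorem IsBranchState.bellFidelity_eq (hΦ : IsBranchState Φ ρ γ)
    (T : QState w →ₗ[ℂ] QState w') (d : Fin w') :
    bellFidelity d (applyR T Φ) =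
      (∑ x, mergeNorm d (T (ket (ρ false x))) (T (ket (ρ true x)))) / 2 ^ (n + 2) := by
  set c : ℂ := 1 / (Real.sqrt (2 ^ (n + 1)) : ℂ) with hc
  have happ : ∀ z b y, applyR T Φ z b y =
      c * ∑ x, if y = γ x then T (ket (ρ b x)) z else 0 := by
    intro z b y
    have h1 : (fun x => Φ x b y) = c • ∑ x, if y = γ x then ket (ρ b x) else 0 := by
      funext z'
      rw [hΦ.amp, Pi.smul_apply, Finset.sum_apply, smul_eq_mul]
      congr 1
      exact Finset.sum_congr rfl fun x _ => by split_ifs <;> rfl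
    change T (fun x => Φ x b y) z = _
    rw [h1, map_smul, map_sum, Pi.smul_apply, Finset.sum_apply, smul_eq_mul]
    congr 1
    refine Finset.sum_congr rfl fun x _ => ?_
    split_ifs
    · rfl
    · simp
  have hrow : ∀ z, (∑ y, if z d = false then
      ‖(applyR T Φ z false y + applyR T Φ (Function.update z d true) true y) /
        (Real.sqrt 2 : ℂ)‖ ^ 2 else 0) =
      ∑ x, (if z d = false then ‖T (ket (ρ false x)) z +
        T (ket (ρ true x)) (Function.update z d true)‖ ^ 2 else 0) / 2 ^ (n + 2) := by
    intro z
    by_cases hz : z d = false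
    swap
    · simp [hz]
    simp only [hz, if_true]
    -- Strings of `H` outside the range of γ have amplitude zero; the others are reindexed by x.
    rw [← Finset.sum_subset (Finset.subset_univ (Finset.univ.image γ)),
      Finset.sum_image (fun x _ x' _ e => hΦ.inj e)]
    · refine Finset.sum_congr rfl fun x _ => ?_
      rw [happ, happ]
      simp only [hΦ.inj.eq_iff, Finset.sum_ite_eq, Finset.mem_univ, if_true]
      rw [← mul_add, mul_comm, mul_div_assoc, norm_mul, mul_pow, sqrt_two_pow_sq]
      ring
    · intro y _ hy
      have hy' : ∀ x, y ≠ γ x := fun x e => hy (by simp [e])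
      simp [happ, hy']
  rw [bellFidelity, Finset.sum_congr rfl fun z _ => hrow z, Finset.sum_comm, Finset.sum_div]
  exact Finset.sum_congr rfl fun x _ => by rw [mergeNorm, Finset.sum_div]

/-- High fidelity forces a large average overlap. -/
theorem IsBranchState.sum_overlap_ge (hΦ : IsBranchState Φ ρ γ)
    (T : QState w →ₗ[ℂ] QState w') (d : Fin w')
    (hT : ∀ b x, ∑ z, ‖T (ket (ρ b x)) z‖ ^ 2 ≤ 1) :
    2 ^ n * (2 * bellFidelity d (applyR T Φ) - 1) ≤
      ∑ x, (overlap d (T (ket (ρ false x))) (T (ket (ρ true x)))).re := by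
  rw [hΦ.bellFidelity_eq]
  have h1 : (∑ x, mergeNorm d (T (ket (ρ false x))) (T (ket (ρ true x)))) ≤
      ∑ x, (2 + 2 * (overlap d (T (ket (ρ false x))) (T (ket (ρ true x)))).re) :=
    Finset.sum_le_sum fun x _ => mergeNorm_le d (hT _ _) (hT _ _)
  rw [Finset.sum_add_distrib, ← Finset.mul_sum] at h1
  simp only [Finset.sum_const, Finset.card_univ, Fintype.card_pi, Fintype.card_bool,
    Finset.prod_const, Fintype.card_fin, nsmul_eq_mul, Nat.cast_pow, Nat.cast_ofNat] at h1
  have hpos : (0 : ℝ) < 2 ^ n := by positivity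
  rw [pow_add]
  field_simp
  linarith

end branch

/-! ### The promise -/

/-- The bijection between the two ranges extends to the whole type, since by finiteness their
complements have equal size. -/
theorem exists_perm_of_injective {α β : Type*} [Finite β] {f g : α → β}
    (hf : Function.Injective f) (hg : Function.Injective g) :
    ∃ π : Equiv.Perm β, ∀ a, π (f a) = g a := by
  classical
  have := Fintype.ofFinite β
  let e : {b // b ∈ Set.range f} ≃ {b // b ∈ Set.range g} :=
    (Equiv.ofInjective f hf).symm.trans (Equiv.ofInjective g hg)
  refine ⟨e.extendSubtype, fun a => ?_⟩
  rw [Equiv.extendSubtype_apply_of_mem e (f a) ⟨a, rfl⟩]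
  have : (Equiv.ofInjective f hf).symm ⟨f a, ⟨a, rfl⟩⟩ = a := by
    rw [Equiv.symm_apply_eq]; rfl
  simp [e, this]

/-- If `ρ` is injective and its last bit tells the branch, then some permutation of the basis
states merges the two branches. -/
theorem IsBranchState.distills {k h n : ℕ} {Φ : TriState (k + 1) h}
    {ρ : Bool → (Fin n → Bool) → Fin (k + 1) → Bool} {γ : (Fin n → Bool) → Fin h → Bool}
    (hΦ : IsBranchState Φ ρ γ) (hρ : Function.Injective fun p : Bool × (Fin n → Bool) => ρ p.1 p.2)
    (hn : n ≤ k) :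
    ∃ U : Matrix.unitaryGroup (Fin (k + 1) → Bool) ℂ, DistillsBellPair U Φ := by
  have hpad : Function.Injective (padZeros (n := n) k) := by
    intro x x' e
    funext i
    have := congrFun e ⟨i, by omega⟩
    simpa [padZeros, firstBits] using this
  -- The targets: for each x both branches receive the same string apart from the last bit, which
  -- equals `b`. This is a Bell pair with `B`.
  have hg : Function.Injective fun p : Bool × (Fin n → Bool) =>
      (Fin.snoc (α := fun _ => Bool) (padZeros k p.2) p.1 : Fin (k + 1) → Bool) := by
    rintro ⟨b, x⟩ ⟨b', x'⟩ e
    have e1 := congrFun e (Fin.last k)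
    simp only [Fin.snoc_last] at e1
    have e2 : padZeros k x = padZeros k x' := by
      funext i
      simpa using congrFun e i.castSucc
    rw [e1, hpad e2]
  obtain ⟨π, hπ⟩ := exists_perm_of_injective hρ hg
  -- The matrix of a permutation acts on vectors by composition with it, so the inverse is needed to
  -- send the basis state of ρ to its image under π.
  have hU : (π⁻¹).permMatrix ℂ ∈ Matrix.unitaryGroup (Fin (k + 1) → Bool) ℂ := by
    rw [Matrix.mem_unitaryGroup_iff, Matrix.star_eq_conjTranspose, Matrix.conjTranspose_permMatrix,
      ← Matrix.permMatrix_mul, inv_inv, mul_inv_cancel, Matrix.permMatrix_one]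
  refine ⟨⟨_, hU⟩, ?_⟩
  have hket : ∀ b x, ((π⁻¹).permMatrix ℂ).mulVecLin (ket (ρ b x)) =
      ket (Fin.snoc (α := fun _ => Bool) (padZeros k x) b) := by
    intro b x
    funext z
    rw [Matrix.mulVecLin_apply, Matrix.permMatrix_mulVec, Function.comp_apply, ket_apply, ket_apply,
      ← hπ (b, x)]
    simp [Equiv.symm_apply_eq, Equiv.Perm.inv_def]
  have hfid := hΦ.bellFidelity_eq ((π⁻¹).permMatrix ℂ).mulVecLin (Fin.last k)
  -- The two basis states meet in a single term, |1 + 1|² = 4.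
  have hone : ∀ x : Fin n → Bool, mergeNorm (Fin.last k)
      (ket (Fin.snoc (α := fun _ => Bool) (padZeros k x) false))
      (ket (Fin.snoc (α := fun _ => Bool) (padZeros k x) true)) = 4 := by
    intro x
    rw [mergeNorm, Finset.sum_eq_single (Fin.snoc (α := fun _ => Bool) (padZeros k x) false)]
    · rw [Fin.snoc_last, Fin.update_snoc_last, if_pos rfl, ket_apply, ket_apply, if_pos rfl,
        if_pos rfl]
      norm_num
    · intro z _ hz
      split_ifs with hlast
      · rw [ket_apply, ket_apply, if_neg hz, if_neg]
        · simp
        · intro e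
          apply hz
          have := congrArg (fun v => Function.update v (Fin.last k) false) e
          simp only [Function.update_idem, Fin.update_snoc_last] at this
          have hz' := Function.update_eq_self (Fin.last k) z
          rw [hlast] at hz'
          rwa [hz'] at this
      · rfl
    · simp
  simp only [hket, hone] at hfid
  rw [DistillsBellPair]
  refine Eq.trans hfid ?_
  simp only [Finset.sum_const, Finset.card_univ, Fintype.card_pi, Fintype.card_bool,
    Finset.prod_const, Fintype.card_fin, nsmul_eq_mul, Nat.cast_pow, Nat.cast_ofNat]
  rw [pow_add]
  have hpos : (0 : ℝ) < 2 ^ n := by positivity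
  field_simp
  norm_num

/-! ### Inversion from an exact decoder -/

theorem isBranchState_owfState {n m : ℕ} (f : (Fin n → Bool) → Fin m → Bool) :
    IsBranchState (owfState f) (fun b x => Fin.snoc (α := fun _ => Bool)
      (if b then f x else padZeros m x) b) id := by
  refine ⟨Function.injective_id, fun z b y => ?_⟩
  simp only [owfState, id, Finset.sum_ite_eq, Finset.mem_univ, if_true, ket_apply, mul_ite,
    mul_one, mul_zero]

theorem sum_norm_sq_column {ι : Type*} [Fintype ι] [DecidableEq ι]
    (U : Matrix.unitaryGroup ι ℂ) (j j' : ι) :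
    ∑ z, star ((U : Matrix ι ι ℂ) z j) * (U : Matrix ι ι ℂ) z j' = if j = j' then 1 else 0 := by
  have := congrFun (congrFun (Matrix.mem_unitaryGroup_iff'.mp U.2) j) j'
  rwa [Matrix.mul_apply, Matrix.one_apply] at this

/-- Fidelity 1 is the maximum of an average, so each x attains it. The equality case turns entries
of W in column f(x) into entries of U in the column (x0…0,0), which vanish at last bit 1. The matrix
product is then an inner product of two columns of U. -/
theorem fixLast_mulVec_ket {n m : ℕ} (f : (Fin n → Bool) → Fin m → Bool)
    (U : Matrix.unitaryGroup (Fin (m + 1) → Bool) ℂ) (hU : DistillsBellPair U (owfState f))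
    (x : Fin n → Bool) :
    ((fixLast false (U : Matrix (Fin (m + 1) → Bool) (Fin (m + 1) → Bool) ℂ)).conjTranspose *
      fixLast true (U : Matrix (Fin (m + 1) → Bool) (Fin (m + 1) → Bool) ℂ)).mulVec (ket (f x)) =
        ket (padZeros m x) := by
  have hcol : ∀ j : Fin (m + 1) → Bool,
      (U : Matrix (Fin (m + 1) → Bool) (Fin (m + 1) → Bool) ℂ).mulVecLin (ket j) =
      fun z => (U : Matrix (Fin (m + 1) → Bool) (Fin (m + 1) → Bool) ℂ) z j := by
    intro j
    rw [Matrix.mulVecLin_apply, ket, Matrix.mulVec_single_one]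
    rfl
  have hnorm : ∀ j : Fin (m + 1) → Bool,
      ∑ z, ‖(U : Matrix (Fin (m + 1) → Bool) (Fin (m + 1) → Bool) ℂ) z j‖ ^ 2 ≤ 1 := by
    intro j
    have h1 := sum_norm_sq_column U j j
    have h2 := braket_self
      fun z => (U : Matrix (Fin (m + 1) → Bool) (Fin (m + 1) → Bool) ℂ) z j
    rw [braket, h1, if_pos rfl] at h2
    exact le_of_eq (by exact_mod_cast h2.symm)
  have hfid := (isBranchState_owfState f).bellFidelity_eq
    (U : Matrix (Fin (m + 1) → Bool) (Fin (m + 1) → Bool) ℂ).mulVecLin (Fin.last m)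
  have hU' : bellFidelity (Fin.last m) (applyR
    (U : Matrix (Fin (m + 1) → Bool) (Fin (m + 1) → Bool) ℂ).mulVecLin (owfState f)) = 1 := hU
  rw [hU'] at hfid
  simp only [hcol] at hfid
  have hle := fun x (_ : x ∈ Finset.univ) => mergeNorm_le_four (Fin.last m)
    (hnorm (Fin.snoc (α := fun _ => Bool) (if false then f x else padZeros m x) false))
    (hnorm (Fin.snoc (α := fun _ => Bool) (if true then f x else padZeros m x) true))
  simp only [Bool.false_eq_true, if_false, if_true] at hfid hle
  -- Each term is at most 4 and the sum is 2ⁿ⁺² = 4 · 2ⁿ, so all terms equal 4.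
  have hfour := (Finset.sum_eq_sum_iff_of_le hle).mp (by
    rw [eq_div_iff (by positivity), one_mul] at hfid
    rw [← hfid]
    simp [pow_add]; norm_num) x (Finset.mem_univ x)
  obtain ⟨h1, h2⟩ := eq_of_mergeNorm_eq_four _ (hnorm _) (hnorm _) hfour
  funext y
  rw [ket, Matrix.mulVec_single_one, Matrix.col_apply, Matrix.mul_apply, ket_apply]
  have h3 := sum_norm_sq_column U (Fin.snoc (α := fun _ => Bool) y false)
    (Fin.snoc (α := fun _ => Bool) (padZeros m x) false)
  rw [← Equiv.sum_comp (Fin.snocEquiv fun _ => Bool), Fintype.sum_prod_type,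
    Fintype.sum_bool] at h3
  have h4 : ∀ z : Fin m → Bool, (Fin.snocEquiv fun _ => Bool) (true, z) =
      (Fin.snoc (α := fun _ => Bool) z true : Fin (m + 1) → Bool) := fun _ => rfl
  have h5 : ∀ z : Fin m → Bool, (Fin.snocEquiv fun _ => Bool) (false, z) =
      (Fin.snoc (α := fun _ => Bool) z false : Fin (m + 1) → Bool) := fun _ => rfl
  simp only [h4, h5] at h3
  -- Rows with last bit 1 drop out of the inner product, because the column of (x0…0,0) is zero
  -- there.
  rw [Finset.sum_eq_zero (fun z _ => by rw [h2 _ (Fin.snoc_last _ _), mul_zero]), zero_add] at h3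
  have h6 : (Fin.snoc (α := fun _ => Bool) y false : Fin (m + 1) → Bool) =
      Fin.snoc (α := fun _ => Bool) (padZeros m x) false ↔ y = padZeros m x := by
    constructor
    · intro e
      funext i
      simpa using congrFun e i.castSucc
    · rintro rfl; rfl
  simp only [h6] at h3
  rw [← h3]
  refine Finset.sum_congr rfl fun z _ => ?_
  rw [Matrix.conjTranspose_apply, fixLast, fixLast, Matrix.of_apply, Matrix.of_apply,
    h1 _ (Fin.snoc_last _ _), Fin.update_snoc_last]

end HarlowHayden


namespace HarlowHayden

/-! ### The circuit that prepares the state of a function -/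

-- `vX` is the first wire of the argument, `vEn` a control wire that is constantly 1, and `vB` the
-- wire of `B`. `vEn` differs from `vOne` because a Toffoli gate needs distinct wires. Variable `vB`
-- is assigned only after the simulation, which uses variables from `11` on as free ones.
notation "vX" => (9 : ℕ)
notation "vEn" => (10 : ℕ)
notation "vB" => (11 : ℕ)

namespace Stmt

/-- Run `s` for a number of consecutive values of `vJ` and `vK`. -/
def zipLoop (q : ℕ) (s : Stmt) : Stmt := rep q (seq s (seq (inc vJ) (inc vK)))

/-- Put the wires of the argument in superposition.  The first wires are those of `R` and `B`. -/
def superpose : Stmt :=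
  seq (copy vFresh 1) (seq (inc vFresh) (seq (inc vFresh) (seq (copy vX vFresh)
    (rep 0 (seq (emit (.had vFresh)) (inc vFresh))))))

/-- Load the initial configuration of a machine with `R` registers. -/
def prepare (R : ℕ) : Stmt :=
  seq (newBit vOne) (seq (emit (.not vOne)) (seq (newBit vEn) (seq (emit (.not vEn))
    (seq (copy vBase vFresh) (seq (advance vFresh (2 * R))
      (seq (copy vJ vBase) (seq (copy vK vX)
        -- Array 0 marks the zeros of the argument: the NOT gate followed by an XOR with the
        -- argument bit leaves its negation. Array 1 below receives the bit itself.
        (seq (zipLoop 0 (seq (emit (.not vJ)) (emit (.tof vOne vK vJ))))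
          (seq (copy vJ vBase) (seq (advance vJ 1) (seq (copy vK vX)
            (zipLoop 0 (emit (.tof vOne vK vJ))))))))))))))

/-- Put `B` in superposition. -/
def superposeB : Stmt := seq (copy vB 1) (seq (inc vB) (emit (.had vB)))

/-- Write the argument or the value of the function on `R`, depending on `B`. -/
def deliver : Stmt :=
  -- The length m of the value, held in variable `1`, is also the number of the last wire of `R`,
  -- which receives a copy of `B`. Afterwards each argument bit x is added as x + bx, which cancels
  -- for b = 1, and the value bits, read from the array of ones of register 0, are added under the
  -- control of `B`.
  seq (emit (.tof vOne vB 1)) (seq (zero vJ) (seq (copy vK vX)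
    (seq (zipLoop 0 (seq (emit (.tof vOne vK vJ)) (emit (.tof vB vK vJ))))
      (seq (zero vJ) (seq (copy vK vBase) (seq (advance vK 1)
        (zipLoop 1 (emit (.tof vB vK vJ)))))))))

/-- The circuit for the function computed by `c`.  Variable `0` holds the length of the argument,
variable `1` that of the value, and variable `2` the capacity of the simulation. -/
def generator (c : Prog) (R : ℕ) : Stmt :=
  seq superpose (seq (prepare R) (seq (c.simulate vEn vB) (seq superposeB deliver)))

theorem wf_generator (c : Prog) (R : ℕ) : (generator c R).Wf params := by
  have hadv := wf_advance
  refine ⟨?_, ?_, c.wf_simulate _ _ (by omega), ?_, ?_⟩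
  · simp [superpose, Wf, params]
  · simp [prepare, newBit, zipLoop, Wf, hadv]; simp [params]
  · simp [superposeB, Wf, params]
  · simp [deliver, zipLoop, Wf, hadv]; simp [params]

theorem iterate_inc_inc (i : ℕ) (σ : ℕ → ℕ) :
    (fun σ : ℕ → ℕ => Function.update (Function.update σ vJ (σ vJ + 1)) vK (σ vK + 1))^[i] σ =
      Function.update (Function.update σ vJ (σ vJ + i)) vK (σ vK + i) := by
  induction i with
  | zero => simp
  | succ i ih =>
    rw [Function.iterate_succ_apply', ih]
    funext v
    by_cases h1 : v = vK
    · subst h1; simp [add_assoc]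
    · by_cases h2 : v = vJ
      · subst h2; simp [add_assoc]
      · simp [h1, h2]

theorem zipLoop_vars {s : Stmt} (hs : ∀ σ, s.vars σ = σ) (q : ℕ) (σ : ℕ → ℕ) :
    (zipLoop q s).vars σ =
      Function.update (Function.update σ vJ (σ vJ + σ q)) vK (σ vK + σ q) := by
  rw [← iterate_inc_inc]
  simp only [zipLoop, vars, hs]
  simp

theorem zipLoop_gates {s : Stmt} (hs : ∀ σ, s.vars σ = σ) (q : ℕ) (σ : ℕ → ℕ) :
    (zipLoop q s).gates σ = (List.range (σ q)).flatMap fun i => s.gates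
      (Function.update (Function.update σ vJ (σ vJ + i)) vK (σ vK + i)) := by
  have h : (seq s (seq (inc vJ) (inc vK))).vars = fun σ : ℕ → ℕ =>
      Function.update (Function.update σ vJ (σ vJ + 1)) vK (σ vK + 1) := by
    funext σ
    simp [vars, hs]
  simp only [zipLoop, gates, h, iterate_inc_inc, List.append_nil]

end Stmt

/-- Circuits whose `i`-th part acts on wire `t + i`. -/
theorem eval_flatMap_range {t n : ℕ} {g : ℕ → List WGate} {F : ℕ → Bool} {m : ℕ → Bool}
    (h : ∀ i < n, ∀ m' : ℕ → Bool, (∀ a, a < t ∨ t + n ≤ a → m' a = m a) →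
      m' (t + i) = m (t + i) → evalGates (g i) m' = Function.update m' (t + i) (F i)) :
    evalGates ((List.range n).flatMap g) m =
      fun a => if t ≤ a ∧ a < t + n then F (a - t) else m a := by
  have key : ∀ k ≤ n, evalGates ((List.range k).flatMap g) m =
      fun a => if t ≤ a ∧ a < t + k then F (a - t) else m a := by
    intro k hk
    induction k with
    | zero => funext a; simp
    | succ k ih =>
      rw [List.range_succ, List.flatMap_append, evalGates_append, ih (by omega)]
      simp only [List.flatMap_cons, List.flatMap_nil, List.append_nil]
      rw [h k (by omega) _ (fun a ha => if_neg (by omega)) (if_neg (by omega))]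
      funext a
      by_cases ha : a = t + k
      · subst ha; simp
      · rw [Function.update_of_ne ha]
        have : (t ≤ a ∧ a < t + (k + 1)) ↔ (t ≤ a ∧ a < t + k) := by omega
        simp only [this]
  exact key n le_rfl

/-! ### Variables, gates and memory of the phases of the generator -/

section phases

variable {n R : ℕ} {σ : ℕ → ℕ}

/-- The bits of a string, followed by zeros. -/
def bitsOf {n : ℕ} (x : Fin n → Bool) : ℕ → Bool := fun i => if h : i < n then x ⟨i, h⟩ else false

theorem setBlock_apply {n : ℕ} (m : ℕ → Bool) (x₀ : ℕ) (x : Fin n → Bool) (a : ℕ) :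
    setBlock m x₀ x a = if x₀ ≤ a ∧ a < x₀ + n then bitsOf x (a - x₀) else m a := by
  unfold setBlock
  split_ifs with h
  · simp [bitsOf, show a - x₀ < n by omega]
  · rfl

theorem superpose_vars (σ : ℕ → ℕ) : Stmt.superpose.vars σ =
    Function.update (Function.update σ vX (σ 1 + 2)) vFresh (σ 1 + 2 + σ 0) := by
  funext v
  by_cases h3 : v = vFresh
  · subst h3; simp [Stmt.superpose, Stmt.vars, Stmt.iterate_inc]
  · by_cases h9 : v = vX
    · subst h9; simp [Stmt.superpose, Stmt.vars, Stmt.iterate_inc]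
    · simp [Stmt.superpose, Stmt.vars, Stmt.iterate_inc, h3, h9]

theorem superpose_gates (σ : ℕ → ℕ) : Stmt.superpose.gates σ =
    (List.range (σ 0)).map fun i => WGate.had (σ 1 + 2 + i) := by
  simp [Stmt.superpose, Stmt.vars, Stmt.gates, Stmt.iterate_inc, WGate.map]
  simp [List.map_eq_flatMap]

theorem prepare_vars (σ : ℕ → ℕ) : (Stmt.prepare R).vars σ =
    Function.update (Function.update (Function.update (Function.update (Function.update
      (Function.update σ vOne (σ vFresh)) vEn (σ vFresh + 1)) vBase (σ vFresh + 2))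
      vFresh (σ vFresh + 2 + 2 * R * σ vSize)) vJ (σ vFresh + 2 + σ vSize + σ 0))
      vK (σ vX + σ 0) := by
  funext v
  simp only [Stmt.prepare, Stmt.newBit, Stmt.vars]
  rw [Stmt.zipLoop_vars (by intro; rfl), Stmt.advance_vars _ _ (by omega), Stmt.zipLoop_vars
    (by intro; rfl), Stmt.advance_vars _ _ (by omega)]
  by_cases h3 : v = vFresh
  · subst h3; simp
  · simp [Function.update_apply, h3]
    split_ifs <;> rfl

theorem prepare_gates (σ : ℕ → ℕ) : (Stmt.prepare R).gates σ =
    [.not (σ vFresh), .not (σ vFresh + 1)] ++ ((List.range (σ 0)).flatMap (fun i =>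
      [.not (σ vFresh + 2 + i), .tof (σ vFresh) (σ vX + i) (σ vFresh + 2 + i)]) ++
      (List.range (σ 0)).flatMap (fun i =>
        [.tof (σ vFresh) (σ vX + i) (σ vFresh + 2 + σ vSize + i)])) := by
  simp only [Stmt.prepare, Stmt.newBit, Stmt.vars, Stmt.gates, Stmt.advance_gates]
  rw [Stmt.zipLoop_gates (by intro; rfl), Stmt.zipLoop_gates (by intro; rfl),
    Stmt.zipLoop_vars (by intro; rfl), Stmt.advance_vars _ _ (by omega),
    Stmt.advance_vars _ _ (by omega)]
  simp [Stmt.gates, WGate.map, Stmt.vars]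

/-- The memory after the initial configuration has been loaded. -/
theorem prepare_spec (h0 : σ 0 = n) (hX : σ vX + n ≤ σ vFresh) (hn : n ≤ σ vSize) (hR : 1 ≤ R)
    {mem : ℕ → Bool} (hmem : ∀ a, σ vFresh ≤ a → mem a = false) (x : Fin n → Bool)
    (hx : ∀ i < n, mem (σ vX + i) = bitsOf x i) :
    (∀ g ∈ (Stmt.prepare R).gates σ, g.Good ((Stmt.prepare R).vars σ vFresh)) ∧
    (∀ a < σ vFresh, evalGates ((Stmt.prepare R).gates σ) mem a = mem a) ∧
    Cfg R ((Stmt.prepare R).vars σ) (evalGates ((Stmt.prepare R).gates σ) mem)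
      (content (inputStore (List.ofFn x))) ∧
    Enable R ((Stmt.prepare R).vars σ) (evalGates ((Stmt.prepare R).gates σ) mem) vEn true := by
  subst h0
  have hRS : 2 * σ vSize ≤ 2 * R * σ vSize := Nat.mul_le_mul_right _ (by omega)
  have e3 : (Stmt.prepare R).vars σ vFresh = σ vFresh + 2 + 2 * R * σ vSize := by
    simp [prepare_vars]
  have e2 : (Stmt.prepare R).vars σ vSize = σ vSize := by simp [prepare_vars]
  have e4 : (Stmt.prepare R).vars σ vBase = σ vFresh + 2 := by simp [prepare_vars]
  have e5 : (Stmt.prepare R).vars σ vOne = σ vFresh := by simp [prepare_vars]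
  have e10 : (Stmt.prepare R).vars σ vEn = σ vFresh + 1 := by simp [prepare_vars]
  have z0 := hmem (σ vFresh) le_rfl
  have z1 := hmem (σ vFresh + 1) (by omega)
  have heval : evalGates ((Stmt.prepare R).gates σ) mem = fun a =>
      if σ vFresh + 2 + σ vSize ≤ a ∧ a < σ vFresh + 2 + σ vSize + σ 0 then
        bitsOf x (a - (σ vFresh + 2 + σ vSize))
      else if σ vFresh + 2 ≤ a ∧ a < σ vFresh + 2 + σ 0 then !bitsOf x (a - (σ vFresh + 2))
      else if a = σ vFresh ∨ a = σ vFresh + 1 then true else mem a := by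
    have h1 : evalGates [.not (σ vFresh), .not (σ vFresh + 1)] mem =
        fun a => if a = σ vFresh ∨ a = σ vFresh + 1 then true else mem a := by
      funext a
      by_cases h1 : a = σ vFresh + 1
      · subst h1; simp [WGate.eval, z1]
      · by_cases h0 : a = σ vFresh
        · subst h0; simp [WGate.eval, z0]
        · simp [WGate.eval, h1, h0]
    rw [prepare_gates, evalGates_append, evalGates_append, h1,
      eval_flatMap_range (t := σ vFresh + 2) (g := fun i =>
        [.not (σ vFresh + 2 + i), .tof (σ vFresh) (σ vX + i) (σ vFresh + 2 + i)]) (F := fun i => !bitsOf x i),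
      eval_flatMap_range (t := σ vFresh + 2 + σ vSize) (F := fun i => bitsOf x i)]
    · intro i hi m' hm' hm''
      have h2 : m' (σ vFresh) = true := by
        rw [hm' _ (by omega), if_neg (by omega), if_pos (by omega)]
      have h3 : m' (σ vX + i) = bitsOf x i := by
        rw [hm' _ (by omega), if_neg (by omega), if_neg (by omega), hx i hi]
      rw [if_neg (by omega), if_neg (by omega), hmem _ (by omega)] at hm''
      simp [WGate.eval, h2, h3, hm'']
    · intro i hi m' hm' hm''
      have h2 : m' (σ vFresh) = true := by
        rw [hm' _ (by omega), if_pos (by omega)]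
      have h3 : m' (σ vX + i) = bitsOf x i := by
        rw [hm' _ (by omega), if_neg (by omega), hx i hi]
      rw [if_neg (by omega), hmem _ (by omega)] at hm''
      simp only [evalGates_cons, evalGates_nil, WGate.eval, hm'', Function.update_self,
        Function.update_idem, Function.update_of_ne (show σ vFresh ≠ σ vFresh + 2 + i by omega),
        Function.update_of_ne (show σ vX + i ≠ σ vFresh + 2 + i by omega), h2, h3]
      simp
  refine ⟨?_, ?_, ⟨?_, ?_, ?_, ?_, ?_⟩, ⟨?_, ?_, ?_, ?_, ?_⟩⟩
  · rw [e3, prepare_gates]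
    intro g hg
    simp only [List.mem_append, List.mem_flatMap, List.mem_range, List.mem_cons,
      List.not_mem_nil, or_false] at hg
    rcases hg with (rfl | rfl) | ⟨i, hi, rfl | rfl⟩ | ⟨i, hi, rfl⟩ <;>
      simp only [WGate.Good] <;> omega
  · intro a ha
    rw [heval]; dsimp only
    rw [if_neg (by omega), if_neg (by omega), if_neg (by omega)]
  · rw [e2, e3, e4]
  · rw [e4, e5]; omega
  · rw [e5, heval]; dsimp only
    rw [if_neg (by omega), if_neg (by omega), if_pos (by omega)]
  · rw [e3]
    intro a ha
    rw [heval]; dsimp only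
    rw [if_neg (by omega), if_neg (by omega), if_neg (by omega), hmem a (by omega)]
  · rw [e2, e4, heval]
    intro t ht j hj
    dsimp only
    have hget : (List.ofFn x)[j]? = if h : j < σ 0 then some (x ⟨j, h⟩) else none := by
      rw [List.getElem?_ofFn]
    by_cases h0 : t = 0
    · subst h0
      rw [if_neg (by omega)]
      have hc : content (inputStore (List.ofFn x)) 0 j =
          decide ((List.ofFn x)[j]? = some false) := by simp [content, inputStore]
      rw [hc, hget]
      by_cases hjn : j < σ 0
      · rw [if_pos (by omega), show σ vFresh + 2 + 0 * σ vSize + j - (σ vFresh + 2) = j by omega]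
        simp only [bitsOf, hjn, dif_pos, Option.some.injEq]
        cases x ⟨j, hjn⟩ <;> rfl
      · rw [if_neg (by omega), if_neg (by omega), hmem _ (by omega)]
        simp [hjn]
    · by_cases h1 : t = 1
      · subst h1
        have hc : content (inputStore (List.ofFn x)) 1 j =
            decide ((List.ofFn x)[j]? = some true) := by simp [content, inputStore]
        rw [hc, hget]
        by_cases hjn : j < σ 0
        · rw [if_pos (by omega), show σ vFresh + 2 + 1 * σ vSize + j -
            (σ vFresh + 2 + σ vSize) = j by omega]
          simp only [bitsOf, hjn, dif_pos, Option.some.injEq]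
          cases x ⟨j, hjn⟩ <;> rfl
        · rw [if_neg (by omega), if_neg (by omega), if_neg (by omega), hmem _ (by omega)]
          simp [hjn]
      · have h2 : 2 * σ vSize ≤ t * σ vSize := Nat.mul_le_mul_right _ (by omega)
        rw [if_neg (by omega), if_neg (by omega), if_neg (by omega), hmem _ (by omega)]
        simp [content, inputStore, show t / 2 ≠ 0 by omega]
  · omega
  · rw [e3, e10]; omega
  · rw [e4, e10]; omega
  · rw [e5, e10]; omega
  · rw [e10, heval]; dsimp only
    rw [if_neg (by omega), if_neg (by omega), if_pos (by omega)]

theorem superposeB_vars (σ : ℕ → ℕ) :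
    Stmt.superposeB.vars σ = Function.update σ vB (σ 1 + 1) := by
  simp [Stmt.superposeB, Stmt.vars]

theorem superposeB_gates (σ : ℕ → ℕ) : Stmt.superposeB.gates σ = [.had (σ 1 + 1)] := by
  simp [Stmt.superposeB, Stmt.vars, Stmt.gates, WGate.map]

theorem deliver_vars_fresh (σ : ℕ → ℕ) : Stmt.deliver.vars σ vFresh = σ vFresh := by
  simp only [Stmt.deliver, Stmt.vars]
  rw [Stmt.zipLoop_vars (by intro; rfl), Stmt.advance_vars _ _ (by omega),
    Stmt.zipLoop_vars (by intro; rfl)]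
  simp

theorem deliver_gates (σ : ℕ → ℕ) : Stmt.deliver.gates σ =
    [.tof (σ vOne) (σ vB) (σ 1)] ++ ((List.range (σ 0)).flatMap (fun i =>
      [.tof (σ vOne) (σ vX + i) (0 + i), .tof (σ vB) (σ vX + i) (0 + i)]) ++
      (List.range (σ 1)).flatMap (fun i =>
        [.tof (σ vB) (σ vBase + σ vSize + i) (0 + i)])) := by
  simp only [Stmt.deliver, Stmt.vars, Stmt.gates, Stmt.advance_gates]
  rw [Stmt.zipLoop_gates (by intro; rfl), Stmt.zipLoop_gates (by intro; rfl),
    Stmt.zipLoop_vars (by intro; rfl), Stmt.advance_vars _ _ (by omega)]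
  simp [Stmt.gates, WGate.map, Stmt.vars]

/-- The memory at the end. -/
theorem deliver_spec (hnm : σ 0 ≤ σ 1) (hX : σ vX = σ 1 + 2) (hB : σ vB = σ 1 + 1)
    (hone : σ 1 + 2 ≤ σ vOne) (hbase : σ 1 + 2 ≤ σ vBase) {mem : ℕ → Bool}
    (h1 : mem (σ vOne) = true) (hz : ∀ a ≤ σ 1, mem a = false) :
    evalGates (Stmt.deliver.gates σ) mem = fun a => if a < σ 1 then
        (if a < σ 0 then mem (σ 1 + 2 + a) ^^ (mem (σ 1 + 1) && mem (σ 1 + 2 + a)) else false) ^^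
          (mem (σ 1 + 1) && mem (σ vBase + σ vSize + a))
      else if a = σ 1 then mem (σ 1 + 1) else mem a := by
  have e0 : evalGates [.tof (σ vOne) (σ vB) (σ 1)] mem =
      fun a => if a = σ 1 then mem (σ 1 + 1) else mem a := by
    funext a
    by_cases ha : a = σ 1
    · subst ha
      simp [WGate.eval, h1, hB, hz]
    · simp [WGate.eval, ha]
  rw [deliver_gates, evalGates_append, evalGates_append, e0,
    eval_flatMap_range (t := 0) (g := fun i =>
      [.tof (σ vOne) (σ vX + i) (0 + i), .tof (σ vB) (σ vX + i) (0 + i)]) (F := fun i =>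
      mem (σ 1 + 2 + i) ^^ (mem (σ 1 + 1) && mem (σ 1 + 2 + i))),
    eval_flatMap_range (t := 0) (F := fun i =>
      (if i < σ 0 then mem (σ 1 + 2 + i) ^^ (mem (σ 1 + 1) && mem (σ 1 + 2 + i)) else false) ^^
        (mem (σ 1 + 1) && mem (σ vBase + σ vSize + i)))]
  · funext a
    by_cases ha : a < σ 1
    · simp [ha]
    · have : ¬ a < σ 0 := by omega
      simp [ha, this]
  · intro i hi m' hm' hm''
    have h2 : m' (σ vB) = mem (σ 1 + 1) := by
      rw [hm' _ (by omega), if_neg (by omega), if_neg (by omega), hB]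
    have h3 : m' (σ vBase + σ vSize + i) = mem (σ vBase + σ vSize + i) := by
      rw [hm' _ (by omega), if_neg (by omega), if_neg (by omega)]
    have h4 : m' (0 + i) = if i < σ 0 then
        mem (σ 1 + 2 + i) ^^ (mem (σ 1 + 1) && mem (σ 1 + 2 + i)) else false := by
      rw [hm'']
      by_cases hi0 : i < σ 0
      · rw [if_pos (by omega), if_pos hi0, Nat.zero_add, Nat.sub_zero]
      · rw [if_neg (by omega), if_neg hi0, if_neg (by omega), hz _ (by omega)]
    simp only [evalGates_cons, evalGates_nil, WGate.eval, h2, h3, h4]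
  · intro i hi m' hm' hm''
    have h2 : m' (σ vB) = mem (σ 1 + 1) := by
      rw [hm' _ (by omega), if_neg (by omega), hB]
    have h3 : m' (σ vX + i) = mem (σ 1 + 2 + i) := by
      rw [hm' _ (by omega), if_neg (by omega), hX]
    have h4 : m' (σ vOne) = true := by
      rw [hm' _ (by omega), if_neg (by omega), h1]
    rw [if_neg (by omega), hz _ (by omega)] at hm''
    simp only [evalGates_cons, evalGates_nil, WGate.eval, Function.update_self,
      Function.update_idem, Function.update_of_ne (show σ vB ≠ 0 + i by omega),
      Function.update_of_ne (show σ vX + i ≠ 0 + i by omega), h2, h3, h4, hm'']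
    simp

end phases

end HarlowHayden


/-! ### The generated circuit and its state -/

namespace HarlowHayden

theorem WGate.Valid.mono {W W' : ℕ} (h : W ≤ W') {g : WGate} (hg : g.Valid W) : g.Valid W' := by
  cases g <;> simp only [WGate.Valid] at * <;> omega

theorem deliver_good {σ : ℕ → ℕ} {W : ℕ} (hnm : σ 0 ≤ σ 1) (hX : σ vX = σ 1 + 2)
    (hB : σ vB = σ 1 + 1) (hone : σ 1 + 2 + σ 0 ≤ σ vOne) (hone' : σ vOne < σ vBase)
    (hbase : σ vBase + 2 * σ vSize ≤ W) (hm : σ 1 ≤ σ vSize) :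
    ∀ g ∈ Stmt.deliver.gates σ, g.Good W := by
  rw [deliver_gates]
  intro g hg
  simp only [List.mem_append, List.mem_flatMap, List.mem_range, List.mem_cons,
    List.not_mem_nil, or_false] at hg
  rcases hg with rfl | ⟨i, hi, rfl | rfl⟩ | ⟨i, hi, rfl⟩ <;>
    simp only [WGate.Good] <;> omega

/-- The wires of the simulation after it has run. -/
theorem simulation_spec {c : Prog} {R : ℕ} (hc : c.regBound ≤ R) (hR : 1 ≤ R) {n m : ℕ}
    {σ : ℕ → ℕ} (h0 : σ 0 = n) (h1 : σ 1 = m) {T : ℕ} (hS : n + T + 1 ≤ σ vSize)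
    {x : Fin n → Bool} {y : Fin m → Bool}
    (hf : OutputsWithin c (List.ofFn x) T (List.ofFn y)) :
    let s := Stmt.seq (Stmt.prepare R) (c.simulate vEn vB)
    let σ1 := Stmt.superpose.vars σ
    let mem1 := setBlock (fun _ => false) (m + 2) x
    (∀ g ∈ s.gates σ1, g.Good (s.vars σ1 vFresh)) ∧
    (∀ v, v = 0 ∨ v = 1 ∨ v = vSize ∨ v = vX → s.vars σ1 v = σ1 v) ∧
    m + 2 + n ≤ s.vars σ1 vOne ∧ s.vars σ1 vOne < s.vars σ1 vBase ∧
    s.vars σ1 vBase + 2 * s.vars σ1 vSize ≤ s.vars σ1 vFresh ∧ m ≤ s.vars σ1 vSize ∧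
    (∀ a < m + 2 + n, evalGates (s.gates σ1) mem1 a = mem1 a) ∧
    evalGates (s.gates σ1) mem1 (s.vars σ1 vOne) = true ∧
    ∀ j < m, evalGates (s.gates σ1) mem1 (s.vars σ1 vBase + s.vars σ1 vSize + j) = bitsOf y j := by
  intro s σ1 mem1
  have a0 : σ1 0 = n := by simp [σ1, superpose_vars, h0]
  have a1 : σ1 1 = m := by simp [σ1, superpose_vars, h1]
  have a2 : σ1 vSize = σ vSize := by simp [σ1, superpose_vars]
  have a3 : σ1 vFresh = m + 2 + n := by simp [σ1, superpose_vars, h1, h0]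
  have a9 : σ1 vX = m + 2 := by simp [σ1, superpose_vars, h1]
  obtain ⟨t, s', ht, hrun, hs'⟩ := hf
  -- The value is at most as long as the argument plus the running time.
  have hm : m ≤ σ vSize := by
    have := hrun.length_le 0
    rw [hs', inputStore, if_pos rfl, List.length_ofFn, List.length_ofFn] at this
    omega
  obtain ⟨g2, k2, cfg2, en2⟩ := prepare_spec (R := R) (σ := σ1) a0 (by omega) (by omega) hR
    (mem := mem1) (fun a ha => by simp only [mem1, setBlock_apply]; rw [if_neg (by omega)]) x
    (fun i hi => by
      simp only [mem1, setBlock_apply, a9]; rw [if_pos (by omega), Nat.add_sub_cancel_left])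
  set σ2 := (Stmt.prepare R).vars σ1 with hσ2
  set mem2 := evalGates ((Stmt.prepare R).gates σ1) mem1 with hmem2
  have b2 : σ2 vSize = σ vSize := by rw [hσ2, prepare_vars, ← a2]; simp
  have b3 : σ2 vFresh = m + 2 + n + 2 + 2 * R * σ vSize := by rw [hσ2, prepare_vars]; simp [a3, a2]
  have b4 : σ2 vBase = m + 2 + n + 2 := by rw [hσ2, prepare_vars]; simp [a3]
  have b5 : σ2 vOne = m + 2 + n := by rw [hσ2, prepare_vars]; simp [a3]
  have hRS : 2 * σ vSize ≤ 2 * R * σ vSize := Nat.mul_le_mul_right _ (by omega)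
  obtain ⟨tame, cfg3⟩ := simulate_spec c hc vEn vB (by omega) (by omega) σ2 mem2
    (inputStore (List.ofFn x)) s' true cfg2 en2 (by omega)
    (.inr ⟨rfl, t, hrun, fun r _ => by
      by_cases hr : r = 0
      · simp only [inputStore, hr, if_true, List.length_ofFn]; omega
      · simp only [inputStore, hr, if_false, List.length_nil]; omega⟩)
  have hv : s.vars σ1 = (c.simulate vEn vB).vars σ2 := rfl
  have hg : s.gates σ1 = (Stmt.prepare R).gates σ1 ++ (c.simulate vEn vB).gates σ2 := rfl
  have he : evalGates (s.gates σ1) mem1 = evalGates ((c.simulate vEn vB).gates σ2) mem2 := by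
    rw [hg, evalGates_append]
  have hk : ∀ v < vB, v ≠ vFresh → v ≠ vJ → v ≠ vC → v ≠ vK → s.vars σ1 v = σ2 v := tame.vars
  have c2 := hk vSize (by omega) (by omega) (by omega) (by omega) (by omega)
  have c4 := hk vBase (by omega) (by omega) (by omega) (by omega) (by omega)
  have c5 := hk vOne (by omega) (by omega) (by omega) (by omega) (by omega)
  have hfr := tame.fresh
  rw [← hv] at hfr
  refine ⟨?_, ?_, ?_, ?_, ?_, ?_, ?_, ?_, ?_⟩
  · intro g hg'
    rw [hg, List.mem_append] at hg'
    rcases hg' with h | h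
    · exact (g2 g h).mono hfr
    · exact tame.good g h
  · rintro v (rfl | rfl | rfl | rfl) <;>
      rw [hk _ (by omega) (by omega) (by omega) (by omega) (by omega), hσ2, prepare_vars] <;> simp
  · rw [c5, b5]
  · rw [c5, c4, b5, b4]; omega
  · rw [c4, c2, b4, b2]; omega
  · rw [c2, b2]; exact hm
  · intro a ha
    rw [he, tame.mem a (by omega) (by omega), k2 a (by omega)]
  · rw [he, hv]; exact cfg3.one
  · intro j hj
    -- Array 1 marks the ones of register 0, so its cells are the bits of the value themselves.
    have := cfg3.cells 1 (by omega) j (by rw [← hv, c2, b2]; omega)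
    rw [← hv, one_mul] at this
    rw [he, this]
    have hc' := content_one s' 0 j
    simp only [mul_zero, zero_add] at hc'
    rw [hc', hs', List.getElem?_ofFn]
    simp [bitsOf, hj]

/-- What the generated circuit does. -/
theorem generator_spec {c : Prog} {R : ℕ} (hc : c.regBound ≤ R) (hR : 1 ≤ R) {n m : ℕ}
    (hnm : n ≤ m) {σ : ℕ → ℕ} (h0 : σ 0 = n) (h1 : σ 1 = m) {T : ℕ} (hS : n + T + 1 ≤ σ vSize)
    {f : (Fin n → Bool) → Fin m → Bool}
    (hf : ∀ x, OutputsWithin c (List.ofFn x) T (List.ofFn (f x))) :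
    (∀ g ∈ (Stmt.generator c R).gates σ, g.Valid ((Stmt.generator c R).vars σ vFresh)) ∧
    m + 2 + n ≤ (Stmt.generator c R).vars σ vFresh ∧
    ∃ mem : (Fin n → Bool) → Bool → ℕ → Bool,
      (∀ W, (Stmt.generator c R).vars σ vFresh ≤ W →
        runCircuit (toCircuit W ((Stmt.generator c R).gates σ)) (ketOf W fun _ => false) =
          (1 / (Real.sqrt 2 : ℂ)) ^ (n + 1) • ∑ x, ∑ b, ketOf W (mem x b)) ∧
      (∀ x b, ∀ j < m, mem x b j = if b then bitsOf (f x) j else bitsOf x j) ∧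
      (∀ x b, mem x b m = b) ∧ (∀ x b, mem x b (m + 1) = b) ∧
      (∀ x b, ∀ i < n, mem x b (m + 2 + i) = bitsOf x i) ∧
      ∀ x b, ∀ a ≥ m + 2, mem x b a = mem x false a := by
  set σ1 := Stmt.superpose.vars σ with hσ1
  set s := Stmt.seq (Stmt.prepare R) (c.simulate vEn vB) with hs
  set σ3 := s.vars σ1 with hσ3
  set σ4 := Stmt.superposeB.vars σ3 with hσ4
  set mem3 : (Fin n → Bool) → ℕ → Bool := fun x =>
    evalGates (s.gates σ1) (setBlock (fun _ => false) (m + 2) x) with hmem3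
  have spec := fun x => simulation_spec hc hR h0 h1 hS (hf x)
  obtain ⟨good, hvar, hone, hob, hbf, hm, -, -, -⟩ := spec fun _ => false
  have hold : ∀ x, ∀ a < m + 2 + n, mem3 x a = setBlock (fun _ => false) (m + 2) x a :=
    fun x => (spec x).2.2.2.2.2.2.1
  have htrue : ∀ x, mem3 x (σ3 vOne) = true := fun x => (spec x).2.2.2.2.2.2.2.1
  have hval : ∀ x, ∀ j < m, mem3 x (σ3 vBase + σ3 vSize + j) = bitsOf (f x) j :=
    fun x => (spec x).2.2.2.2.2.2.2.2
  clear spec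
  simp only [← hσ1, ← hs, ← hσ3] at good hvar hone hob hbf hm
  have a0 : σ1 0 = n := by simp [σ1, superpose_vars, h0]
  have a1 : σ1 1 = m := by simp [σ1, superpose_vars, h1]
  have a9 : σ1 vX = m + 2 := by simp [σ1, superpose_vars, h1]
  have b0 : σ3 0 = n := by rw [hvar 0 (by simp), a0]
  have b1 : σ3 1 = m := by rw [hvar 1 (by simp), a1]
  have b9 : σ3 vX = m + 2 := by rw [hvar vX (by simp), a9]
  have c4 : ∀ v, v ≠ vB → σ4 v = σ3 v := fun v hv => by rw [hσ4, superposeB_vars]; simp [hv]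
  have cB : σ4 vB = m + 1 := by rw [hσ4, superposeB_vars]; simp [b1]
  have hH : (Stmt.generator c R).vars σ vFresh = σ3 vFresh := by
    change Stmt.deliver.vars σ4 vFresh = _
    rw [deliver_vars_fresh, c4 _ (by omega)]
  have hG : (Stmt.generator c R).gates σ = Stmt.superpose.gates σ ++ (s.gates σ1 ++
      (Stmt.superposeB.gates σ3 ++ Stmt.deliver.gates σ4)) := by
    simp only [Stmt.generator, Stmt.gates, Stmt.vars, hs, List.append_assoc, hσ1, hσ3, hσ4]
  have d0 : σ4 0 = n := by rw [c4 _ (by omega), b0]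
  have d1 : σ4 1 = m := by rw [c4 _ (by omega), b1]
  have d2 := c4 vSize (by omega)
  have d4 := c4 vBase (by omega)
  have d5 := c4 vOne (by omega)
  have d9 : σ4 vX = m + 2 := by rw [c4 _ (by omega), b9]
  have good5 : ∀ g ∈ Stmt.deliver.gates σ4, g.Good (σ3 vFresh) :=
    deliver_good (by omega) (by omega) (by omega) (by omega) (by omega) (by omega) (by omega)
  rw [hH, hG]
  -- The final memory: simulation on x, then bit `b` on the wire of `B`, then delivery. As the
  -- simulation precedes the choice of `b` and delivery only writes on `R`, the wires of `H` do not
  -- depend on `b`.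
  refine ⟨?_, by omega, fun x b =>
    evalGates (Stmt.deliver.gates σ4) (Function.update (mem3 x) (m + 1) b), ?_, ?_⟩
  · intro g hg
    simp only [List.mem_append] at hg
    rcases hg with hg | hg | hg | hg
    · rw [superpose_gates] at hg
      simp only [List.mem_map, List.mem_range] at hg
      obtain ⟨i, hi, rfl⟩ := hg
      simp only [WGate.Valid]; omega
    · exact (good g hg).valid
    · rw [superposeB_gates, List.mem_singleton] at hg
      subst hg
      simp only [WGate.Valid]; omega
    · exact (good5 g hg).valid
  · intro W hW
    rw [superpose_gates, h0, h1, toCircuit_append, runCircuit_append,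
      runCircuit_hadBlock n (by omega) (fun _ _ => rfl), ← circuitLin_apply, map_smul, map_sum,
      pow_succ, mul_smul, Finset.smul_sum (r := 1 / (Real.sqrt 2 : ℂ))]
    congr 1
    refine Finset.sum_congr rfl fun x _ => ?_
    rw [circuitLin_apply, toCircuit_append, runCircuit_append,
      runCircuit_toCircuit (fun g hg => (good g hg).mono hW), toCircuit_append, runCircuit_append,
      superposeB_gates, b1, runCircuit_had (by omega), ← circuitLin_apply, map_smul, map_sum]
    · congr 1
      refine Finset.sum_congr rfl fun b _ => ?_
      rw [circuitLin_apply, runCircuit_toCircuit (fun g hg => (good5 g hg).mono hW)]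
    · change mem3 x (m + 1) = false
      rw [hold x _ (by omega), setBlock_apply, if_neg (by omega)]
  · have key : ∀ x b, evalGates (Stmt.deliver.gates σ4) (Function.update (mem3 x) (m + 1) b) =
        fun a => if a < m then (if a < n then bitsOf x a ^^ (b && bitsOf x a) else false) ^^
            (b && bitsOf (f x) a)
          else if a = m then b else Function.update (mem3 x) (m + 1) b a := by
      intro x b
      rw [deliver_spec (by omega) (by omega) (by omega) (by omega) (by omega), d0, d1]
      · funext a
        simp only [Function.update_self]
        by_cases ha : a < m
        · rw [if_pos ha, if_pos ha, d4, d2, Function.update_of_ne (by omega),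
            Function.update_of_ne (by omega), hval x a ha]
          by_cases ha' : a < n
          · rw [if_pos ha', if_pos ha', hold x _ (by omega), setBlock_apply, if_pos (by omega),
              Nat.add_sub_cancel_left]
          · rw [if_neg ha', if_neg ha']
        · rw [if_neg ha, if_neg ha]
      · rw [d5, Function.update_of_ne (by omega), htrue]
      · intro a ha
        rw [d1] at ha
        rw [Function.update_of_ne (by omega), hold x _ (by omega), setBlock_apply,
          if_neg (by omega)]
    have hbits : ∀ (x : Fin n → Bool) j, ¬ j < n → bitsOf x j = false := by
      intro x j hj; simp [bitsOf, hj]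
    refine ⟨?_, ?_, ?_, ?_, ?_⟩
    · intro x b j hj
      simp only [key, hj, if_true]
      by_cases hj' : j < n
      · cases b <;> simp [hj']
      · cases b <;> simp [hj', hbits]
    · intro x b
      simp [key]
    · intro x b
      simp [key]
    · intro x b i hi
      simp only [key]
      rw [if_neg (by omega), if_neg (by omega), Function.update_of_ne (by omega),
        hold x _ (by omega), setBlock_apply, if_pos (by omega), Nat.add_sub_cancel_left]
    · intro x b a ha
      simp only [key]
      rw [if_neg (by omega), if_neg (by omega), Function.update_of_ne (by omega),
        if_neg (by omega), if_neg (by omega), Function.update_of_ne (by omega)]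

/-- The generated circuit as an input of the decoding task. -/
noncomputable abbrev generatorInstance (c : Prog) (R m : ℕ) (σ : ℕ → ℕ) : Instance where
  k := m
  -- This is more than is needed: the circuit uses wires below `vFresh`, while there are m + 2 +
  -- `vFresh` of them. The surplus wires stay 0, and no subtraction is required.
  h := (Stmt.generator c R).vars σ vFresh
  circuit := toCircuit _ ((Stmt.generator c R).gates σ)

/-- The strings in register `R` for a function. -/
def branches {n m : ℕ} (f : (Fin n → Bool) → Fin m → Bool) (b : Bool) (x : Fin n → Bool) :
    Fin (m + 1) → Bool :=
  Fin.snoc (α := fun _ => Bool) (if b then f x else padZeros m x) b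

theorem ketOf_append_snoc {m h : ℕ} (μ : ℕ → Bool) (z : Fin (m + 1) → Bool) (b : Bool)
    (y : Fin h → Bool) : ketOf (m + 1 + 1 + h) μ (Fin.append (Fin.snoc (α := fun _ => Bool) z b) y) =
      if (z = fun i : Fin (m + 1) => μ i) ∧ b = μ (m + 1) ∧ y = fun i : Fin h => μ (m + 2 + i)
      then 1 else 0 := by
  rw [ketOf, ket_apply]
  congr 1
  refine propext ⟨fun e => ⟨?_, ?_, ?_⟩, ?_⟩
  · funext i
    have := congrFun e (Fin.castAdd h (Fin.castSucc i))
    simpa using this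
  · have := congrFun e (Fin.castAdd h (Fin.last _))
    simpa using this
  · funext i
    have := congrFun e (Fin.natAdd (m + 1 + 1) i)
    simpa using this
  · rintro ⟨rfl, rfl, rfl⟩
    funext i
    refine Fin.addCases (fun j => ?_) (fun j => ?_) i
    · rw [Fin.append_left]
      refine Fin.lastCases ?_ (fun l => ?_) j
      · simp
      · simp
    · simp

/-- `H` ends with the argument and the garbage of the simulation. Together they are the same for
both values of `B` and determine x, which is all that is asked of γ; no uncomputation takes place.
-/
theorem isBranchState_generatorInstance {c : Prog} {R : ℕ} (hc : c.regBound ≤ R) (hR : 1 ≤ R)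
    {n m : ℕ} (hnm : n ≤ m) {σ : ℕ → ℕ} (h0 : σ 0 = n) (h1 : σ 1 = m) {T : ℕ}
    (hS : n + T + 1 ≤ σ vSize) {f : (Fin n → Bool) → Fin m → Bool}
    (hf : ∀ x, OutputsWithin c (List.ofFn x) T (List.ofFn (f x))) :
    ∃ γ, IsBranchState (generatorInstance c R m σ).state (branches f) γ := by
  obtain ⟨-, hH, mem, hrun, hlow, hm, hm1, hmx, hhigh⟩ := generator_spec hc hR hnm h0 h1 hS hf
  refine ⟨fun x i => mem x false (m + 2 + i), fun x x' e => ?_, fun z b y => ?_⟩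
  · funext i
    have hi : i.val < (Stmt.generator c R).vars σ vFresh := by omega
    have := congrFun e ⟨i, hi⟩
    simp only [hmx _ _ i i.2, bitsOf, i.2, dif_pos] at this
    exact this
  · have hamp : (1 / (Real.sqrt 2 : ℂ)) ^ (n + 1) = 1 / (Real.sqrt (2 ^ (n + 1)) : ℂ) := by
      rw [one_div_pow, ← Complex.ofReal_pow]
      congr 2
      rw [eq_comm, Real.sqrt_eq_iff_mul_self_eq (by positivity) (by positivity)]
      rw [← mul_pow, Real.mul_self_sqrt (by norm_num)]
    have key : ∀ (z : Fin (m + 1) → Bool) (y : Fin ((Stmt.generator c R).vars σ vFresh) → Bool),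
        runCircuit (toCircuit (m + 1 + 1 + (Stmt.generator c R).vars σ vFresh)
          ((Stmt.generator c R).gates σ)) (ketOf _ fun _ => false)
          (Fin.append (Fin.snoc (α := fun _ => Bool) z b) y) =
        (1 / (Real.sqrt (2 ^ (n + 1)) : ℂ)) * ∑ x, if y = fun i : Fin _ => mem x false (m + 2 + i) then
          ket (branches f b x) z else 0 := ?_
    · exact key z y
    clear z y
    intro z y
    rw [hrun _ (by omega)]
    rw [Pi.smul_apply, Finset.sum_apply, smul_eq_mul, hamp]
    congr 1
    refine Finset.sum_congr rfl fun x _ => ?_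
    -- The wire m + 1 of `B` carries the branch, so only the branch `b` contributes to an amplitude
    -- with that value of `B`.
    rw [Finset.sum_apply, Finset.sum_eq_single b]
    · rw [ketOf_append_snoc, hm1]
      have hz : (fun i : Fin (m + 1) => mem x b i) = branches f b x := by
        funext i
        refine Fin.lastCases ?_ (fun j => ?_) i
        · simp [branches, hm]
        · simp only [branches, Fin.snoc_castSucc, Fin.val_castSucc, hlow x b j j.2]
          cases b <;> simp [bitsOf, padZeros, firstBits]
      have hy : (fun i : Fin ((Stmt.generator c R).vars σ vFresh) => mem x b (m + 2 + i)) =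
          fun i : Fin _ => mem x false (m + 2 + i) := by
        funext i
        exact hhigh x b _ (by omega)
      rw [hz, hy, ket_apply]
      by_cases h1 : y = fun i : Fin _ => mem x false (m + 2 + i)
      · by_cases h2 : z = branches f b x <;> simp [h1, h2]
      · simp [h1]
    · intro b' _ hb
      rw [ketOf_append_snoc, hm1, if_neg]
      rintro ⟨-, rfl, -⟩
      exact hb rfl
    · simp

theorem branches_injective {n m : ℕ} (hnm : n ≤ m) {f : (Fin n → Bool) → Fin m → Bool}
    (hinj : Function.Injective f) :
    Function.Injective fun p : Bool × (Fin n → Bool) => branches f p.1 p.2 := by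
  rintro ⟨b, x⟩ ⟨b', x'⟩ e
  obtain ⟨e1, rfl⟩ := Fin.snoc_injective2 e
  cases b
  · have : x = x' := by
      funext i
      have := congrFun e1 ⟨i, by omega⟩
      simpa [padZeros, firstBits] using this
    rw [this]
  · have : x = x' := hinj (by simpa using e1)
    rw [this]

theorem promise_generatorInstance {c : Prog} {R : ℕ} (hc : c.regBound ≤ R) (hR : 1 ≤ R)
    {n m : ℕ} (hnm : n ≤ m) {σ : ℕ → ℕ} (h0 : σ 0 = n) (h1 : σ 1 = m) {T : ℕ}
    (hS : n + T + 1 ≤ σ vSize) {f : (Fin n → Bool) → Fin m → Bool} (hinj : Function.Injective f)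
    (hf : ∀ x, OutputsWithin c (List.ofFn x) T (List.ofFn (f x))) :
    (generatorInstance c R m σ).Promise := by
  obtain ⟨γ, h⟩ := isBranchState_generatorInstance hc hR hnm h0 h1 hS hf
  exact h.distills (branches_injective hnm hinj) hnm

/-- Connects the text printed by the machine with the mathematical instance: all gates are valid, so
none is dropped when the numbered wires are turned into qubits. -/
theorem encode_generatorInstance {c : Prog} {R : ℕ} (hc : c.regBound ≤ R) (hR : 1 ≤ R)
    {n m : ℕ} (hnm : n ≤ m) {σ : ℕ → ℕ} (h0 : σ 0 = n) (h1 : σ 1 = m) {T : ℕ}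
    (hS : n + T + 1 ≤ σ vSize) {f : (Fin n → Bool) → Fin m → Bool}
    (hf : ∀ x, OutputsWithin c (List.ofFn x) T (List.ofFn (f x))) :
    (generatorInstance c R m σ).encode = encNat m ++
      encNat ((Stmt.generator c R).vars σ vFresh) ++ encGates ((Stmt.generator c R).gates σ) := by
  obtain ⟨hv, -⟩ := generator_spec hc hR hnm h0 h1 hS hf
  rw [Instance.encode, encCircuit_toCircuit fun g hg =>
    (hv g hg).mono (show _ ≤ m + 1 + 1 + _ by omega)]

end HarlowHayden


namespace HarlowHayden

open Polynomial

/-! ### The machine that writes down the input of the decoder -/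

theorem Stmt.iter_inc_vars (v c : ℕ) (σ : ℕ → ℕ) :
    ((Stmt.inc v).iter c).vars σ = Function.update σ v (σ v + c) := by
  rw [Stmt.iter_vars]
  exact Stmt.iterate_inc v c σ

theorem Stmt.wf_iter {P : Set ℕ} {s : Stmt} (h : s.Wf P) (c : ℕ) : (s.iter c).Wf P := by
  induction c with
  | zero => trivial
  | succ c ih => exact ⟨h, ih⟩

/-- Polynomials of variable `0` can be evaluated. -/
theorem exists_addPoly (Q : ℕ[X]) {v : ℕ} (hv : v ≠ 0) : ∃ s : Stmt, s.Wf {0} ∧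
    (∀ σ, s.vars σ = Function.update σ v (σ v + Q.eval (σ 0))) ∧ ∀ σ, s.gates σ = [] := by
  induction Q using Polynomial.induction_on' with
  | add p q hp hq =>
    obtain ⟨s, h1, h2, h3⟩ := hp
    obtain ⟨s', h1', h2', h3'⟩ := hq
    refine ⟨.seq s s', ⟨h1, h1'⟩, fun σ => ?_, fun σ => by simp [Stmt.gates, h3, h3']⟩
    simp [Stmt.vars, h2, h2', hv.symm, add_assoc]
  | monomial k c =>
    induction k with
    | zero =>
      refine ⟨(Stmt.inc v).iter c, Stmt.wf_iter (by simpa [Stmt.Wf] using hv) c, fun σ => ?_,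
        fun σ => ?_⟩
      · simp [Stmt.iter_inc_vars]
      · simp [Stmt.iter_gates, Stmt.gates]
    | succ k ih =>
      obtain ⟨s, h1, h2, h3⟩ := ih
      -- Adding the monomial of degree k as many times as variable `0` says adds the monomial of
      -- degree k + 1.
      refine ⟨.rep 0 s, ⟨rfl, h1⟩, fun σ => ?_, fun σ => by simp [Stmt.gates, h3]⟩
      have key : ∀ i, s.vars^[i] σ = Function.update σ v (σ v + i * (c * σ 0 ^ k)) := by
        intro i
        induction i with
        | zero => simp
        | succ i ih =>
          rw [Function.iterate_succ_apply', ih, h2]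
          simp [hv.symm, add_assoc, Nat.succ_mul]
      simp only [Stmt.vars, key, eval_monomial]
      congr 2
      ring

/-- The values of the parameters of the generator. -/
def parameters (p S : ℕ[X]) (n : ℕ) : ℕ → ℕ :=
  Function.update (Function.update (Function.update (fun _ => 0) 0 n) 1 (p.eval n)) 2 (S.eval n)

theorem mkStore_inputStore {B : ℕ} (hB : 1 ≤ B) (l : List Bool) :
    mkStore B (inputStore l) [] (fun _ => 0) (fun _ => 0) = inputStore l := by
  apply store_ext B
  · intro q hq; rw [mkStore_lt hq]
  · simp [inputStore, show B ≠ 0 by omega]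
  · intro v; rw [mkStore_var]; simp [inputStore, varReg]
  · intro v; rw [mkStore_ctr]; simp [inputStore, ctrReg]

theorem update_inputStore (l l' : List Bool) :
    Function.update (inputStore l) 0 l' = inputStore l' := by
  funext r
  by_cases hr : r = 0
  · subst hr; simp [inputStore]
  · simp [inputStore, hr]

/-- On input 1ⁿ the machine computes the parameters, prints the generated circuit, and only then
pushes the two sizes in front of it, because the number of qubits of `H` is known when the generator
has finished. The variables stay in the registers above `B`, from where the rewriting of the decoder
later takes m. -/
theorem exists_encoder (c : Prog) (R : ℕ) (p S : ℕ[X]) {B : ℕ} (hB : 1 ≤ B) :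
    ∃ (q : Prog) (T : ℕ[X]), ∀ n : ℕ,
      (∀ v, (Stmt.generator c R).vars (parameters p S n) v ≤ T.eval n) ∧
      Exec q (T.eval n) (inputStore (List.replicate n true)) (mkStore B
        (inputStore (encNat (p.eval n) ++
          encNat ((Stmt.generator c R).vars (parameters p S n) vFresh) ++
          encGates ((Stmt.generator c R).gates (parameters p S n)))) []
        ((Stmt.generator c R).vars (parameters p S n)) fun _ => 0) := by
  obtain ⟨s1, w1, v1, g1⟩ := exists_addPoly p (v := 1) (by omega)
  obtain ⟨s2, w2, v2, g2⟩ := exists_addPoly S (v := 2) (by omega)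
  obtain ⟨Ga, Ta, ha⟩ := Stmt.exec_compile B {0} (.seq s1 s2) ⟨w1, w2⟩
  obtain ⟨Gb, Tb, hb⟩ := Stmt.exec_compile B params (Stmt.generator c R) (Stmt.wf_generator c R)
  set N : ℕ[X] := X + p + S with hN
  refine ⟨.seq (moveReg 0 (varReg B 0)) (.seq ((Stmt.seq s1 s2).compile B 1)
    (.seq ((Stmt.generator c R).compile B 1) (.seq (moveReg B 0)
      (.seq (pushVar B 0 vFresh) (pushVar B 0 1))))),
    (4 * X + 1) + (Ta.comp (X + X) + (Tb.comp (N + N) + (4 * Tb.comp (N + N) + 1 +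
      ((9 * (N + Gb.comp N) + 3) + (9 * (N + Gb.comp N) + 3))))), fun n => ?_⟩
  set σ0 := parameters p S n with hσ0
  have e0 : σ0 0 = n := by simp [hσ0, parameters]
  have e1 : σ0 1 = p.eval n := by simp [hσ0, parameters]
  have e2 : σ0 2 = S.eval n := by simp [hσ0, parameters]
  have eN : N.eval n = n + p.eval n + S.eval n := by simp [hN]
  have hle : ∀ v, σ0 v ≤ N.eval n := by
    intro v
    by_cases h2 : v = 2
    · subst h2; omega
    · by_cases h1 : v = 1
      · subst h1; omega
      · by_cases h0 : v = 0
        · subst h0; omega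
        · simp [hσ0, parameters, h0, h1, h2]
  have x1 : Exec (moveReg 0 (varReg B 0)) (4 * n + 1) (inputStore (List.replicate n true))
      (mkStore B (inputStore []) [] (Function.update (fun _ => 0) 0 n) fun _ => 0) := by
    refine (exec_moveReg (ne_varReg (show 0 < B by omega)) _).congr ?_ (by simp [inputStore])
    rw [← mkStore_update_var, mkStore_inputStore hB]
    have : inputStore [] = Function.update (inputStore (List.replicate n true)) 0 [] := by
      rw [update_inputStore]
    rw [this]
    congr 1
    simp [inputStore, varReg]
  have hvars : (Stmt.seq s1 s2).vars (Function.update (fun _ => 0) 0 n) = σ0 := by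
    simp [Stmt.vars, v1, v2, hσ0, parameters]
  have hgates : (Stmt.seq s1 s2).gates (Function.update (fun _ => 0) 0 n) = [] := by
    simp [Stmt.gates, g1, g2]
  have x2 := (ha (inputStore []) [] (Function.update (fun _ => 0) 0 n) (fun _ => 0) 1 n n
    (by rintro q rfl; simp) (fun v => by
      by_cases hv : v = 0
      · subst hv; simp
      · simp [hv]) le_rfl rfl (fun _ _ => rfl)).2
  rw [hvars, hgates, encGates_nil, List.reverse_nil, List.nil_append] at x2
  obtain ⟨hv3, x3⟩ := hb (inputStore []) [] σ0 (fun _ => 0) 1 (N.eval n) (N.eval n)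
    (fun q _ => hle q) hle le_rfl rfl (fun _ _ => rfl)
  set σ' := (Stmt.generator c R).vars σ0 with hσ'
  set gs := (Stmt.generator c R).gates σ0 with hgs
  -- The printed text is no longer than the time spent on printing it.
  have hlen : (encGates gs).length ≤ Tb.eval (N.eval n + N.eval n) := by
    obtain ⟨t, ht, hr⟩ := x3
    have := hr.length_le B
    simp at this
    omega
  have hσ1 : σ' 1 = p.eval n := by
    rw [hσ', (Stmt.wf_generator c R).vars_eq (by simp [params]), e1]
  -- Moving the text reverses it, which undoes the backwards order on the output stack.
  have x4 : Exec (moveReg B 0) (4 * Tb.eval (N.eval n + N.eval n) + 1)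
      (mkStore B (inputStore []) ((encGates gs).reverse ++ []) σ' fun _ => 0)
      (mkStore B (inputStore (encGates gs)) [] σ' fun _ => 0) := by
    refine (exec_moveReg (by omega) _).congr ?_ (by simpa using hlen)
    rw [mkStore_update_out, mkStore_update_lt (by omega), update_inputStore]
    simp [mkStore_lt (show 0 < B by omega), inputStore]
  have x5 := exec_pushVar (B := B) (rest := inputStore (encGates gs)) (out := []) (σ := σ')
    (κ := fun _ => 0) rfl (show 0 < B by omega) vFresh
  rw [update_inputStore] at x5
  have x6 := exec_pushVar (B := B) (rest := inputStore (encNat (σ' vFresh) ++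
    inputStore (encGates gs) 0)) (out := []) (σ := σ')
    (κ := fun _ => 0) rfl (show 0 < B by omega) 1
  rw [update_inputStore] at x6
  refine ⟨fun v => (hv3 v).trans ?_, ?_⟩
  · simp only [eval_add, eval_mul, eval_comp, eval_X, eval_ofNat, eval_one]
    omega
  · have h5 := hv3 vFresh
    have h6 := hv3 1
    refine (x1.seq (x2.seq (x3.seq (x4.seq (x5.seq x6))))).congr ?_ ?_
    · simp [hσ1, inputStore]
    · simp only [eval_add, eval_mul, eval_comp, eval_X, eval_ofNat, eval_one]
      omega

end HarlowHayden


namespace HarlowHayden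

open Polynomial

/-! ### The machine that turns a decoder into an inverter -/

theorem Exec.length_le {p : Prog} {T : ℕ} {s s' : Store} (h : Exec p T s s') (r : ℕ) :
    (s' r).length ≤ (s r).length + T := by
  obtain ⟨t, ht, h⟩ := h
  have := h.length_le r
  omega

/-! ### Parsing a circuit and stacking up its inverse -/

section parse

variable {B F I : ℕ} {rest : Store} {out : List Bool} {σ κ : ℕ → ℕ}

/-- Read a number from register `0` into a variable; register `F` is a flag. -/
def readTok (B F v : ℕ) : Prog :=
  .seq (zeroVar B v) (.seq (.push F true) (.loop F (.branch 0 (.pop F)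
    (.seq (.pop 0) (.pop F)) (.seq (.pop 0) (.push (varReg B v) true)))))

theorem encNat_succ (k : ℕ) : encNat (k + 1) = true :: encNat k := rfl

/-- The flag stays set while ones are read, and the terminating zero removes it; this ends the loop
although register 0 is not yet empty. -/
theorem exec_readTok_loop (hF : F < B) (hF0 : F ≠ 0) (v k : ℕ) {l : List Bool}
    (h0 : rest 0 = encNat k ++ l) (hf : rest F = [true]) :
    Exec (.loop F (.branch 0 (.pop F) (.seq (.pop 0) (.pop F))
        (.seq (.pop 0) (.push (varReg B v) true)))) (5 * k + 5) (mkStore B rest out σ κ)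
      (mkStore B (Function.update (Function.update rest 0 l) F []) out
        (Function.update σ v (σ v + k)) κ) := by
  have hB : 0 < B := by omega
  induction k generalizing rest σ with
  | zero =>
    have h1 := (Exec.pop 0 (mkStore B rest out σ κ)).seq (Exec.pop F _)
    rw [mkStore_update_lt hB, mkStore_update_lt hF, mkStore_lt hB, mkStore_lt hF,
      Function.update_of_ne hF0, hf, h0] at h1
    have h2 := Exec.loop_step (by rw [mkStore_lt hF, hf]; simp)
      (Exec.branch_zero (p := .pop F) (u := .seq (.pop 0) (.push (varReg B v) true))
        (by rw [mkStore_lt hB, h0]; rfl) h1)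
      (Exec.loop_done (by rw [mkStore_lt hF]; simp))
    refine h2.congr ?_ (by omega)
    simp [encNat]
  | succ k ih =>
    have h1 := (Exec.pop 0 (mkStore B rest out σ κ)).seq (Exec.push (varReg B v) true _)
    rw [mkStore_update_lt hB, mkStore_var, ← List.replicate_succ, mkStore_update_var,
      mkStore_lt hB, h0, encNat_succ] at h1
    have h3 := ih (rest := Function.update rest 0 (encNat k ++ l))
      (σ := Function.update σ v (σ v + 1)) (by simp) (by simp [hF0, hf])
    have h2 := Exec.loop_step (by rw [mkStore_lt hF, hf]; simp)
      (Exec.branch_one (p := .pop F) (q := .seq (.pop 0) (.pop F))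
        (by rw [mkStore_lt hB, h0]; rfl) h1) h3
    refine h2.congr ?_ (by omega)
    simp [show σ v + 1 + k = σ v + (k + 1) by omega]

theorem exec_readTok (hF : F < B) (hF0 : F ≠ 0) (v k : ℕ) {l : List Bool}
    (h0 : rest 0 = encNat k ++ l) (hf : rest F = []) :
    Exec (readTok B F v) (3 * σ v + 5 * k + 7) (mkStore B rest out σ κ)
      (mkStore B (Function.update rest 0 l) out (Function.update σ v k) κ) := by
  have h2 := Exec.push F true (mkStore B rest out (Function.update σ v 0) κ)
  rw [mkStore_update_lt hF, mkStore_lt hF, hf] at h2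
  have h3 := exec_readTok_loop (B := B) (out := out) (σ := Function.update σ v 0) (κ := κ)
    (rest := Function.update rest F [true]) hF hF0 v k (l := l)
    (by rw [Function.update_of_ne hF0.symm, h0]) (by simp)
  refine ((exec_zeroVar v).seq (h2.seq h3)).congr ?_ (by omega)
  congr 1
  · funext q
    by_cases hq : q = F
    · subst hq; simp [hF0, hf]
    · by_cases hq0 : q = 0
      · subst hq0; simp [hq]
      · simp [hq, hq0]
  · simp

theorem exec_pushCode {r : ℕ} (hr : r < B) (l : List Bool) :
    Exec (pushBits r l.reverse) (l.length + 1) (mkStore B rest out σ κ)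
      (mkStore B (Function.update rest r (l ++ rest r)) out σ κ) := by
  have := exec_pushBits r l.reverse (mkStore B rest out σ κ)
  rwa [mkStore_update_lt hr, mkStore_lt hr, List.reverse_reverse, List.length_reverse] at this

/-- Push the code of a gate with one wire on register `I`. -/
def pushGate (B I c : ℕ) : Prog := .seq (pushVar B I 8) (pushBits I (encNat c).reverse)

theorem exec_pushGate (hI : I < B) (hκ : κ 0 = 0) (c : ℕ) :
    Exec (pushGate B I c) (9 * σ 8 + c + 5) (mkStore B rest out σ κ)
      (mkStore B (Function.update rest I (encNat c ++ encNat (σ 8) ++ rest I)) out σ κ) :=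
  ((exec_pushVar hκ hI 8).seq (exec_pushCode hI (encNat c))).congr (by simp) (by simp; omega)

/-- Read a gate, print it, and push its inverse on register `I`. -/
def parseGate (B F I : ℕ) : Prog :=
  -- The three kinds of gates start with the codes 0, 10 and 110, so at most two bits have to be
  -- tested. The inverse of a phase gate is three phase gates, and operands of a Toffoli gate are
  -- pushed last to first so that they can be read from the top.
  .branch 0 .skip
    (.seq (.pop 0) (.seq (readTok B F 8) (.seq (emitGate B (.had 8)) (pushGate B I 0))))
    (.seq (.pop 0) (.branch 0 .skip
      (.seq (.pop 0) (.seq (readTok B F 8) (.seq (emitGate B (.phase 8))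
        (.seq (pushGate B I 1) (.seq (pushGate B I 1) (pushGate B I 1))))))
      (.seq (.pop 0) (.seq (.pop 0) (.seq (readTok B F 8) (.seq (readTok B F 9)
        (.seq (readTok B F 10) (.seq (emitGate B (.tof 8 9 10)) (.seq (pushVar B I 10)
          (.seq (pushVar B I 9) (.seq (pushVar B I 8) (pushBits I (encNat 2).reverse))))))))))))

theorem exec_pop_zero (hB : 0 < B) {b : Bool} {l : List Bool} (h0 : rest 0 = b :: l) :
    Exec (.pop 0) 1 (mkStore B rest out σ κ) (mkStore B (Function.update rest 0 l) out σ κ) := by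
  have := Exec.pop 0 (mkStore B rest out σ κ)
  rwa [mkStore_update_lt hB, mkStore_lt hB, h0] at this

theorem exec_parseGate (hF : F < B) (hI : I < B) (hF0 : F ≠ 0) (hI0 : I ≠ 0)
    (hκ : κ 0 = 0) {w V : ℕ} (hw : w ≤ V) (hV : ∀ v, σ v ≤ V) (g : Gate w) {l : List Bool}
    (h0 : rest 0 = g.encode ++ l) (hf : rest F = []) :
    ∃ σ', (∀ v, v < 8 → σ' v = σ v) ∧ (∀ v, σ' v ≤ V) ∧
      Exec (parseGate B F I) (200 * (V + 1)) (mkStore B rest out σ κ)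
        (mkStore B (Function.update (Function.update rest 0 l) I
          (encCircuit g.inverse ++ rest I)) (g.encode.reverse ++ out) σ' κ) := by
  have hB : 0 < B := by omega
  have hVu : ∀ {σ : ℕ → ℕ}, (∀ v, σ v ≤ V) → ∀ (u : ℕ) (i : Fin w) v,
      Function.update σ u (i : ℕ) v ≤ V := by
    intro σ hσ u i v
    by_cases h : v = u
    · subst h; simp; omega
    · simpa [h] using hσ v
  have v8 := hV 8
  have v9 := hV 9
  have v10 := hV 10
  cases g with
  | had i =>
    have e0 : rest 0 = false :: (encNat i ++ l) := by rw [h0]; rfl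
    have x1 := exec_pop_zero (out := out) (σ := σ) (κ := κ) hB e0
    have x2 := exec_readTok (B := B) (rest := Function.update rest 0 (encNat i ++ l)) (out := out)
      (σ := σ) (κ := κ) hF hF0 8 i (l := l) (by simp) (by simp [hF0, hf])
    rw [Function.update_idem] at x2
    have x3 := exec_emitGate (B := B) (rest := Function.update rest 0 l) (out := out) hκ
      (hVu hV 8 i) (.had 8)
    have x4 := exec_pushGate (B := B) (I := I) (rest := Function.update rest 0 l)
      (out := ((WGate.had 8).map (Function.update σ 8 i)).encode.reverse ++ out)
      (σ := Function.update σ 8 i) hI hκ 0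
    refine ⟨Function.update σ 8 i, fun v hv => Function.update_of_ne (by omega) _ _, hVu hV 8 i, ?_⟩
    refine (Exec.branch_zero (by rw [mkStore_lt hB, e0]; rfl)
      (x1.seq (x2.seq (x3.seq x4)))).congr ?_ ?_
    · simp [WGate.map, WGate.encode, Gate.encode, Gate.inverse, encCircuit, hI0]
    · rw [Function.update_self]; omega
  | phase i =>
    have e0 : rest 0 = true :: (false :: (encNat i ++ l)) := by rw [h0]; rfl
    have x0 := exec_pop_zero (out := out) (σ := σ) (κ := κ) hB e0
    have x1 := exec_pop_zero (B := B) (rest := Function.update rest 0 (false :: (encNat i ++ l)))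
      (out := out) (σ := σ) (κ := κ) hB (Function.update_self ..)
    rw [Function.update_idem] at x1
    have x2 := exec_readTok (B := B) (rest := Function.update rest 0 (encNat i ++ l)) (out := out)
      (σ := σ) (κ := κ) hF hF0 8 i (l := l) (by simp) (by simp [hF0, hf])
    rw [Function.update_idem] at x2
    have x3 := exec_emitGate (B := B) (rest := Function.update rest 0 l) (out := out) hκ
      (hVu hV 8 i) (.phase 8)
    have x4 := fun rest => exec_pushGate (B := B) (I := I) (rest := rest)
      (out := ((WGate.phase 8).map (Function.update σ 8 i)).encode.reverse ++ out)
      (σ := Function.update σ 8 i) hI hκ 1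
    refine ⟨Function.update σ 8 i, fun v hv => Function.update_of_ne (by omega) _ _, hVu hV 8 i, ?_⟩
    refine (Exec.branch_one (by rw [mkStore_lt hB, e0]; rfl) (x0.seq
      (Exec.branch_zero (by rw [mkStore_lt hB, Function.update_self]; rfl)
      (x1.seq (x2.seq (x3.seq ((x4 _).seq ((x4 _).seq (x4 _))))))))).congr ?_ ?_
    · simp [WGate.map, WGate.encode, Gate.encode, Gate.inverse, encCircuit, hI0]
    · rw [Function.update_self]; omega
  | toffoli i j k hij hik hjk =>
    have e0 : rest 0 = true :: (true :: (false :: (encNat i ++ (encNat j ++ (encNat k ++ l))))) := by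
      rw [h0]; simp [Gate.encode, encNat]
    have x0 := exec_pop_zero (out := out) (σ := σ) (κ := κ) hB e0
    have x1 := fun (b : Bool) (l : List Bool) => exec_pop_zero (B := B)
      (rest := Function.update rest 0 (b :: l))
      (out := out) (σ := σ) (κ := κ) hB (Function.update_self ..)
    simp only [Function.update_idem] at x1
    have x2 := fun (σ : ℕ → ℕ) (v k : ℕ) (l : List Bool) => exec_readTok (B := B)
      (rest := Function.update rest 0 (encNat k ++ l)) (out := out)
      (σ := σ) (κ := κ) hF hF0 v k (l := l) (by simp) (by simp [hF0, hf])
    simp only [Function.update_idem] at x2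
    set σ1 := Function.update σ 8 (i : ℕ) with hσ1
    set σ2 := Function.update σ1 9 (j : ℕ) with hσ2
    set σ3 := Function.update σ2 10 (k : ℕ) with hσ3
    have V1 : ∀ v, σ1 v ≤ V := hVu hV 8 i
    have V2 : ∀ v, σ2 v ≤ V := hVu V1 9 j
    have V3 : ∀ v, σ3 v ≤ V := hVu V2 10 k
    have x3 := exec_emitGate (B := B) (rest := Function.update rest 0 l) (out := out) hκ
      V3 (.tof 8 9 10)
    set out' := ((WGate.tof 8 9 10).map σ3).encode.reverse ++ out with hout'
    have x4 := fun (rest : Store) (v : ℕ) => exec_pushVar (B := B) (rest := rest) (out := out')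
      (σ := σ3) hκ hI v
    have x5 := fun (rest : Store) => exec_pushCode (B := B) (rest := rest) (out := out')
      (σ := σ3) (κ := κ) hI (encNat 2)
    have s8 : σ3 8 = i := by simp [hσ3, hσ2, hσ1]
    have s9 : σ3 9 = j := by simp [hσ3, hσ2]
    have s10 : σ3 10 = k := by simp [hσ3]
    have b9 := V1 9
    have b10 := V2 10
    refine ⟨σ3, fun v hv => ?_, V3, ?_⟩
    · rw [hσ3, Function.update_of_ne (by omega), hσ2, Function.update_of_ne (by omega), hσ1,
        Function.update_of_ne (by omega)]
    refine (Exec.branch_one (by rw [mkStore_lt hB, e0]; rfl) (x0.seq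
      (Exec.branch_one (by rw [mkStore_lt hB, Function.update_self]; rfl)
      ((x1 _ _).seq ((x1 _ _).seq ((x2 σ 8 i _).seq ((x2 σ1 9 j _).seq ((x2 σ2 10 k _).seq
        (x3.seq ((x4 _ 10).seq ((x4 _ 9).seq ((x4 _ 8).seq (x5 _))))))))))))).congr ?_ ?_
    · simp [hout', WGate.map, WGate.encode, Gate.encode, Gate.inverse, encCircuit, hI0, s8, s9, s10]
    · rw [s8, s9, s10, length_encNat]; omega

/-- Gates are read in order but their inverses are stacked, so the inverse of the last gate ends on
top: the stack reads as the description of the inverse circuit, with no separate reversal. -/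
theorem exec_parse (hF : F < B) (hI : I < B) (hF0 : F ≠ 0) (hI0 : I ≠ 0) (hFI : F ≠ I)
    (hκ : κ 0 = 0) {w V : ℕ} (hw : w ≤ V) (hV : ∀ v, σ v ≤ V) (gs : List (Gate w))
    (h0 : rest 0 = encCircuit gs) (hf : rest F = []) :
    ∃ σ', (∀ v, v < 8 → σ' v = σ v) ∧ (∀ v, σ' v ≤ V) ∧
      Exec (.loop 0 (parseGate B F I)) (gs.length * (200 * (V + 1) + 1) + 1)
        (mkStore B rest out σ κ)
        (mkStore B (Function.update (Function.update rest 0 []) I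
          (encCircuit (inverseCircuit gs) ++ rest I)) ((encCircuit gs).reverse ++ out) σ' κ) := by
  induction gs generalizing rest out σ with
  | nil =>
    have h0' : rest 0 = [] := h0
    refine ⟨σ, fun _ _ => rfl, hV, (Exec.loop_done (by rw [mkStore_lt (by omega), h0'])).congr ?_
      (by simp)⟩
    have : Function.update rest 0 [] = rest := by rw [← h0', Function.update_eq_self]
    simp [this, encCircuit, inverseCircuit]
  | cons g gs ih =>
    have h0' : rest 0 = g.encode ++ encCircuit gs := h0
    obtain ⟨σ1, k1, V1, x1⟩ := exec_parseGate (out := out) hF hI hF0 hI0 hκ hw hV g h0' hf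
    obtain ⟨σ2, k2, V2, x2⟩ := ih (rest := Function.update (Function.update rest 0 (encCircuit gs))
      I (encCircuit g.inverse ++ rest I)) (out := g.encode.reverse ++ out) (σ := σ1) V1
      (by simp [hI0.symm]) (by simp [hFI, hF0, hf])
    refine ⟨σ2, fun v hv => (k2 v hv).trans (k1 v hv), V2, ?_⟩
    refine (Exec.loop_step ?_ x1 x2).congr ?_ ?_
    · rw [mkStore_lt (by omega), h0']
      cases g <;> simp [Gate.encode, encNat]
    · congr 1
      · funext q
        by_cases hq : q = I
        · subst hq; simp [inverseCircuit, encCircuit]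
        · by_cases hq0 : q = 0
          · subst hq0; simp [hq]
          · simp [hq, hq0]
      · simp [encCircuit]
    · simp only [List.length_cons]; ring_nf; omega

end parse

/-- Compute the numbers of the additional wires, and flip the first two of them. -/
def openStmt : Stmt :=
  -- With m in variable `1` and a in variable `3`, the variables `4` to `7` become m (the decoded
  -- qubit), m + 1 + a (a constant 1), m + 2 + a (the wire that receives the decoded bit) and the
  -- number a + 3 of ancillas. The two NOT gates select the branch with last bit 1 and set the
  -- constant.
  .seq (.copy 4 1) (.seq (.copy 5 1) (.seq (.inc 5) (.seq (.rep 3 (.inc 5)) (.seq (.copy 6 5)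
    (.seq (.inc 6) (.seq (.emit (.not 4)) (.seq (.emit (.not 5)) (.seq (.copy 7 3)
      (.seq (.inc 7) (.seq (.inc 7) (.inc 7)))))))))))

/-- Move the decoded bit to the last wire. -/
def midStmt : Stmt := .seq (.emit (.tof 5 4 6)) (.emit (.tof 5 6 4))

/-- Turn the description of a decoder into that of an inverter. -/
def inverterProg (B F I : ℕ) : Prog :=
  .seq (readTok B F 3) (.seq (openStmt.compile B 1) (.seq (.loop 0 (parseGate B F I))
    (.seq (midStmt.compile B 1) (.seq (moveReg I B) (.seq (moveReg B 0) (pushVar B 0 7))))))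

theorem openStmt_vars (σ : ℕ → ℕ) : openStmt.vars σ =
    Function.update (Function.update (Function.update (Function.update σ 4 (σ 1))
      5 (σ 1 + 1 + σ 3)) 6 (σ 1 + 1 + σ 3 + 1)) 7 (σ 3 + 1 + 1 + 1) := by
  simp [openStmt, Stmt.vars, Stmt.iterate_inc]

theorem openStmt_gates (σ : ℕ → ℕ) :
    openStmt.gates σ = [.not (σ 1), .not (σ 1 + 1 + σ 3)] := by
  simp [openStmt, Stmt.vars, Stmt.gates, Stmt.iterate_inc, WGate.map]

/-- One pass over the decoder both prints it and stacks up its inverse, so the inverter can be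
assembled from the two texts. The time bound also controls their lengths, hence the cost of moving
them. -/
theorem exists_inverterProg {B F I : ℕ} (hF : F < B) (hI : I < B) (hF0 : F ≠ 0) (hI0 : I ≠ 0)
    (hFI : F ≠ I) : ∃ T : ℕ[X], ∀ (m a : ℕ) (gs : List (Gate (m + 1 + a))) (rest : Store)
      (σ : ℕ → ℕ) (V : ℕ), rest 0 = encNat a ++ encCircuit gs → rest F = [] → rest I = [] →
      σ 1 = m → (∀ v, σ v ≤ V) → (rest 0).length ≤ V →
      ∃ s', Exec (inverterProg B F I) (T.eval V) (mkStore B rest [] σ fun _ => 0) s' ∧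
        s' 0 = encNat (a + 3) ++ (encGates [.not m, .not (m + 1 + a)] ++ (encCircuit gs ++
          (encGates [.tof (m + 1 + a) m (m + 2 + a), .tof (m + 1 + a) (m + 2 + a) m] ++
            encCircuit (inverseCircuit gs)))) := by
  obtain ⟨G1, T1, h1⟩ := Stmt.exec_compile B {3} openStmt (by simp [openStmt, Stmt.Wf])
  obtain ⟨G2, T2, h2⟩ := Stmt.exec_compile B ∅ midStmt (by simp [midStmt, Stmt.Wf])
  have hB : 0 < B := by omega
  set V2 : ℕ[X] := X + G1 + (X + X + 1) with hV2
  set T5 : ℕ[X] := (8 * X + 7) + (T1.comp (X + X) + ((X * (200 * (V2 + 1) + 1) + 1) +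
    (T2.comp (V2 + V2) + (4 * (X * (200 * (V2 + 1) + 1) + 1) + 1)))) with hT5
  refine ⟨T5 + ((4 * T5 + 1) + (9 * V2 + 3)), fun m a gs rest σ V h0 hf hi hm hV hlen => ?_⟩
  have eV2 : V2.eval V = V + G1.eval V + (V + V + 1) := by simp [hV2]
  have ha : a ≤ V := by rw [h0] at hlen; simp at hlen; omega
  have hgs : gs.length ≤ V := by
    have : gs.length ≤ (encCircuit gs).length := by
      clear h0
      induction gs with
      | nil => simp
      | cons g gs ih =>
        have : 1 ≤ g.encode.length := by cases g <;> simp [Gate.encode] <;> omega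
        simp only [encCircuit, List.flatMap_cons, List.length_append, List.length_cons] at ih ⊢
        omega
    rw [h0] at hlen; simp at hlen; omega
  have v3 := hV 3
  have x1 := exec_readTok (B := B) (out := []) (σ := σ) (κ := fun _ => 0) hF hF0 3 a h0 hf
  set σ1 := Function.update σ 3 a with hσ1
  have V1 : ∀ v, σ1 v ≤ V := by
    intro v
    by_cases hv : v = 3
    · subst hv; simpa [hσ1] using ha
    · simpa [hσ1, hv] using hV v
  have s1 : σ1 1 = m := by simp [hσ1, hm]
  have s3 : σ1 3 = a := by simp [hσ1]
  obtain ⟨k2, x2⟩ := h1 (Function.update rest 0 (encCircuit gs)) [] σ1 (fun _ => 0) 1 V V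
    (fun q _ => V1 q) V1 le_rfl rfl (fun _ _ => rfl)
  have s2e := openStmt_vars σ1
  rw [s1, s3] at s2e
  set σ2 := openStmt.vars σ1 with hσ2
  rw [openStmt_gates, s1, s3, List.append_nil] at x2
  have hmV := hV 1
  obtain ⟨σ3, k3, V3, x3⟩ := exec_parse (B := B) (F := F) (I := I) (κ := fun _ => 0)
    (rest := Function.update rest 0 (encCircuit gs)) (σ := σ2)
    (out := (encGates [.not m, .not (m + 1 + a)]).reverse) hF hI hF0 hI0 hFI rfl
    (w := m + 1 + a) (V := V2.eval V) (by omega) (fun v => (k2 v).trans (by omega)) gs (by simp)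
    (by simp [hF0, hf])
  have t4 : σ3 4 = m := by rw [k3 4 (by omega), s2e]; simp
  have t5 : σ3 5 = m + 1 + a := by rw [k3 5 (by omega), s2e]; simp
  have t6 : σ3 6 = m + 2 + a := by rw [k3 6 (by omega), s2e]; simp; omega
  have t7 : σ3 7 = a + 3 := by rw [k3 7 (by omega), s2e]; simp
  have hgs' : gs.length * (200 * (V2.eval V + 1) + 1) + 1 ≤
      V * (200 * (V2.eval V + 1) + 1) + 1 := by gcongr
  have hinv : (encCircuit (inverseCircuit gs)).length ≤ V * (200 * (V2.eval V + 1) + 1) + 1 := by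
    have := x3.length_le I
    rw [mkStore_lt hI, mkStore_lt hI, Function.update_self, Function.update_of_ne hI0, hi] at this
    simp only [List.append_nil, List.length_nil] at this
    omega
  rw [Function.update_idem, Function.update_of_ne hI0, hi, List.append_nil] at x3
  set rest3 := Function.update (Function.update rest 0 []) I (encCircuit (inverseCircuit gs))
    with hrest3
  set out3 := (encCircuit gs).reverse ++ (encGates [.not m, .not (m + 1 + a)]).reverse
    with hout3
  obtain ⟨-, x4⟩ := h2 rest3 out3 σ3 (fun _ => 0) 1 (V2.eval V) (V2.eval V)
    (fun q _ => V3 q) V3 le_rfl rfl (fun _ _ => rfl)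
  have hmid : midStmt.gates σ3 =
      [.tof (m + 1 + a) m (m + 2 + a), .tof (m + 1 + a) (m + 2 + a) m] := by
    simp [midStmt, Stmt.gates, Stmt.vars, WGate.map, t4, t5, t6]
  have hmid' : midStmt.vars σ3 = σ3 := rfl
  rw [hmid, hmid'] at x4
  -- The inverse is stored in reading order; the move reverses it, as is right for appending to the
  -- backwards output.
  have x5 := exec_moveReg (a := I) (b := B) (by omega) (mkStore B rest3
    ((encGates [.tof (m + 1 + a) m (m + 2 + a), .tof (m + 1 + a) (m + 2 + a) m]).reverse ++ out3)
      σ3 fun _ => 0)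
  rw [mkStore_update_lt hI, mkStore_update_out, mkStore_out, mkStore_lt hI, hrest3,
    Function.update_self, Function.update_idem, ← hrest3] at x5
  have x15 := x1.seq (x2.seq (x3.seq (x4.seq x5)))
  replace x15 := x15.mono (T' := T5.eval V) (by
    simp only [hT5, eval_add, eval_mul, eval_comp, eval_X, eval_ofNat, eval_one]
    omega)
  have hout := x15.length_le B
  rw [mkStore_out, mkStore_out, List.length_nil, Nat.zero_add] at hout
  set out5 := (encCircuit (inverseCircuit gs)).reverse ++ ((encGates
    [.tof (m + 1 + a) m (m + 2 + a), .tof (m + 1 + a) (m + 2 + a) m]).reverse ++ out3) with hout5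
  set rest5 := Function.update (Function.update rest 0 []) I [] with hrest5
  have x6 := exec_moveReg (a := B) (b := 0) (by omega) (mkStore B rest5 out5 σ3 fun _ => 0)
  rw [mkStore_update_out, mkStore_update_lt hB, mkStore_out, mkStore_lt hB] at x6
  have x7 := exec_pushVar (B := B) (rest := Function.update rest5 0 (out5.reverse ++ rest5 0))
    (out := []) (σ := σ3) (κ := fun _ => 0) rfl hB 7
  have hv7 := V3 7
  have x17 := x1.seq (x2.seq (x3.seq (x4.seq (x5.seq (x6.seq x7)))))
  refine ⟨_, x17.mono ?_, ?_⟩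
  · simp only [eval_add, eval_mul, eval_ofNat, eval_one]
    simp only [hT5, eval_add, eval_mul, eval_comp, eval_X, eval_ofNat, eval_one] at hout ⊢
    omega
  · rw [mkStore_lt hB, Function.update_self, Function.update_self, t7, hrest5,
      Function.update_of_ne hI0.symm, Function.update_self, hout5, hout3]
    simp

end HarlowHayden


namespace HarlowHayden

/-! ### The inverter -/

/-- Decode the string of the second branch, and run the decoder backwards as if it had come from the
first branch. -/
noncomputable def inverterCircuit (m a : ℕ) (gs : List (Gate (m + 1 + a))) :
    List (Gate (m + (a + 3))) :=
  -- Wire layout: m input qubits, the qubit m to be decoded, a ancillas of the decoder, the constant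
  -- 1, and the wire that receives the decoded bit.
  toCircuit _ [.not m, .not (m + 1 + a)] ++ (gs.map (Gate.lift (by omega)) ++
    (toCircuit _ [.tof (m + 1 + a) m (m + 2 + a), .tof (m + 1 + a) (m + 2 + a) m] ++
      (inverseCircuit gs).map (Gate.lift (by omega))))

theorem encCircuit_inverterCircuit (m a : ℕ) (gs : List (Gate (m + 1 + a))) :
    encCircuit (inverterCircuit m a gs) = encGates [.not m, .not (m + 1 + a)] ++
      (encCircuit gs ++ (encGates [.tof (m + 1 + a) m (m + 2 + a),
        .tof (m + 1 + a) (m + 2 + a) m] ++ encCircuit (inverseCircuit gs))) := by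
  rw [inverterCircuit, encCircuit_append, encCircuit_append, encCircuit_append, encCircuit_lift,
    encCircuit_lift, encCircuit_toCircuit, encCircuit_toCircuit]
  · intro g hg
    simp only [List.mem_cons, List.not_mem_nil, or_false] at hg
    rcases hg with rfl | rfl <;> simp only [WGate.Valid] <;> omega
  · intro g hg
    simp only [List.mem_cons, List.not_mem_nil, or_false] at hg
    rcases hg with rfl | rfl <;> simp only [WGate.Valid] <;> omega

theorem addAncillas_ket {w : ℕ} (a : ℕ) (z : Fin w → Bool) :
    addAncillas a (ket z) = ket (Fin.append z fun _ => false) := by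
  funext z'
  simp only [addAncillas, ket_apply]
  by_cases h : z' = Fin.append z fun _ => false
  · subst h; simp
  · rw [if_neg h]
    split_ifs with h1 h2
    · exfalso
      apply h
      funext i
      refine Fin.addCases (fun j => ?_) (fun j => ?_) i
      · rw [Fin.append_left]; exact congrFun h2 j
      · rw [Fin.append_right]; exact h1 j
    · rfl
    · rfl

/-- Two additional wires: the first is `1`, the second is `e`. -/
def tailBits (w : ℕ) (e : Bool) : ℕ → Bool := fun i => if i = w then true else e

theorem slice_ketOf {w : ℕ} (μ : ℕ → Bool) (hw : μ w = true) (hw1 : μ (w + 1) = false) (e : Bool) :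
    slice w (tailBits w e) (ketOf (w + 2) μ) = if e then 0 else ket fun i : Fin w => μ i := by
  funext z
  rw [slice, ketOf, ket_apply]
  cases e
  · simp only [Bool.false_eq_true, if_false, ket_apply]
    congr 1
    refine propext ⟨fun h => funext fun i => ?_, fun h => funext fun i => ?_⟩
    · have := congrFun h (i.castLE (by omega))
      rwa [glue_castLE (by omega)] at this
    · subst h
      by_cases hi : i.val < w
      · simp [glue, hi]
      · have : i.val = w ∨ i.val = w + 1 := by omega
        rcases this with h | h <;> simp [glue, h, tailBits, hw, hw1]
  · rw [if_neg]
    · rfl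
    · intro h
      have := congrFun h ⟨w + 1, by omega⟩
      simp [glue, tailBits, hw1] at this

theorem runCircuit_tof {W i j k : ℕ} (h : (WGate.tof i j k).Valid W) (ψ : QState W)
    (z : Fin W → Bool) : runCircuit (toCircuit W [.tof i j k]) ψ z =
      ψ (Function.update z ⟨k, h.2.2.1⟩
        (xor (z ⟨k, h.2.2.1⟩) (z ⟨i, h.1⟩ && z ⟨j, h.2.1⟩))) := by
  have h' : i < W ∧ j < W ∧ k < W ∧ i ≠ j ∧ i ≠ k ∧ j ≠ k := h
  simp only [toCircuit, List.flatMap_cons, List.flatMap_nil, List.append_nil, WGate.toGates, h',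
    and_self, dif_pos, ne_eq, not_false_eq_true, runCircuit_cons, runCircuit_nil, Gate.apply]

theorem glue_tailBits {w W : ℕ} (hW : W = w + 2) (z : Fin w → Bool) (e e' : Bool) :
    Function.update (glue W z (tailBits w e)) ⟨w + 1, by omega⟩ e' =
      glue W z (tailBits w e') := by
  funext i
  by_cases hi : i = ⟨w + 1, by omega⟩
  · subst hi; simp [glue, tailBits]
  · have hi' : i.val ≠ w + 1 := fun h => hi (Fin.ext h)
    rw [Function.update_of_ne hi]
    by_cases h : i.val < w
    · simp [glue, h]
    · simp [glue, tailBits, show i.val = w by omega]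

/-- The middle gates implement |0⟩⟨1| on the decoded qubit in the part of the state where the last
wire is 1. Running the decoder backwards and reading one amplitude is then, by adjointness, an inner
product with the decoder's output on the first branch. -/
theorem inverterCircuit_apply {m a : ℕ} (gs : List (Gate (m + 1 + a))) (y u : Fin m → Bool) :
    runCircuit (inverterCircuit m a gs) (ket (Fin.append y fun _ => false))
      (glue _ (Fin.append (Fin.snoc (α := fun _ => Bool) u false) fun _ : Fin a => false)
        (tailBits (m + 1 + a) true)) =
    overlap (Fin.castAdd a (Fin.last m))
      (runCircuit gs (addAncillas a (ket (Fin.snoc (α := fun _ => Bool) u false))))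
      (runCircuit gs (addAncillas a (ket (Fin.snoc (α := fun _ => Bool) y true)))) := by
  have hW : m + (a + 3) = m + 1 + a + 2 := by omega
  have hle : m + 1 + a ≤ m + (a + 3) := by omega
  set d : Fin (m + 1 + a) := Fin.castAdd a (Fin.last m) with hd
  have hd' : (d : ℕ) = m := rfl
  set μ : ℕ → Bool := evalGates [.not m, .not (m + 1 + a)] (bitsOf y) with hμ
  have hμe : μ = Function.update (Function.update (bitsOf y) m true) (m + 1 + a) true := by
    have h1 : bitsOf y m = false := by simp [bitsOf]
    have h2 : bitsOf y (m + 1 + a) = false := by simp [bitsOf, show ¬ m + 1 + a < m by omega]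
    simp [hμ, WGate.eval, h1, h2, show (m + 1 + a) ≠ m by omega]
  have h0 : ket (Fin.append y fun _ => false) = ketOf (m + (a + 3)) (bitsOf y) := by
    rw [ketOf]
    congr 1
    funext i
    refine Fin.addCases (fun j => ?_) (fun j => ?_) i
    · simp [bitsOf]
    · simp [bitsOf]
  have h1 : runCircuit (toCircuit _ [.not m, .not (m + 1 + a)]) (ketOf (m + (a + 3)) (bitsOf y)) =
      ketOf (m + (a + 3)) μ := by
    rw [runCircuit_toCircuit, hμ]
    intro g hg
    simp only [List.mem_cons, List.not_mem_nil, or_false] at hg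
    rcases hg with rfl | rfl <;> simp only [WGate.Good] <;> omega
  have hμw : μ (m + 1 + a) = true := by simp [hμe]
  have hμw1 : μ (m + 1 + a + 1) = false := by
    simp [hμe, bitsOf, show (m + 1 + a) + 1 ≠ m by omega, show ¬ (m + 1 + a) + 1 < m by omega]
  have hres : (fun i : Fin (m + 1 + a) => μ i) =
      Fin.append (Fin.snoc (α := fun _ => Bool) y true) fun _ => false := by
    funext i
    refine Fin.addCases (fun j => ?_) (fun j => ?_) i
    · rw [Fin.append_left]
      refine Fin.lastCases ?_ (fun l => ?_) j
      · simp [hμe, show m ≠ (m + 1 + a) by omega]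
      · simp [hμe, bitsOf, show (l : ℕ) ≠ m by omega, show (l : ℕ) ≠ (m + 1 + a) by omega]
    · rw [Fin.append_right, hμe]
      change Function.update (Function.update (bitsOf y) m true) (m + 1 + a) true (m + 1 + j) = false
      rw [Function.update_of_ne (by omega), Function.update_of_ne (by omega), bitsOf,
        dif_neg (by omega)]
  have hs1 : ∀ e, slice (m + 1 + a) (tailBits (m + 1 + a) e) (ketOf (m + (a + 3)) μ) = if e then 0 else
      ket (Fin.append (Fin.snoc (α := fun _ => Bool) y true) fun _ => false) := by
    intro e
    rw [hW, slice_ketOf μ hμw hμw1, hres]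
  set ψ2 := runCircuit (gs.map (Gate.lift hle)) (ketOf (m + (a + 3)) μ) with hψ2
  set b := runCircuit gs
    (ket (Fin.append (Fin.snoc (α := fun _ => Bool) y true) fun _ : Fin a => false)) with hb
  have hs2 : ∀ e, slice (m + 1 + a) (tailBits (m + 1 + a) e) ψ2 = if e then 0 else b := by
    intro e
    rw [hψ2, slice_runCircuit_lift, hs1, hb]
    cases e
    · rfl
    · simp only [if_true, ← circuitLin_apply, map_zero]
  have ew : m + 2 + a = (m + 1 + a) + 1 := by omega
  set ψ3 := runCircuit (toCircuit (m + (a + 3)) [.tof (m + 1 + a) m (m + 1 + a + 1),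
    .tof (m + 1 + a) (m + 1 + a + 1) m]) ψ2 with hψ3
  -- With the constant wire as a control these are two controlled NOTs. They take (1, 0) on the
  -- decoded and the last wire to (0, 1) and fix (0, 0), so the slice with last wire 1 is the part
  -- of `b` with decoded bit 1, relabelled as 0.
  have hs3 : slice (m + 1 + a) (tailBits (m + 1 + a) true) ψ3 =
      fun z => if z d = false then b (Function.update z d true) else 0 := by
    funext z
    have hg0 : ∀ (z : Fin (m + 1 + a) → Bool) (e : Bool) (h : m < m + (a + 3)),
        glue (m + (a + 3)) z (tailBits (m + 1 + a) e) ⟨m, h⟩ = z d :=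
      fun z e h => glue_castLE hle z _ d
    have hg1 : ∀ (z : Fin (m + 1 + a) → Bool) (e : Bool) (h : (m + 1 + a) < m + (a + 3)),
        glue (m + (a + 3)) z (tailBits (m + 1 + a) e) ⟨m + 1 + a, h⟩ = true := fun z e h => by
      simp [glue, tailBits]
    have hg2 : ∀ (z : Fin (m + 1 + a) → Bool) (e : Bool) (h : (m + 1 + a) + 1 < m + (a + 3)),
        glue (m + (a + 3)) z (tailBits (m + 1 + a) e) ⟨m + 1 + a + 1, h⟩ = e := fun z e h => by
      simp [glue, tailBits]
    have hu : ∀ (z : Fin (m + 1 + a) → Bool) (e c : Bool) (h : m < m + (a + 3)),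
        Function.update (glue (m + (a + 3)) z (tailBits (m + 1 + a) e)) ⟨m, h⟩ c =
          glue _ (Function.update z d c) (tailBits (m + 1 + a) e) :=
      fun z e c h => update_glue hle z _ d c
    have v1 : (WGate.tof (m + 1 + a) m (m + 1 + a + 1)).Valid (m + (a + 3)) := by
      simp only [WGate.Valid]; omega
    have v2 : (WGate.tof (m + 1 + a) (m + 1 + a + 1) m).Valid (m + (a + 3)) := by
      simp only [WGate.Valid]; omega
    change ψ3 (glue _ z (tailBits (m + 1 + a) true)) = _
    rw [hψ3, show [WGate.tof (m + 1 + a) m (m + 1 + a + 1), .tof (m + 1 + a) (m + 1 + a + 1) m] =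
      [.tof (m + 1 + a) m (m + 1 + a + 1)] ++ [.tof (m + 1 + a) (m + 1 + a + 1) m] from rfl,
      toCircuit_append, runCircuit_append,
      runCircuit_tof v2, hg0, hg1, hg2, hu, runCircuit_tof v1, hg0, hg1, hg2, glue_tailBits hW]
    change slice (m + 1 + a) (tailBits (m + 1 + a) _) ψ2 _ = _
    rw [hs2]
    cases hz : z d <;> simp
  rw [inverterCircuit, runCircuit_append, runCircuit_append, runCircuit_append, h0, h1, ew, ← hψ2,
    ← hψ3]
  change slice (m + 1 + a) (tailBits (m + 1 + a) true)
    (runCircuit ((inverseCircuit gs).map (Gate.lift hle)) ψ3) _ = _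
  rw [slice_runCircuit_lift, hs3, addAncillas_ket, addAncillas_ket, ← hb]
  -- The amplitude is written as an inner product with a basis state, and the inverse circuit is
  -- moved to the other side.
  refine (braket_ket _ _).symm.trans ?_
  rw [← braket_inverseCircuit]
  simp only [braket, overlap, mul_ite, mul_zero]

end HarlowHayden


namespace HarlowHayden

open Polynomial

/-! ### Hardness of decoding -/

theorem splice_mkStore {B' B : ℕ} (h : B' ≤ B) (s rest : Store) (out : List Bool)
    (σ κ : ℕ → ℕ) :
    splice B' s (mkStore B rest out σ κ) = mkStore B (splice B' s rest) out σ κ := by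
  funext r
  by_cases hr : r < B'
  · rw [splice, if_pos hr, mkStore_lt (by omega), splice, if_pos hr]
  · by_cases hr' : r < B
    · rw [splice, if_neg hr, mkStore_lt hr', mkStore_lt hr', splice, if_neg hr]
    · rw [splice, if_neg hr, mkStore, mkStore, if_neg hr', if_neg hr']

/-- The decoding machine is started with variables and parsing registers in use. It cannot notice
them, as they lie above its registers. Splicing at `regBound + 1` makes sure that register 0, with
the output, is included. -/
theorem Exec.of_runs {M : Prog} {x : List Bool} {t : ℕ} {s : Store}
    (h : Runs M (inputStore x) t s) {B : ℕ} (hB : M.regBound + 1 ≤ B) (out : List Bool)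
    (σ κ : ℕ → ℕ) : Exec M t (mkStore B (inputStore x) out σ κ)
      (mkStore B (splice (M.regBound + 1) s (inputStore x)) out σ κ) := by
  refine ⟨t, le_rfl, ?_⟩
  have := h.splice (B := M.regBound + 1) (by omega) (mkStore B (inputStore x) out σ κ)
  rw [splice_mkStore hB, splice_mkStore hB] at this
  have e : splice (M.regBound + 1) (inputStore x) (inputStore x) = inputStore x := by
    funext r; simp [splice]
  rwa [e] at this

/-- The inverters made from polynomial-time decoders are computed in polynomial time. -/
theorem polyTime_inverter {M c : Prog} {R : ℕ} {p S TM : ℕ[X]} {a : ℕ → ℕ}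
    {gs : ∀ n, List (Gate (p.eval n + 1 + a n))}
    (h : ∀ n, OutputsWithin M (encNat (p.eval n) ++
        encNat ((Stmt.generator c R).vars (parameters p S n) vFresh) ++
        encGates ((Stmt.generator c R).gates (parameters p S n)))
      (TM.eval (encNat (p.eval n) ++
        encNat ((Stmt.generator c R).vars (parameters p S n) vFresh) ++
        encGates ((Stmt.generator c R).gates (parameters p S n))).length)
      (encNat (a n) ++ encCircuit (gs n))) :
    QFamily.PolyTime (p := fun n => p.eval n)
      fun n => ⟨a n + 3, inverterCircuit (p.eval n) (a n) (gs n)⟩ := by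
  set B := M.regBound + 3 with hB
  obtain ⟨q, T1, h1⟩ := exists_encoder c R p S (B := B) (by omega)
  obtain ⟨T3, h3⟩ := exists_inverterProg (B := B) (F := M.regBound + 1) (I := M.regBound + 2)
    (by omega) (by omega) (by omega) (by omega) (by omega)
  refine ⟨.seq q (.seq M (inverterProg B (M.regBound + 1) (M.regBound + 2))),
    T1 + (TM.comp (X + T1) + T3.comp (T1 + (X + T1) + TM.comp (X + T1))), fun n => ?_⟩
  obtain ⟨hv, x1⟩ := h1 n
  obtain ⟨t, s, ht, hr, hs⟩ := h n
  set x := encNat (p.eval n) ++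
    encNat ((Stmt.generator c R).vars (parameters p S n) vFresh) ++
    encGates ((Stmt.generator c R).gates (parameters p S n)) with hx
  have hlen : x.length ≤ n + T1.eval n := by
    have := x1.length_le 0
    rw [mkStore_lt (by omega)] at this
    simpa [inputStore] using this
  have ht' : t ≤ TM.eval (n + T1.eval n) := ht.trans (natPoly_eval_mono TM hlen)
  have x2 := Exec.of_runs hr (B := B) (by omega) []
    ((Stmt.generator c R).vars (parameters p S n)) (fun _ => 0)
  set rest := splice (M.regBound + 1) s (inputStore x) with hrest
  have r0 : rest 0 = encNat (a n) ++ encCircuit (gs n) := by simp [hrest, splice, hs]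
  have hlen0 : (rest 0).length ≤ n + T1.eval n + TM.eval (n + T1.eval n) := by
    have := hr.length_le 0
    rw [hs, ← r0] at this
    simp only [inputStore, if_true] at this
    omega
  obtain ⟨s', x3, hs'⟩ := h3 (p.eval n) (a n) (gs n) rest
    ((Stmt.generator c R).vars (parameters p S n))
    (T1.eval n + (n + T1.eval n) + TM.eval (n + T1.eval n)) r0
    (by simp [hrest, splice, inputStore]) (by simp [hrest, splice, inputStore])
    (by rw [(Stmt.wf_generator c R).vars_eq (by simp [params])]; simp [parameters])
    (fun v => (hv v).trans (by omega)) (hlen0.trans (by omega))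
  obtain ⟨t', ht'', hrun⟩ := x1.seq (x2.seq x3)
  refine ⟨t', s', ht''.trans ?_, hrun, ?_⟩
  · simp only [eval_add, eval_comp, eval_X]
    omega
  · rw [hs', encCircuit_inverterCircuit]

/-- Adjoining ancilla qubits is linear. -/
noncomputable def addAncillasLin (w a : ℕ) : QState w →ₗ[ℂ] QState (w + a) where
  toFun := addAncillas a
  map_add' u v := by
    funext z
    simp only [addAncillas, Pi.add_apply]
    split_ifs <;> simp
  map_smul' c v := by
    funext z
    simp only [addAncillas, Pi.smul_apply, RingHom.id_apply, smul_eq_mul]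
    split_ifs <;> simp

/-- A good decoder yields a good inverter. -/
theorem inversionProb_ge {p : ℕ → ℕ} {f : ∀ n, (Fin n → Bool) → Fin (p n) → Bool}
    {A : QFamily p} {n a h : ℕ} (hn : n ≤ p n) {gs : List (Gate (p n + 1 + a))}
    (hA : A n = ⟨a + 3, inverterCircuit (p n) a gs⟩) {Φ : TriState (p n + 1) h}
    {γ : (Fin n → Bool) → Fin h → Bool} (hΦ : IsBranchState Φ (branches (f n)) γ) {c : ℝ}
    (hc : 1 / 2 < c) (hgs : c ≤ bellFidelity (Fin.castAdd a (Fin.last (p n)))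
      (applyR (fun v => runCircuit gs (addAncillas a v)) Φ)) :
    (2 * c - 1) ^ 2 ≤ inversionProb f A n := by
  set d := Fin.castAdd a (Fin.last (p n)) with hd
  set D := circuitLin gs ∘ₗ addAncillasLin (p n + 1) a with hD
  have hDa : ∀ v, D v = runCircuit gs (addAncillas a v) := fun v => by
    rw [hD, LinearMap.comp_apply, circuitLin_apply]; rfl
  have hle := hΦ.sum_overlap_ge D d (fun b x => by
    simp only [hDa, addAncillas_ket]
    rw [sum_norm_sq_runCircuit, sum_norm_sq_ket])
  have hfid : c ≤ bellFidelity d (applyR D Φ) := by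
    rwa [show (⇑D : QState _ → QState _) = fun v => runCircuit gs (addAncillas a v) from funext hDa]
  set ov : (Fin n → Bool) → ℂ := fun x =>
    overlap d (D (ket (branches (f n) false x))) (D (ket (branches (f n) true x))) with hov
  have h2n : (0 : ℝ) < 2 ^ n := by positivity
  -- Of all successful outcomes only one is kept: the padded string x, last bit of `R` 0, ancillas
  -- of the decoder 0, both additional wires 1. Its first n bits are x.
  have hprob : (∑ x, ‖ov x‖ ^ 2) / 2 ^ n ≤ inversionProb f A n := by
    rw [inversionProb]
    gcongr with x
    rw [hA]
    dsimp only
    set z := glue (p n + (a + 3)) (Fin.append (Fin.snoc (α := fun _ => Bool)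
      (padZeros (p n) x) false) fun _ : Fin a => false) (tailBits (p n + 1 + a) true) with hz
    have hfirst : firstBits n z = x := by
      funext i
      have e : (⟨i, by omega⟩ : Fin (p n + (a + 3))) =
          (Fin.castAdd a (Fin.castSucc (⟨i, by omega⟩ : Fin (p n)))).castLE (by omega) := rfl
      simp only [firstBits, show i.val < p n + (a + 3) by omega, dif_pos]
      rw [e, hz, glue_castLE (by omega), Fin.append_left, Fin.snoc_castSucc]
      simp [padZeros, firstBits]
    refine le_trans (le_of_eq ?_) (Finset.single_le_sum (fun z _ => ?_) (Finset.mem_univ z))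
    · rw [hfirst, if_pos rfl, hz, inverterCircuit_apply, hov]
      simp only [hDa, branches]
      rfl
    · split_ifs <;> positivity
  -- Cauchy–Schwarz over the 2ⁿ arguments passes from the average of Re ω to the average of |ω|².
  have hsq : (∑ x, (ov x).re) ^ 2 ≤ 2 ^ n * ∑ x, ‖ov x‖ ^ 2 := by
    have h1 := sq_sum_le_card_mul_sum_sq (s := Finset.univ) (f := fun x => (ov x).re)
    have h2 : ∑ x, (ov x).re ^ 2 ≤ ∑ x, ‖ov x‖ ^ 2 := Finset.sum_le_sum fun x _ => by
      rw [← sq_abs]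
      exact pow_le_pow_left₀ (abs_nonneg _) (Complex.abs_re_le_norm _) 2
    have h3 : ((Finset.univ : Finset (Fin n → Bool)).card : ℝ) = 2 ^ n := by simp
    rw [h3] at h1
    exact h1.trans (by gcongr)
  have h4 : 2 ^ n * (2 * c - 1) ≤ ∑ x, (ov x).re := le_trans (by gcongr) hle
  refine le_trans ?_ hprob
  rw [le_div_iff₀ h2n]
  have h5 : (2 ^ n * (2 * c - 1)) ^ 2 ≤ (∑ x, (ov x).re) ^ 2 :=
    pow_le_pow_left₀ (mul_nonneg h2n.le (by linarith)) h4 2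
  have h6 : (2 : ℝ) ^ n * ((2 * c - 1) ^ 2 * 2 ^ n) ≤ 2 ^ n * ∑ x, ‖ov x‖ ^ 2 := by
    refine le_trans (le_of_eq (by ring)) (h5.trans hsq)
  exact le_of_mul_le_mul_left h6 h2n

/-- A decoder of fidelity c gives for every n a circuit that inverts with probability at least (2c −
1)². These circuits form a uniform polynomial-time family, because the decoding machine itself is
run inside the machine that writes them. -/
theorem not_decodingInPolyTime {p : ℕ[X]} {f : ∀ n : ℕ, (Fin n → Bool) → (Fin (p.eval n) → Bool)}
    (hf : IsInjectiveQuantumOWF (p := fun n => p.eval n) f) {c : ℝ} (hc : 1 / 2 < c) :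
    ¬ DecodingInPolyTime c := by
  rintro ⟨M, TM, hM⟩
  obtain ⟨⟨q, T, hq⟩, hinj, hhard⟩ := hf
  -- Counting: an injection of 2ⁿ strings needs at least as many targets. So the argument fits into
  -- `R` next to the last qubit.
  have hn : ∀ n, n ≤ p.eval n := by
    intro n
    have := Fintype.card_le_of_injective _ (hinj n)
    simpa using (Nat.pow_le_pow_iff_right (a := 2) (by omega)).mp (by simpa using this)
  set R := max q.regBound 1 with hR
  -- Argument length plus running time bounds every stack during the run; the added 1 keeps the
  -- arrays from being empty.
  set S : ℕ[X] := X + T + 1 with hS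
  have h0 : ∀ n, parameters p S n 0 = n := fun n => by simp [parameters]
  have h1 : ∀ n, parameters p S n 1 = p.eval n := fun n => by simp [parameters]
  have h2 : ∀ n, n + T.eval n + 1 ≤ parameters p S n vSize := fun n => by simp [parameters, hS]
  have hdec : ∀ n, ∃ (a : ℕ) (gs : List (Gate (p.eval n + 1 + a))),
      OutputsWithin M (generatorInstance q R (p.eval n) (parameters p S n)).encode
        (TM.eval (generatorInstance q R (p.eval n) (parameters p S n)).encode.length)
        (encNat a ++ encCircuit gs) ∧
      c ≤ bellFidelity (Fin.castAdd a (Fin.last (p.eval n)))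
        (applyR (fun v => runCircuit gs (addAncillas a v))
          (generatorInstance q R (p.eval n) (parameters p S n)).state) := by
    intro n
    obtain ⟨out, ho, a, gs, rfl, hfid⟩ := hM (generatorInstance q R (p.eval n) (parameters p S n))
      (promise_generatorInstance (le_max_left _ _) (le_max_right _ _) (hn n) (h0 n) (h1 n) (h2 n)
        (hinj n) (hq n))
    exact ⟨a, gs, ho, hfid⟩
  choose a gs hout hfid using hdec
  simp only [fun n => encode_generatorInstance (c := q) (R := R) (le_max_left _ _)
    (le_max_right _ _) (hn n) (h0 n) (h1 n) (h2 n) (hq n)] at hout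
  -- The bound 1/n is already enough, since it falls below the constant (2c − 1)² for large n.
  have hA := hhard _ (polyTime_inverter hout) 1
  have hpos : 0 < (2 * c - 1) ^ 2 := by
    have : 0 < 2 * c - 1 := by linarith
    positivity
  obtain ⟨N, hN⟩ := exists_nat_gt (1 / (2 * c - 1) ^ 2)
  obtain ⟨n, hlt, hnN⟩ := (hA.and (eventually_ge_atTop (N + 1))).exists
  obtain ⟨γ, hγ⟩ := isBranchState_generatorInstance (c := q) (R := R) (le_max_left _ _)
    (le_max_right _ _) (hn n) (h0 n) (h1 n) (h2 n) (hq n)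
  have hge := inversionProb_ge (p := fun n => p.eval n) (f := f) (n := n)
    (A := fun n => ⟨a n + 3, inverterCircuit (p.eval n) (a n) (gs n)⟩) (hn n) rfl hγ hc (hfid n)
  have hn0 : (N : ℝ) < n := by exact_mod_cast hnN
  have hnpos : (0 : ℝ) < n := lt_of_le_of_lt (by positivity) hn0
  rw [div_lt_iff₀ hpos] at hN
  rw [pow_one, lt_div_iff₀ hnpos] at hlt
  nlinarith [mul_le_mul_of_nonneg_right hge hnpos.le, mul_lt_mul_of_pos_right hn0 hpos]

end HarlowHayden


theorem mainTheorem2 :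
    ((∃ (p : Polynomial ℕ) (f : ∀ n : ℕ, (Fin n → Bool) → (Fin (p.eval n) → Bool)),
        HarlowHayden.IsInjectiveQuantumOWF (p := fun n => p.eval n) f) →
      ∀ c : ℝ, 1 / 2 < c → ¬ HarlowHayden.DecodingInPolyTime c) ∧
    (∀ (n m : ℕ) (f : (Fin n → Bool) → (Fin m → Bool)), Function.Injective f →
      ∀ U : Matrix.unitaryGroup (Fin (m + 1) → Bool) ℂ,
        HarlowHayden.DistillsBellPair U (HarlowHayden.owfState f) →
        ∀ x : Fin n → Bool,
          ((HarlowHayden.fixLast false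
                (U : Matrix (Fin (m + 1) → Bool) (Fin (m + 1) → Bool) ℂ)).conjTranspose *
              HarlowHayden.fixLast true
                (U : Matrix (Fin (m + 1) → Bool) (Fin (m + 1) → Bool) ℂ)).mulVec
              (HarlowHayden.ket (f x)) =
            HarlowHayden.ket (HarlowHayden.padZeros m x)) := by
  exact ⟨fun ⟨_, _, hf⟩ _ hc => HarlowHayden.not_decodingInPolyTime hf hc,
    fun _ _ f _ U hU x => HarlowHayden.fixLast_mulVec_ket f U hU x⟩
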